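/- Let $M=\{x^2+y^2\le 1\}$ be the closed Euclidean unit disc, $SM=M\times\mathbb S^1$ with the measure $d\mathrm x\,d\theta$, $\|\cdot\|$ the norm of $L^2(SM)$ and $\|\cdot\|_M$ that of $L^2(M)$ (complex-valued functions). Let $a\in C^0(M,\mathbb C)$. In fan-beam coordinates $(\beta,\alpha)\in\mathbb S^1\times[-\pi/2,\pi/2]$ on the ingoing boundary $\partial_+SM$, put $\mathrm x(\beta)=(\cos\beta,\sin\beta)$, $\theta=\beta+\pi+\alpha$ and $\gamma(t)=\mathrm x(\beta)+t(\cos\theta,\sin\theta)$; the attenuated X-ray transform of $f\in L^2(SM)$ is $$I_af(\beta,\alpha)=\int_0^{2\cos\alpha} f(\gamma(t),\theta)\exp\Big(\int_0^t a(\gamma(s))\,ds\Big)dt .$$ Equality of transforms is equality $d\beta\,d\alpha$-almost everywhere, the integrals converging absolutely for almost every $(\beta,\alpha)$. For $f\in L^2(SM)$ let $f_0(\mathrm x)=\frac1{2\pi}\int_0^{2\pi} f(\mathrm x,\theta)\,d\theta$ and $f_{k,\pm}(\mathrm x)=\frac1{2\pi}\int_0^{2\pi} f(\mathrm x,\theta)e^{\mp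 ik\theta}d\theta$, $k\ge1$. For $\kappa\ge1$ let $$\|f\|_\kappa^2=2\pi\Big(\|f_0\|_M^2+\sum_{k\ge1}\kappa^k\big(\|f_{k,+}\|_M^2+\|f_{k,-}\|_M^2\big)\Big),\qquad L^{2,\kappa}(SM)=\{f\in L^2(SM):\|f\|_\kappa<\infty\}.$$ Let $H^{\mathrm{sol}}_k$ ($k\ge1$) be the set of all $e^{ik\theta}u(\mathrm x)+e^{-ik\theta}v(\mathrm x)$ with $u,v\in L^2(M)$, $u$ holomorphic and $v$ antiholomorphic in the open disc. Let $X_\perp=\sin\theta\,\partial_x-\cos\theta\,\partial_y$, let $a_\infty=\sup_M|a|$, let $C_P$ be the smallest constant with $\|u\|_M^2\le C_P\|\nabla u\|_M^2$ for all $u\in H^1_0(M)$, and set $C=4+8a_\infty^2C_P$. **Theorem.** There is a linear map $L^{2,C}(SM)\to L^2(SM)$, $f\mapsto g$, such that for every $f\in L^{2,C}(SM)$ we have $I_ag=I_af$, $$g=g_0+X_\perp g_s+\sum_{k=1}^\infty g_k\quad\text{(convergence in }L^2(SM)),\qquad g_0\in L^2(M),\quad g_s\in H^1_0(M),\quad g_k\in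 H^{\mathrm{sol}}_k\ (k\ge1),$$ and $\|g\|^2\le 4\|f\|_C^2$. -/

import Mathlib

open MeasureTheory Filter Topology
open scoped ENNReal ContDiff

noncomputable section

namespace AttenuatedXray

/-- The angular variable lives on `AddCircle (2π)`. -/
instance twoPiPos : Fact (0 < 2 * Real.pi) := ⟨Real.two_pi_pos⟩

/-- The circle `ℝ / 2πℤ` of angles; its `volume` is `dθ`, of total mass `2π`. -/
abbrev Ang : Type := AddCircle (2 * Real.pi)

/-- The closed unit disc, in the plane `ℂ` (with `x + iy` for the point `(x, y)`). -/
def disc : Set ℂ := Metric.closedBall 0 1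

/-- Lebesgue measure on the disc. -/
def discMeasure : Measure ℂ := volume.restrict disc

/-- The measure `dx dθ` on `SM = M × S¹`. -/
def smMeasure : Measure (ℂ × Ang) := discMeasure.prod volume

/-- `L²(M)`, complex-valued. -/
abbrev L2M : Type := Lp ℂ 2 discMeasure

/-- `L²(SM)`, complex-valued. -/
abbrev L2SM : Type := Lp ℂ 2 smMeasure

instance discMeasure_finite : IsFiniteMeasure discMeasure := by
  have h : IsCompact disc := isCompact_closedBall 0 1
  exact ⟨by rw [discMeasure, Measure.restrict_apply_univ]; exact h.measure_lt_top⟩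

instance smMeasure_finite : IsFiniteMeasure smMeasure := by
  unfold smMeasure; infer_instance

/-! ### Products of a function of position and a function of the angle -/

theorem memLp_tensor (c : C(Ang, ℂ)) (u : L2M) :
    MemLp (fun p : ℂ × Ang => c p.2 * u p.1) 2 smMeasure := by
  have hu : MemLp (fun p : ℂ × Ang => u p.1) 2 smMeasure := (Lp.memLp u).comp_fst volume
  have hc : AEStronglyMeasurable (fun p : ℂ × Ang => c p.2) smMeasure :=
    (c.continuous.comp continuous_snd).aestronglyMeasurable
  refine hu.of_le_mul (c := ‖c‖) (hc.mul hu.1) (Eventually.of_forall fun p => ?_)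
  rw [norm_mul]
  exact mul_le_mul_of_nonneg_right (c.norm_coe_le_norm p.2) (norm_nonneg _)

/-- The element `(x, θ) ↦ c(θ) u(x)` of `L²(SM)`. -/
def tensor (c : C(Ang, ℂ)) (u : L2M) : L2SM := (memLp_tensor c u).toLp _

/-- `θ ↦ cos θ`, the real part of `fourier 1 θ = e^{iθ}`. -/
def cosA : C(Ang, ℂ) :=
  ⟨fun θ => ((fourier 1 θ : ℂ).re : ℂ), Complex.continuous_ofReal.comp
    (Complex.continuous_re.comp (fourier 1 : C(Ang, ℂ)).continuous)⟩

/-- `θ ↦ sin θ`, the imaginary part of `fourier 1 θ = e^{iθ}`. -/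
def sinA : C(Ang, ℂ) :=
  ⟨fun θ => ((fourier 1 θ : ℂ).im : ℂ), Complex.continuous_ofReal.comp
    (Complex.continuous_im.comp (fourier 1 : C(Ang, ℂ)).continuous)⟩

/-! ### The attenuated X-ray transform -/

/-- The measure `dβ dα` on the ingoing boundary, in fan-beam coordinates `(β, α)`, with `β` on the
circle and `-π/2 ≤ α ≤ π/2`. -/
def inMeasure : Measure (Ang × ℝ) :=
  (volume : Measure Ang).prod (volume.restrict (Set.Icc (-(Real.pi / 2)) (Real.pi / 2)))

/-- The angle `β + π + α` of the ingoing direction with fan-beam coordinates `q = (β, α)`. -/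
def rayAngle (q : Ang × ℝ) : Ang := q.1 + ((Real.pi + q.2 : ℝ) : Ang)

/-- The point at time `t` of the unit speed line that starts at the boundary point `e^{iβ}` in the
direction `e^{i(β + π + α)}`. -/
def rayPoint (q : Ang × ℝ) (t : ℝ) : ℂ := fourier 1 q.1 + t * fourier 1 (rayAngle q)

/-- The length `2 cos α` of the chord along which the line stays in the disc. -/
def exitTime (q : Ang × ℝ) : ℝ := 2 * Real.cos q.2

/-- The integrand `f(φ_t) exp (∫₀ᵗ a(γ(s)) ds)` of the attenuated X-ray transform. -/
def rayIntegrand (a : ℂ → ℂ) (f : ℂ × Ang → ℂ) (q : Ang × ℝ) (t : ℝ) : ℂ :=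
  f (rayPoint q t, rayAngle q) * Complex.exp (∫ s in (0 : ℝ)..t, a (rayPoint q s))

/-- The attenuated X-ray transform `I_a f`, in fan-beam coordinates. -/
def xray (a : ℂ → ℂ) (f : ℂ × Ang → ℂ) (q : Ang × ℝ) : ℂ :=
  ∫ t in (0 : ℝ)..exitTime q, rayIntegrand a f q t

/-! ### The space `H¹₀(M)` -/

/-- Smooth functions with compact support in the open unit disc. -/
structure IsTest (φ : ℂ → ℂ) : Prop where
  smooth : ContDiff ℝ ∞ φ
  compact : HasCompactSupport φ
  supp : tsupport φ ⊆ Metric.ball 0 1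

/-- The classical partial derivative in `x`. -/
def partialX (φ : ℂ → ℂ) (z : ℂ) : ℂ := fderiv ℝ φ z 1

/-- The classical partial derivative in `y`. -/
def partialY (φ : ℂ → ℂ) (z : ℂ) : ℂ := fderiv ℝ φ z Complex.I

/-- The space `H¹₀(M)`: functions `u ∈ L²(M)` with weak gradient `(dx, dy)` in `L²(M)` that are
limits of test functions in the `H¹` norm. The gradient is determined by `u`. -/
structure H10 where
  /-- the function -/
  u : L2M
  /-- its weak derivative in `x` -/
  dx : L2M
  /-- its weak derivative in `y` -/
  dy : L2M
  weak_dx : ∀ φ, IsTest φ →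
    ∫ z, u z * partialX φ z ∂discMeasure = -∫ z, dx z * φ z ∂discMeasure
  weak_dy : ∀ φ, IsTest φ →
    ∫ z, u z * partialY φ z ∂discMeasure = -∫ z, dy z * φ z ∂discMeasure
  approx : ∃ φ : ℕ → ℂ → ℂ, (∀ n, IsTest (φ n)) ∧
    Tendsto (fun n => eLpNorm (fun z => u z - φ n z) 2 discMeasure) atTop (𝓝 0) ∧
    Tendsto (fun n => eLpNorm (fun z => dx z - partialX (φ n) z) 2 discMeasure) atTop (𝓝 0) ∧
    Tendsto (fun n => eLpNorm (fun z => dy z - partialY (φ n) z) 2 discMeasure) atTop (𝓝 0)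

/-- `X_⊥ u = sin θ ∂_x u - cos θ ∂_y u`. -/
def Xperp (u : H10) : L2SM := tensor sinA u.dx - tensor cosA u.dy

/-- The Poincaré constant of the disc: the least `C > 0` with `‖u‖² ≤ C ‖∇u‖²` on `H¹₀(M)`. -/
def poincareConst : ℝ :=
  sInf {C : ℝ | 0 < C ∧ ∀ u : H10, ‖u.u‖ ^ 2 ≤ C * (‖u.dx‖ ^ 2 + ‖u.dy‖ ^ 2)}

/-- The supremum of `|a|` on the disc. -/
def supNorm (a : ℂ → ℂ) : ℝ := ⨆ z : disc, ‖a z‖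

/-- The constant `C = 4 + 8 a_∞² C_P`. -/
def stabConst (a : ℂ → ℂ) : ℝ := 4 + 8 * supNorm a ^ 2 * poincareConst

/-! ### The spaces `H_k^sol` -/

/-- `u` belongs to `L²(ker ∂̄)`: it is holomorphic in the open disc. -/
def IsHolo (u : L2M) : Prop :=
  ∃ h : ℂ → ℂ, DifferentiableOn ℂ h (Metric.ball 0 1) ∧ u =ᵐ[discMeasure] h

/-- `u` belongs to `L²(ker ∂)`: it is antiholomorphic in the open disc. -/
def IsAntiholo (u : L2M) : Prop :=
  ∃ h : ℂ → ℂ, DifferentiableOn ℂ (fun z => (starRingEnd ℂ) (h z)) (Metric.ball 0 1) ∧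
    u =ᵐ[discMeasure] h

/-- `H_k^sol`: all `e^{ikθ} u(x) + e^{-ikθ} v(x)` with `u` holomorphic and `v` antiholomorphic. -/
def Hsol (k : ℕ) : Set L2SM :=
  {g | ∃ u v : L2M, IsHolo u ∧ IsAntiholo v ∧
    g = tensor (fourier (k : ℤ)) u + tensor (fourier (-(k : ℤ))) v}

/-! ### The spaces `L^{2,κ}(SM)` -/

/-- The angular moment `x ↦ (2π)⁻¹ ∫ f(x, θ) e^{-inθ} dθ`, that is, `f_0` for `n = 0` and `f_{k,±}`
for `n = ±k`. -/
def moment (n : ℤ) (f : ℂ × Ang → ℂ) (x : ℂ) : ℂ := fourierCoeff (fun θ => f (x, θ)) n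

/-- The square of the norm of `L²(M)`, with values in `[0, ∞]`. -/
def sqNormM (h : ℂ → ℂ) : ℝ≥0∞ := eLpNorm h 2 discMeasure ^ 2

/-- `‖f‖_κ² = 2π (‖f_0‖² + ∑_{k ≥ 1} κ^k (‖f_{k,+}‖² + ‖f_{k,-}‖²))`, with values in `[0, ∞]`. -/
def wNormSq (κ : ℝ) (f : ℂ × Ang → ℂ) : ℝ≥0∞ :=
  ENNReal.ofReal (2 * Real.pi) * (sqNormM (moment 0 f) +
    ∑' k : ℕ, ENNReal.ofReal κ ^ (k + 1) *
      (sqNormM (moment (k + 1 : ℤ) f) + sqNormM (moment (-(k + 1 : ℤ)) f)))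

theorem ae_integrable_fibre (f : L2SM) :
    ∀ᵐ x ∂discMeasure, Integrable (fun θ : Ang => f (x, θ)) volume :=
  ((Lp.memLp f).integrable (by norm_num)).prod_right_ae

theorem integrable_haar {h : Ang → ℂ} (hh : Integrable h volume) :
    Integrable h AddCircle.haarAddCircle := by
  rw [AddCircle.volume_eq_smul_haarAddCircle] at hh
  exact (integrable_smul_measure (by simpa using Real.pi_pos) ENNReal.ofReal_ne_top).1 hh

theorem integrable_fourier_smul {h : Ang → ℂ} (hh : Integrable h volume) (n : ℤ) :
    Integrable (fun θ => fourier n θ • h θ) AddCircle.haarAddCircle := by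
  refine (integrable_haar hh).bdd_mul (c := 1)
    (fourier n : C(Ang, ℂ)).continuous.aestronglyMeasurable (Eventually.of_forall fun θ => ?_)
  exact (Circle.norm_coe _).le

theorem aestronglyMeasurable_moment (n : ℤ) (f : L2SM) :
    AEStronglyMeasurable (moment n f) discMeasure := by
  have h : StronglyMeasurable (fun p : ℂ × Ang => fourier (-n) p.2 • f p) :=
    ((fourier (-n) : C(Ang, ℂ)).continuous.comp continuous_snd).stronglyMeasurable.smul
      (Lp.stronglyMeasurable f)
  exact (h.integral_prod_right' (ν := AddCircle.haarAddCircle)).aestronglyMeasurable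

theorem moment_congr {f g : ℂ × Ang → ℂ} (h : f =ᵐ[smMeasure] g) (n : ℤ) :
    moment n f =ᵐ[discMeasure] moment n g := by
  filter_upwards [Measure.ae_ae_of_ae_prod h] with x hx
  have hx' : (fun θ => f (x, θ)) =ᵐ[AddCircle.haarAddCircle] fun θ => g (x, θ) := by
    rw [AddCircle.volume_eq_smul_haarAddCircle] at hx
    have hc : ENNReal.ofReal (2 * Real.pi) ≠ 0 := by simpa using Real.pi_pos
    exact (Measure.ae_ennreal_smul_measure_iff hc).1 hx
  refine integral_congr_ae ?_
  filter_upwards [hx'] with θ hθ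
  rw [hθ]

theorem moment_add (n : ℤ) (f g : L2SM) :
    moment n (f + g : L2SM) =ᵐ[discMeasure] fun x => moment n f x + moment n g x := by
  filter_upwards [moment_congr (Lp.coeFn_add f g) n, ae_integrable_fibre f,
    ae_integrable_fibre g] with x hx hf hg
  rw [hx]
  simp only [moment, fourierCoeff, Pi.add_apply, smul_add]
  exact integral_add (integrable_fourier_smul hf _) (integrable_fourier_smul hg _)

theorem moment_smul (n : ℤ) (c : ℂ) (f : L2SM) :
    moment n (c • f : L2SM) =ᵐ[discMeasure] c • moment n f := by
  filter_upwards [moment_congr (Lp.coeFn_smul c f) n] with x hx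
  rw [hx]
  simp only [moment, fourierCoeff, Pi.smul_apply]
  rw [← integral_smul]
  simp only [smul_comm c]

theorem sqNormM_add (n : ℤ) (f g : L2SM) :
    sqNormM (moment n (f + g : L2SM)) ≤ 2 * (sqNormM (moment n f) + sqNormM (moment n g)) := by
  unfold sqNormM
  rw [eLpNorm_congr_ae (moment_add n f g)]
  have h := eLpNorm_add_le (aestronglyMeasurable_moment n f) (aestronglyMeasurable_moment n g)
    (p := 2) (by norm_num)
  refine (pow_le_pow_left₀ zero_le h 2).trans ?_
  have := ENNReal.rpow_add_le_mul_rpow_add_rpow (eLpNorm (moment n f) 2 discMeasure)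
    (eLpNorm (moment n g) 2 discMeasure) (p := 2) (by norm_num)
  norm_num at this
  exact this

theorem sqNormM_smul (n : ℤ) (c : ℂ) (f : L2SM) :
    sqNormM (moment n (c • f : L2SM)) = ‖c‖ₑ ^ 2 * sqNormM (moment n f) := by
  unfold sqNormM
  rw [eLpNorm_congr_ae (moment_smul n c f), eLpNorm_const_smul, mul_pow]

theorem wNormSq_add (κ : ℝ) (f g : L2SM) :
    wNormSq κ (f + g : L2SM) ≤ 2 * (wNormSq κ f + wNormSq κ g) := by
  unfold wNormSq
  rw [← mul_add, mul_left_comm]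
  gcongr
  rw [add_add_add_comm, mul_add, ← ENNReal.tsum_add, ← ENNReal.tsum_mul_left]
  refine add_le_add (sqNormM_add 0 f g) (ENNReal.tsum_le_tsum fun k => ?_)
  rw [← mul_add, mul_left_comm]
  gcongr
  refine (add_le_add (sqNormM_add _ f g) (sqNormM_add _ f g)).trans (le_of_eq ?_)
  ring

theorem wNormSq_smul (κ : ℝ) (c : ℂ) (f : L2SM) :
    wNormSq κ (c • f : L2SM) = ‖c‖ₑ ^ 2 * wNormSq κ f := by
  unfold wNormSq
  simp only [sqNormM_smul, ← mul_add, mul_left_comm _ (‖c‖ₑ ^ 2), ENNReal.tsum_mul_left]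

theorem wNormSq_zero (κ : ℝ) : wNormSq κ (0 : L2SM) = 0 := by
  have h := wNormSq_smul κ 0 0
  simpa using h

/-- The subspace `L^{2,κ}(SM)` of the `f ∈ L²(SM)` with `‖f‖_κ < ∞`. -/
def L2w (κ : ℝ) : Submodule ℂ L2SM where
  carrier := {f | wNormSq κ f < ⊤}
  zero_mem' := by
    change wNormSq κ (0 : L2SM) < ⊤
    rw [wNormSq_zero]; exact ENNReal.zero_lt_top
  add_mem' := fun {f g} hf hg => (wNormSq_add κ f g).trans_lt
    (ENNReal.mul_lt_top (by norm_num) (ENNReal.add_lt_top.2 ⟨hf, hg⟩))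
  smul_mem' := fun c f hf => by
    change wNormSq κ (c • f : L2SM) < ⊤
    rw [wNormSq_smul]
    exact ENNReal.mul_lt_top (ENNReal.pow_lt_top enorm_lt_top) hf

end AttenuatedXray

end

/-!
The transform `I_a` vanishes on `(X + a)(e^{imθ} w)` for `w ∈ H¹₀(M)`, where
`X = e^{iθ} ∂ + e^{-iθ} ∂̄` is the geodesic vector field: for a test function `w`, this is the
fundamental theorem of calculus along the ray (`xray_transport_test`). By Santaló's formula
(`santalo`) the transform is continuous on `L²(SM)` with values in a weighted `L¹`, so that its
kernel is closed (`isClosed_xrayKernel`) and test functions may be replaced by their limits.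

So the angular modes of `f` may be pushed down. By Weyl's lemma (`weyl`) and the Poincaré
inequality, `L²(M)` is the orthogonal sum of `∂ H¹₀(M)` and of its holomorphic elements. Split the
mode `b` of degree `k` as `b = ∂w + h` with `h` holomorphic, and subtract `(X + a)(e^{i(k-1)θ} w)`.
This leaves `h` in degree `k`, and changes the modes of degree `k - 1` and `k - 2` by `-a w` and
`-∂̄w`. Negative degrees are treated in the same way with `∂` and `∂̄` exchanged. Done from infinity
downwards, this is the recursion `b_k = f_k - a w_k - ∂̄w_{k+1}` with `∂w_{k-1}` the projection of
`b_k`. It has a solution that is linear in the data `f_k` (`recSol`), by a geometric series which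
converges for the weights `C^k`. At the bottom, the modes of degree `±1` contain
`e^{iθ} ∂w + e^{-iθ} ∂̄w'`, which is `X v + X_⊥ g_s` with `v = (w + w') / 2` and
`g_s = i (w - w') / 2`. Subtracting `(X + a) v` leaves `X_⊥ g_s`, and `g_0` collects the remaining
terms of degree zero. The identity between `f`, `g` and the functions subtracted is `telescope`.

For the estimate, `‖a w‖ ≤ s ‖∂w‖` with `s = 2 a_∞ √C_P`, and `‖∂̄w‖ = ‖∂w‖`, so that
`‖b_k‖ ≤ ‖f_k‖ + s ‖∂w_k‖ + ‖∂w_{k+1}‖`. With `C = 4 + 2 s²` the quantities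
`C^k ‖∂w_{k-1}‖² + 8 C^{k-1} ‖∂w_k‖²` grow from one degree to the previous one by at most
`4 C^k ‖f_k‖² - C^k ‖h_k‖²` (`energy_recursion`). The sum of these inequalities bounds all `h_k`
together with the first two gauge functions, and these control `g_0` and `g_s` (`norm_low_le`).
-/

namespace AttenuatedXray

/-! ### A descending two-step recursion with weighted estimates -/


section Recursion

variable {E : Type*} [NormedAddCommGroup E] [NormedSpace ℂ E]

/-- The coefficients `β_j` of the solution `b_k = ∑_j β_j f_{k+j}` of the descending recursion
`b_k = f_k - A b_{k+1} - B b_{k+2}`. -/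
noncomputable def recCoeff (A B : E →L[ℂ] E) : ℕ → (E →L[ℂ] E)
  | 0 => ContinuousLinearMap.id ℂ E
  | 1 => -A
  | j + 2 => -(B.comp (recCoeff A B j)) - A.comp (recCoeff A B (j + 1))

theorem norm_recCoeff_apply_le {A B : E →L[ℂ] E} {s ρ : ℝ} (hA : ∀ x, ‖A x‖ ≤ s * ‖x‖)
    (hB : ∀ x, ‖B x‖ ≤ ‖x‖) (hs : 0 ≤ s) (hsρ : s ≤ ρ) (hρ : 1 + s * ρ ≤ ρ ^ 2) (x : E) :
    ∀ j, ‖recCoeff A B j x‖ ≤ ρ ^ j * ‖x‖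
  | 0 => by simp [recCoeff]
  | 1 => by
    simp only [recCoeff, neg_apply, norm_neg, pow_one]
    exact (hA x).trans (mul_le_mul_of_nonneg_right hsρ (norm_nonneg _))
  | j + 2 => by
    have h0 := norm_recCoeff_apply_le hA hB hs hsρ hρ x j
    have h1 := norm_recCoeff_apply_le hA hB hs hsρ hρ x (j + 1)
    simp only [recCoeff, sub_apply, neg_apply,
      ContinuousLinearMap.comp_apply]
    calc ‖-B (recCoeff A B j x) - A (recCoeff A B (j + 1) x)‖
        ≤ ‖recCoeff A B j x‖ + s * ‖recCoeff A B (j + 1) x‖ := by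
          refine (norm_sub_le _ _).trans ?_
          rw [norm_neg]
          exact add_le_add (hB _) (hA _)
      _ ≤ ρ ^ j * ‖x‖ + s * (ρ ^ (j + 1) * ‖x‖) := by gcongr
      _ = (1 + s * ρ) * (ρ ^ j * ‖x‖) := by ring
      _ ≤ ρ ^ 2 * (ρ ^ j * ‖x‖) := by
          have : 0 ≤ ρ := hs.trans hsρ
          gcongr
      _ = ρ ^ (j + 2) * ‖x‖ := by ring

/-- The weight `C = 4 + 2 s²` leaves a factor `2` between the growth `ρ^j` of the coefficients,
`ρ² = C / 2`, and the decay `C^{-j/2}` of the data. -/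
theorem weighted_recCoeff_le {A B : E →L[ℂ] E} {s C : ℝ} (hA : ∀ x, ‖A x‖ ≤ s * ‖x‖)
    (hB : ∀ x, ‖B x‖ ≤ ‖x‖) (hs : 0 ≤ s) (hC : C = 4 + 2 * s ^ 2) {f : ℕ → E} {M : ℝ} {k : ℕ}
    (hM : ∀ j, √C ^ (k + j) * ‖f (k + j)‖ ≤ M) (j : ℕ) :
    √C ^ k * ‖recCoeff A B j (f (k + j))‖ ≤ M * √(1 / 2) ^ j := by
  have hCpos : 0 < C := by rw [hC]; positivity
  have hρ2 : (√(1 / 2) * √C) ^ 2 = 2 + s ^ 2 := by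
    rw [mul_pow, Real.sq_sqrt (by norm_num), Real.sq_sqrt hCpos.le, hC]; ring
  have hsρ : s ≤ √(1 / 2) * √C := by
    refine le_of_sq_le_sq (by rw [hρ2]; linarith) (by positivity)
  have hρ : 1 + s * (√(1 / 2) * √C) ≤ (√(1 / 2) * √C) ^ 2 := by
    have h := sq_nonneg (s - √(1 / 2) * √C)
    nlinarith
  have h := norm_recCoeff_apply_le hA hB hs hsρ hρ (f (k + j)) j
  calc √C ^ k * ‖recCoeff A B j (f (k + j))‖
      ≤ √C ^ k * ((√(1 / 2) * √C) ^ j * ‖f (k + j)‖) := by gcongr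
    _ = (√C ^ (k + j) * ‖f (k + j)‖) * √(1 / 2) ^ j := by ring
    _ ≤ M * √(1 / 2) ^ j := by gcongr; exact hM j

theorem summable_sqrt_half_pow : Summable (fun j : ℕ => √(1 / 2 : ℝ) ^ j) := by
  refine summable_geometric_of_lt_one (Real.sqrt_nonneg _) ?_
  rw [Real.sqrt_lt' one_pos]; norm_num

theorem summable_recCoeff [CompleteSpace E] {A B : E →L[ℂ] E} {s C : ℝ} (hA : ∀ x, ‖A x‖ ≤ s * ‖x‖)
    (hB : ∀ x, ‖B x‖ ≤ ‖x‖) (hs : 0 ≤ s) (hC : C = 4 + 2 * s ^ 2) {f : ℕ → E} {M : ℝ} {k : ℕ}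
    (hM : ∀ j, √C ^ (k + j) * ‖f (k + j)‖ ≤ M) :
    Summable (fun j => recCoeff A B j (f (k + j))) := by
  have hCpos : 0 < √C := Real.sqrt_pos.2 (by rw [hC]; positivity)
  refine Summable.of_norm_bounded ((summable_sqrt_half_pow.mul_left M).div_const (√C ^ k))
    fun j => ?_
  rw [le_div_iff₀ (by positivity), mul_comm]
  exact weighted_recCoeff_le hA hB hs hC hM j

/-- The solution `b_k = ∑_j β_j f_{k+j}` of the recursion `b_k = f_k - A b_{k+1} - B b_{k+2}`. -/
noncomputable def recSol (A B : E →L[ℂ] E) (f : ℕ → E) (k : ℕ) : E :=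
  ∑' j, recCoeff A B j (f (k + j))

theorem weighted_recSol_le {A B : E →L[ℂ] E} {s C : ℝ} (hA : ∀ x, ‖A x‖ ≤ s * ‖x‖)
    (hB : ∀ x, ‖B x‖ ≤ ‖x‖) (hs : 0 ≤ s) (hC : C = 4 + 2 * s ^ 2) {f : ℕ → E} {M : ℝ} {k : ℕ}
    (hM : ∀ j, √C ^ (k + j) * ‖f (k + j)‖ ≤ M) :
    √C ^ k * ‖recSol A B f k‖ ≤ M * ∑' j : ℕ, √(1 / 2) ^ j := by
  have hCpos : 0 < √C := Real.sqrt_pos.2 (by rw [hC]; positivity)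
  rw [mul_comm, ← le_div_iff₀ (by positivity), ← tsum_mul_left, ← tsum_div_const]
  refine tsum_of_norm_bounded ((summable_sqrt_half_pow.mul_left M).div_const (√C ^ k)).hasSum
    fun j => ?_
  rw [le_div_iff₀ (by positivity), mul_comm]
  exact weighted_recCoeff_le hA hB hs hC hM j

theorem recSol_eq {A B : E →L[ℂ] E} {f : ℕ → E}
    (hf : ∀ k, Summable (fun j => recCoeff A B j (f (k + j)))) (k : ℕ) :
    recSol A B f k = f k - A (recSol A B f (k + 1)) - B (recSol A B f (k + 2)) := by
  have h1 := (A.hasSum (hf (k + 1)).hasSum)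
  have h2 := (B.hasSum (hf (k + 2)).hasSum)
  have h3 : HasSum (fun j => A (recCoeff A B (j + 1) (f (k + 1 + (j + 1)))))
      (A (recSol A B f (k + 1)) - A (f (k + 1))) := by
    have := (hasSum_nat_add_iff' 1).2 h1
    simpa [recCoeff, recSol] using this
  have h4 : HasSum (fun j => recCoeff A B (j + 2) (f (k + (j + 2))))
      (recSol A B f k - (f k - A (f (k + 1)))) := by
    have := (hasSum_nat_add_iff' 2).2 (hf k).hasSum
    simpa [recCoeff, recSol, Finset.sum_range_succ, sub_eq_add_neg] using this
  have h5 : HasSum (fun j => recCoeff A B (j + 2) (f (k + (j + 2))))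
      (-B (recSol A B f (k + 2)) - (A (recSol A B f (k + 1)) - A (f (k + 1)))) := by
    refine (h2.neg.sub h3).congr_fun fun j => ?_
    simp only [recCoeff, sub_apply, neg_apply, ContinuousLinearMap.comp_apply]
    rw [show k + (j + 2) = k + 2 + j by ring, show k + 1 + (j + 1) = k + 2 + j by ring]
  have h6 := h4.unique h5
  rw [sub_eq_iff_eq_add] at h6
  rw [h6]
  abel

/-- The solution of the recursion inherits the decay of the data: `C^{k/2} ‖b_k‖ → 0`. -/
theorem tendsto_weighted_recSol {A B : E →L[ℂ] E} {s C : ℝ} (hA : ∀ x, ‖A x‖ ≤ s * ‖x‖)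
    (hB : ∀ x, ‖B x‖ ≤ ‖x‖) (hs : 0 ≤ s) (hC : C = 4 + 2 * s ^ 2) {f : ℕ → E}
    (hf : Summable fun k => C ^ k * ‖f k‖ ^ 2) :
    Tendsto (fun k => C ^ k * ‖recSol A B f k‖ ^ 2) atTop (𝓝 0) := by
  have hCpos : 0 < C := by rw [hC]; positivity
  set K : ℝ := ∑' j : ℕ, √(1 / 2) ^ j
  have htail := tendsto_sum_nat_add (fun k => C ^ k * ‖f k‖ ^ 2)
  have hb : ∀ k, C ^ k * ‖recSol A B f k‖ ^ 2 ≤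
      (∑' j, C ^ (j + k) * ‖f (j + k)‖ ^ 2) * K ^ 2 := by
    intro k
    have hnn : ∀ j, 0 ≤ C ^ j * ‖f j‖ ^ 2 := fun j => by positivity
    set R := ∑' j, C ^ (j + k) * ‖f (j + k)‖ ^ 2
    have hR : 0 ≤ R := tsum_nonneg fun j => hnn _
    have hM : ∀ j, √C ^ (k + j) * ‖f (k + j)‖ ≤ √R := by
      intro j
      refine Real.le_sqrt_of_sq_le ?_
      rw [mul_pow, ← pow_mul, mul_comm (k + j) 2, pow_mul, Real.sq_sqrt hCpos.le, add_comm k j]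
      exact ((summable_nat_add_iff k).2 hf).le_tsum j fun i _ => hnn _
    have h := weighted_recSol_le hA hB hs hC hM
    have h2 := pow_le_pow_left₀ (by positivity) h 2
    rwa [mul_pow, ← pow_mul, mul_comm k 2, pow_mul, Real.sq_sqrt hCpos.le, mul_pow,
      Real.sq_sqrt hR] at h2
  refine squeeze_zero (fun k => by positivity) hb ?_
  simpa using htail.mul_const (K ^ 2)

end Recursion

/-- The energy estimate for a descending recursion `b_k = f_k - A b_{k+1} - B b_{k+2}`, where
`b_k` is split into a part of norm `D_k`, which alone enters the recursion, and a remainder of norm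
`H_k`. The quantity `W_k = C^k D_k² + 8 C^{k-1} D_{k+1}²` bounds the cost of the remaining steps:
`W_k + C^k H_k² ≤ 4 C^k F_k² + W_{k+1}`, by `(F + x + s y)² ≤ 4 F² + 4 x² + 2 s² y²`. -/
theorem energy_recursion {s C : ℝ} (hC : C = 4 + 2 * s ^ 2) {F Bn D H : ℕ → ℝ}
    (hB0 : ∀ k, 0 ≤ Bn k)
    (hsplit : ∀ k, Bn k ^ 2 = D k ^ 2 + H k ^ 2)
    (hrec : ∀ k, Bn k ≤ F k + s * D (k + 1) + D (k + 2))
    (hlim : Tendsto (fun k => C ^ k * Bn k ^ 2) atTop (𝓝 0))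
    (hF : Summable fun k => C ^ k * F k ^ 2) :
    Summable (fun k => H (k + 1) ^ 2) ∧
    C * D 1 ^ 2 + 8 * D 2 ^ 2 + ∑' k, H (k + 1) ^ 2 ≤ 4 * ∑' k, C ^ (k + 1) * F (k + 1) ^ 2 := by
  have hC4 : 4 ≤ C := by rw [hC]; nlinarith [sq_nonneg s]
  have hCpos : 0 < C := by linarith
  have key : ∀ k, (C ^ (k + 1) * D (k + 1) ^ 2 + 8 * C ^ k * D (k + 2) ^ 2) +
      C ^ (k + 1) * H (k + 1) ^ 2 ≤ 4 * (C ^ (k + 1) * F (k + 1) ^ 2) +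
      (C ^ (k + 2) * D (k + 2) ^ 2 + 8 * C ^ (k + 1) * D (k + 3) ^ 2) := by
    intro k
    have h1 : Bn (k + 1) ^ 2 ≤
        4 * F (k + 1) ^ 2 + 4 * D (k + 3) ^ 2 + 2 * s ^ 2 * D (k + 2) ^ 2 := by
      refine (pow_le_pow_left₀ (hB0 _) (hrec (k + 1)) 2).trans ?_
      change (F (k + 1) + s * D (k + 2) + D (k + 3)) ^ 2 ≤ _
      nlinarith [sq_nonneg (F (k + 1) - D (k + 3)),
        sq_nonneg (s * D (k + 2) - 2 * F (k + 1)), sq_nonneg (s * D (k + 2) - 2 * D (k + 3)),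
        sq_nonneg (s * D (k + 2) - F (k + 1) - D (k + 3))]
    have h2 : 8 + 2 * s ^ 2 * C ≤ C ^ 2 := by
      have : C ^ 2 = 4 * C + 2 * s ^ 2 * C := by
        calc C ^ 2 = C * C := sq C
          _ = (4 + 2 * s ^ 2) * C := by rw [← hC]
          _ = _ := by ring
      linarith
    have hk : 0 < C ^ k := by positivity
    have hsp := hsplit (k + 1)
    have e1 := mul_le_mul_of_nonneg_left h1 (by positivity : 0 ≤ C ^ (k + 1))
    have e2 := mul_le_mul_of_nonneg_right h2
      (by positivity : 0 ≤ C ^ k * D (k + 2) ^ 2)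
    have e3 : 0 ≤ C ^ (k + 1) * D (k + 3) ^ 2 := by positivity
    have e4 : C ^ (k + 1) * Bn (k + 1) ^ 2 =
        C ^ (k + 1) * D (k + 1) ^ 2 + C ^ (k + 1) * H (k + 1) ^ 2 := by rw [hsp]; ring
    calc _ = C ^ (k + 1) * Bn (k + 1) ^ 2 + 8 * C ^ k * D (k + 2) ^ 2 := by rw [e4]; ring
      _ ≤ C ^ (k + 1) * (4 * F (k + 1) ^ 2 + 4 * D (k + 3) ^ 2 + 2 * s ^ 2 * D (k + 2) ^ 2)
          + 8 * C ^ k * D (k + 2) ^ 2 := by linarith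
      _ = 4 * (C ^ (k + 1) * F (k + 1) ^ 2) + (8 + 2 * s ^ 2 * C) * (C ^ k * D (k + 2) ^ 2)
          + 4 * (C ^ (k + 1) * D (k + 3) ^ 2) := by ring
      _ ≤ 4 * (C ^ (k + 1) * F (k + 1) ^ 2) + C ^ 2 * (C ^ k * D (k + 2) ^ 2)
          + 8 * (C ^ (k + 1) * D (k + 3) ^ 2) := by linarith
      _ = _ := by ring
  have hsum : ∀ K, C * D 1 ^ 2 + 8 * D 2 ^ 2 + ∑ k ∈ Finset.range K, C ^ (k + 1) * H (k + 1) ^ 2 ≤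
      4 * (∑ k ∈ Finset.range K, C ^ (k + 1) * F (k + 1) ^ 2) +
      (C ^ (K + 1) * D (K + 1) ^ 2 + 8 * C ^ K * D (K + 2) ^ 2) := by
    intro K
    induction K with
    | zero => simp
    | succ K ih =>
      rw [Finset.sum_range_succ, Finset.sum_range_succ]
      have := key K
      rw [mul_add]
      linarith
  have hDB : ∀ k, D k ^ 2 ≤ Bn k ^ 2 := fun k => by
    rw [hsplit k]; linarith [sq_nonneg (H k)]
  have hDlim : Tendsto (fun k => C ^ k * D k ^ 2) atTop (𝓝 0) := by
    refine squeeze_zero (fun k => by positivity) (fun k => ?_) hlim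
    exact mul_le_mul_of_nonneg_left (hDB k) (by positivity)
  have hW : Tendsto (fun K => C ^ (K + 1) * D (K + 1) ^ 2 + 8 * C ^ K * D (K + 2) ^ 2)
      atTop (𝓝 0) := by
    have t1 := hDlim.comp (tendsto_add_atTop_nat 1)
    have t2 := (hDlim.comp (tendsto_add_atTop_nat 2)).const_mul (8 / C ^ 2)
    have t3 := t1.add t2
    rw [mul_zero, add_zero] at t3
    refine t3.congr fun K => ?_
    simp only [Function.comp]
    field_simp
    ring
  have hF1 : Summable fun k => C ^ (k + 1) * F (k + 1) ^ 2 := (summable_nat_add_iff 1).2 hF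
  have hR : Tendsto (fun K => 4 * (∑ k ∈ Finset.range K, C ^ (k + 1) * F (k + 1) ^ 2) +
      (C ^ (K + 1) * D (K + 1) ^ 2 + 8 * C ^ K * D (K + 2) ^ 2)) atTop
      (𝓝 (4 * ∑' k, C ^ (k + 1) * F (k + 1) ^ 2)) := by
    simpa using (hF1.hasSum.tendsto_sum_nat.const_mul 4).add hW
  have hHC : ∀ k, H (k + 1) ^ 2 ≤ C ^ (k + 1) * H (k + 1) ^ 2 := fun k =>
    le_mul_of_one_le_left (sq_nonneg _) (one_le_pow₀ (by linarith))
  have hsum' : ∀ K, C * D 1 ^ 2 + 8 * D 2 ^ 2 + ∑ k ∈ Finset.range K, H (k + 1) ^ 2 ≤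
      4 * (∑ k ∈ Finset.range K, C ^ (k + 1) * F (k + 1) ^ 2) +
      (C ^ (K + 1) * D (K + 1) ^ 2 + 8 * C ^ K * D (K + 2) ^ 2) := fun K =>
    (add_le_add_right (Finset.sum_le_sum fun k _ => hHC k) _).trans (hsum K)
  obtain ⟨b, hb⟩ := hR.bddAbove_range
  have hHs : Summable fun k => H (k + 1) ^ 2 := by
    refine summable_of_sum_range_le (c := b) (fun k => sq_nonneg _) fun K => ?_
    have h1 := hb ⟨K, rfl⟩
    have h2 := hsum' K
    simp only at h1
    have : 0 ≤ C * D 1 ^ 2 + 8 * D 2 ^ 2 := by positivity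
    linarith
  refine ⟨hHs, le_of_tendsto_of_tendsto' (hHs.hasSum.tendsto_sum_nat.const_add _) hR hsum'⟩

/-! ### Test functions -/

namespace IsTest

variable {φ ψ : ℂ → ℂ}

theorem add (hφ : IsTest φ) (hψ : IsTest ψ) : IsTest (fun z => φ z + ψ z) where
  smooth := hφ.smooth.add hψ.smooth
  compact := hφ.compact.add hψ.compact
  supp := (tsupport_add φ ψ).trans (Set.union_subset hφ.supp hψ.supp)

theorem const_mul (hφ : IsTest φ) (c : ℂ) : IsTest (fun z => c * φ z) where
  smooth := contDiff_const.mul hφ.smooth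
  compact := hφ.compact.mul_left (f := fun _ => c)
  supp := (tsupport_mul_subset_right (f := fun _ => c)).trans hφ.supp

theorem zero : IsTest (fun _ => 0) where
  smooth := contDiff_const
  compact := HasCompactSupport.zero
  supp := by simp [tsupport]

theorem star (hφ : IsTest φ) : IsTest (fun z => starRingEnd ℂ (φ z)) where
  smooth := Complex.conjCLE.contDiff.comp hφ.smooth
  compact := hφ.compact.comp_left (map_zero _)
  supp := (closure_mono (Function.support_comp_subset (map_zero (starRingEnd ℂ)) φ)).trans hφ.supp

theorem fderiv_apply (hφ : IsTest φ) (v : ℂ) : IsTest (fun z => fderiv ℝ φ z v) where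
  smooth := (hφ.smooth.fderiv_right (m := ∞) (by norm_cast)).clm_apply contDiff_const
  compact := hφ.compact.fderiv_apply ℝ v
  supp := (tsupport_fderiv_apply_subset ℝ v).trans hφ.supp

theorem partialX (hφ : IsTest φ) : IsTest (partialX φ) := hφ.fderiv_apply 1

theorem partialY (hφ : IsTest φ) : IsTest (partialY φ) := hφ.fderiv_apply Complex.I

theorem continuous (hφ : IsTest φ) : Continuous φ := hφ.smooth.continuous

theorem differentiable (hφ : IsTest φ) : Differentiable ℝ φ := hφ.smooth.differentiable (by simp)

theorem eq_zero (hφ : IsTest φ) {z : ℂ} (hz : z ∉ Metric.ball (0 : ℂ) 1) : φ z = 0 :=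
  image_eq_zero_of_notMem_tsupport fun h => hz (hφ.supp h)

theorem memLp (hφ : IsTest φ) (p : ℝ≥0∞) : MemLp φ p discMeasure :=
  (hφ.continuous.memLp_of_hasCompactSupport hφ.compact).restrict _

/-- The class of a test function in `L²(M)`. -/
noncomputable def toL2 (hφ : IsTest φ) : L2M := (hφ.memLp 2).toLp φ

theorem coeFn_toL2 (hφ : IsTest φ) : hφ.toL2 =ᵐ[discMeasure] φ := MemLp.coeFn_toLp _

theorem integral_eq (hφ : IsTest φ) (f : ℂ → ℂ) :
    ∫ z, f z * φ z ∂discMeasure = ∫ z, f z * φ z := by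
  refine setIntegral_eq_integral_of_forall_compl_eq_zero fun z hz => ?_
  rw [hφ.eq_zero fun h => hz (Metric.ball_subset_closedBall h), mul_zero]

theorem integral_mul_fderiv (hφ : IsTest φ) (hψ : IsTest ψ) (v : ℂ) :
    ∫ z, φ z * fderiv ℝ ψ z v ∂discMeasure = -∫ z, fderiv ℝ φ z v * ψ z ∂discMeasure := by
  rw [(hψ.fderiv_apply v).integral_eq, hψ.integral_eq]
  have hint : ∀ {f g : ℂ → ℂ}, IsTest f → IsTest g → Integrable (fun z => f z * g z) volume :=
    fun hf hg => (hf.continuous.mul hg.continuous).integrable_of_hasCompactSupport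
      hg.compact.mul_left
  exact integral_mul_fderiv_eq_neg_fderiv_mul_of_integrable (hint (hφ.fderiv_apply v) hψ)
    (hint hφ (hψ.fderiv_apply v)) (hint hφ hψ) (fun x _ => hφ.differentiable x)
    (fun x _ => hψ.differentiable x)

theorem inner_toL2 (hφ : IsTest φ) (u : L2M) :
    inner ℂ hφ.star.toL2 u = ∫ z, u z * φ z ∂discMeasure := by
  rw [L2.inner_def]
  refine integral_congr_ae ?_
  filter_upwards [hφ.star.coeFn_toL2] with z hz
  rw [hz]
  simp

theorem inner_toL2' (hφ : IsTest φ) (u : L2M) :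
    inner ℂ hφ.toL2 u = ∫ z, u z * starRingEnd ℂ (φ z) ∂discMeasure := by
  rw [L2.inner_def]
  refine integral_congr_ae ?_
  filter_upwards [hφ.coeFn_toL2] with z hz
  rw [hz]
  simp

theorem fderiv_star (hφ : IsTest φ) (z v : ℂ) :
    fderiv ℝ (fun z => starRingEnd ℂ (φ z)) z v = starRingEnd ℂ (fderiv ℝ φ z v) := by
  have h : HasFDerivAt (fun z => starRingEnd ℂ (φ z))
      ((Complex.conjCLE : ℂ →L[ℝ] ℂ).comp (fderiv ℝ φ z)) z :=
    (Complex.conjCLE : ℂ →L[ℝ] ℂ).hasFDerivAt.comp z (hφ.differentiable z).hasFDerivAt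
  rw [h.fderiv]
  simp

theorem fderiv_comm (hφ : IsTest φ) (v w z : ℂ) :
    fderiv ℝ (fun z => fderiv ℝ φ z v) z w = fderiv ℝ (fun z => fderiv ℝ φ z w) z v := by
  have hd : Differentiable ℝ (fderiv ℝ φ) :=
    (hφ.smooth.fderiv_right (m := 1) (by norm_cast)).differentiable (by simp)
  have h : ∀ v w, fderiv ℝ (fun z => fderiv ℝ φ z v) z w = fderiv ℝ (fderiv ℝ φ) z w v := by
    intro v w
    rw [fderiv_clm_apply (hd z) (differentiableAt_const v)]
    simp
  rw [h, h]
  exact (hφ.smooth.contDiffAt.isSymmSndFDerivAt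
    (by rw [minSmoothness_of_isRCLikeNormedField]; exact ENat.LEInfty.out)).eq w v

/-- `⟨∂_v φ, ∂_w φ⟩ = ⟨∂_w φ, ∂_v φ⟩`: two integrations by parts. -/
theorem inner_fderiv_comm (hφ : IsTest φ) (v w : ℂ) :
    inner ℂ (hφ.fderiv_apply v).toL2 (hφ.fderiv_apply w).toL2 =
      inner ℂ (hφ.fderiv_apply w).toL2 (hφ.fderiv_apply v).toL2 := by
  have key : ∀ v w : ℂ, inner ℂ (hφ.fderiv_apply v).toL2 (hφ.fderiv_apply w).toL2 =
      -∫ z, φ z * starRingEnd ℂ (fderiv ℝ (fun z => fderiv ℝ φ z v) z w) ∂discMeasure := by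
    intro v w
    rw [inner_toL2']
    have h1 : ∫ z, (hφ.fderiv_apply w).toL2 z * starRingEnd ℂ (fderiv ℝ φ z v) ∂discMeasure
        = ∫ z, fderiv ℝ φ z w * starRingEnd ℂ (fderiv ℝ φ z v) ∂discMeasure := by
      refine integral_congr_ae ?_
      filter_upwards [(hφ.fderiv_apply w).coeFn_toL2] with z hz
      rw [hz]
    have h2 := hφ.integral_mul_fderiv (hφ.fderiv_apply v).star w
    rw [h1, eq_neg_iff_add_eq_zero, ← eq_neg_iff_add_eq_zero.1 h2, add_comm]
    simp only [(hφ.fderiv_apply v).fderiv_star]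
  rw [key, key]
  simp only [hφ.fderiv_comm v w]

end IsTest

/-! ### The space `H¹₀(M)` as a closed subspace of `L²(M)³` -/

/-- The triples `(φ, ∂_x φ, ∂_y φ)` for test functions `φ`. -/
noncomputable def testGraph : Submodule ℂ (L2M × L2M × L2M) where
  carrier := {p | ∃ (φ : ℂ → ℂ) (h : IsTest φ),
    p = (h.toL2, h.partialX.toL2, h.partialY.toL2)}
  zero_mem' := by
    have hz : ∀ (f : ℂ → ℂ) (hf : IsTest f), (∀ z, f z = 0) → hf.toL2 = 0 := by
      intro f hf h0
      have : f = 0 := funext h0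
      subst this
      exact MemLp.toLp_zero _
    refine ⟨_, IsTest.zero, ?_⟩
    rw [hz _ _ fun _ => rfl, hz _ _ fun z => by simp [partialX],
      hz _ _ fun z => by simp [partialY]]
    rfl
  add_mem' := by
    rintro _ _ ⟨φ, hφ, rfl⟩ ⟨ψ, hψ, rfl⟩
    have hadd : ∀ {f g k : ℂ → ℂ} (hf : IsTest f) (hg : IsTest g) (hk : IsTest k),
        (∀ z, k z = f z + g z) → hf.toL2 + hg.toL2 = hk.toL2 := by
      intro f g k hf hg hk h
      have : k = f + g := funext h
      subst this
      exact (MemLp.toLp_add _ _).symm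
    refine ⟨_, hφ.add hψ, ?_⟩
    have h : ∀ z v, fderiv ℝ (fun z => φ z + ψ z) z v = fderiv ℝ φ z v + fderiv ℝ ψ z v :=
      fun z v => by rw [fderiv_fun_add (hφ.differentiable z) (hψ.differentiable z)]; simp
    simp only [Prod.mk_add_mk, Prod.mk.injEq]
    exact ⟨hadd _ _ _ fun _ => rfl, hadd _ _ _ fun z => h z 1,
      hadd _ _ _ fun z => h z Complex.I⟩
  smul_mem' := by
    rintro c _ ⟨φ, hφ, rfl⟩
    have hsm : ∀ {f k : ℂ → ℂ} (hf : IsTest f) (hk : IsTest k),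
        (∀ z, k z = c * f z) → c • hf.toL2 = hk.toL2 := by
      intro f k hf hk h
      have : k = c • f := funext h
      subst this
      exact (MemLp.toLp_const_smul _ _).symm
    refine ⟨_, hφ.const_mul c, ?_⟩
    have h : ∀ z v, fderiv ℝ (fun z => c * φ z) z v = c * fderiv ℝ φ z v :=
      fun z v => by rw [fderiv_const_mul (hφ.differentiable z)]; simp
    simp only [Prod.smul_mk, Prod.mk.injEq]
    exact ⟨hsm _ _ fun _ => rfl, hsm _ _ fun z => h z 1, hsm _ _ fun z => h z Complex.I⟩

/-- The graph of the gradient on `H¹₀(M)`: the closure of the triples `(φ, ∂_x φ, ∂_y φ)`. It is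
`H10` with its structure of a complete normed space. -/
noncomputable def gradGraph : Submodule ℂ (L2M × L2M × L2M) := testGraph.topologicalClosure

instance : CompleteSpace gradGraph :=
  testGraph.isClosed_topologicalClosure.completeSpace_coe

/-- The element of `gradGraph` given by a test function. -/
noncomputable def IsTest.toGraph {φ : ℂ → ℂ} (h : IsTest φ) : gradGraph :=
  ⟨(h.toL2, h.partialX.toL2, h.partialY.toL2), subset_closure ⟨φ, h, rfl⟩⟩

/-- Induction on `gradGraph`: closed conditions may be checked on test functions. -/
theorem gradGraph_induction {P : gradGraph → Prop} (hP : IsClosed {w | P w})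
    (h : ∀ φ (hφ : IsTest φ), P hφ.toGraph) (w : gradGraph) : P w := by
  have hw : w ∈ closure {x : gradGraph | ∃ φ, ∃ hφ : IsTest φ, x = hφ.toGraph} := by
    rw [Topology.IsInducing.subtypeVal.closure_eq_preimage_closure_image]
    refine closure_mono ?_ w.2
    rintro _ ⟨φ, hφ, rfl⟩
    exact ⟨_, ⟨φ, hφ, rfl⟩, rfl⟩
  refine closure_minimal ?_ hP hw
  rintro _ ⟨φ, hφ, rfl⟩
  exact h φ hφ

/-- The function of an element of `H¹₀(M)`. -/
noncomputable def valL : gradGraph →L[ℂ] L2M :=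
  (ContinuousLinearMap.fst ℂ _ _).comp gradGraph.subtypeL

/-- The derivative in `x` of an element of `H¹₀(M)`. -/
noncomputable def dxL : gradGraph →L[ℂ] L2M :=
  ((ContinuousLinearMap.fst ℂ _ _).comp (ContinuousLinearMap.snd ℂ _ _)).comp gradGraph.subtypeL

/-- The derivative in `y` of an element of `H¹₀(M)`. -/
noncomputable def dyL : gradGraph →L[ℂ] L2M :=
  ((ContinuousLinearMap.snd ℂ _ _).comp (ContinuousLinearMap.snd ℂ _ _)).comp gradGraph.subtypeL

/-- The Wirtinger derivative `∂ = (∂_x - i ∂_y) / 2`. -/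
noncomputable def dzL : gradGraph →L[ℂ] L2M := (1 / 2 : ℂ) • (dxL - Complex.I • dyL)

/-- The Wirtinger derivative `∂̄ = (∂_x + i ∂_y) / 2`. -/
noncomputable def dzbarL : gradGraph →L[ℂ] L2M := (1 / 2 : ℂ) • (dxL + Complex.I • dyL)

/-- For `w ∈ H¹₀(M)` the derivatives `∂w` and `∂̄w` have the same norm, half that of the gradient:
the cross term `Re ⟨∂_x w, i ∂_y w⟩` vanishes after two integrations by parts. -/
theorem norm_dzL_eq (w : gradGraph) :
    4 * ‖dzL w‖ ^ 2 = ‖dxL w‖ ^ 2 + ‖dyL w‖ ^ 2 ∧ ‖dzbarL w‖ = ‖dzL w‖ := by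
  have key : (inner ℂ (dxL w) (dyL w) : ℂ) = inner ℂ (dyL w) (dxL w) := by
    refine gradGraph_induction (P := fun w => (inner ℂ (dxL w) (dyL w) : ℂ) =
      inner ℂ (dyL w) (dxL w)) ?_ (fun φ hφ => hφ.inner_fderiv_comm 1 Complex.I) w
    exact isClosed_eq (by fun_prop) (by fun_prop)
  have him : (inner ℂ (dxL w) (dyL w) : ℂ).im = 0 := by
    have h := inner_conj_symm (𝕜 := ℂ) (dxL w) (dyL w)
    rw [← key, Complex.conj_eq_iff_im] at h
    exact h
  have h1 : ‖dxL w - Complex.I • dyL w‖ ^ 2 = ‖dxL w‖ ^ 2 + ‖dyL w‖ ^ 2 := by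
    rw [norm_sub_sq (𝕜 := ℂ), inner_smul_right, norm_smul]
    simp [him]
  have h2 : ‖dxL w + Complex.I • dyL w‖ ^ 2 = ‖dxL w‖ ^ 2 + ‖dyL w‖ ^ 2 := by
    rw [norm_add_sq (𝕜 := ℂ), inner_smul_right, norm_smul]
    simp [him]
  have h3 : ‖dzL w‖ ^ 2 = (‖dxL w‖ ^ 2 + ‖dyL w‖ ^ 2) / 4 := by
    change ‖(1 / 2 : ℂ) • (dxL w - Complex.I • dyL w)‖ ^ 2 = _
    rw [norm_smul, mul_pow, h1]; norm_num; ring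
  have h4 : ‖dzbarL w‖ ^ 2 = (‖dxL w‖ ^ 2 + ‖dyL w‖ ^ 2) / 4 := by
    change ‖(1 / 2 : ℂ) • (dxL w + Complex.I • dyL w)‖ ^ 2 = _
    rw [norm_smul, mul_pow, h2]; norm_num; ring
  refine ⟨by rw [h3]; ring, ?_⟩
  rw [← sq_eq_sq₀ (norm_nonneg _) (norm_nonneg _), h3, h4]

theorem IsTest.norm_toL2 {φ : ℂ → ℂ} (h : IsTest φ) :
    ‖h.toL2‖ = (eLpNorm φ 2 discMeasure).toReal := Lp.norm_toLp _ _

theorem gradGraph_weak_dx (w : gradGraph) {φ : ℂ → ℂ} (hφ : IsTest φ) :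
    ∫ z, valL w z * partialX φ z ∂discMeasure = -∫ z, dxL w z * φ z ∂discMeasure := by
  rw [← hφ.partialX.inner_toL2, ← hφ.inner_toL2]
  refine gradGraph_induction (P := fun w => inner ℂ hφ.partialX.star.toL2 (valL w) =
    -(inner ℂ hφ.star.toL2 (dxL w) : ℂ)) (isClosed_eq (by fun_prop) (by fun_prop)) ?_ w
  intro ψ hψ
  have h := hψ.integral_mul_fderiv hφ 1
  rw [hφ.partialX.inner_toL2, hφ.inner_toL2]
  refine Eq.trans ?_ (h.trans ?_)
  · refine integral_congr_ae ?_
    filter_upwards [hψ.coeFn_toL2] with z hz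
    exact congrArg (· * _) hz
  · refine congrArg Neg.neg (integral_congr_ae ?_)
    filter_upwards [hψ.partialX.coeFn_toL2] with z hz
    exact congrArg (· * _) hz.symm

theorem gradGraph_weak_dy (w : gradGraph) {φ : ℂ → ℂ} (hφ : IsTest φ) :
    ∫ z, valL w z * partialY φ z ∂discMeasure = -∫ z, dyL w z * φ z ∂discMeasure := by
  rw [← hφ.partialY.inner_toL2, ← hφ.inner_toL2]
  refine gradGraph_induction (P := fun w => inner ℂ hφ.partialY.star.toL2 (valL w) =
    -(inner ℂ hφ.star.toL2 (dyL w) : ℂ)) (isClosed_eq (by fun_prop) (by fun_prop)) ?_ w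
  intro ψ hψ
  have h := hψ.integral_mul_fderiv hφ Complex.I
  rw [hφ.partialY.inner_toL2, hφ.inner_toL2]
  refine Eq.trans ?_ (h.trans ?_)
  · refine integral_congr_ae ?_
    filter_upwards [hψ.coeFn_toL2] with z hz
    exact congrArg (· * _) hz
  · refine congrArg Neg.neg (integral_congr_ae ?_)
    filter_upwards [hψ.partialY.coeFn_toL2] with z hz
    exact congrArg (· * _) hz.symm

theorem tendsto_eLpNorm_sub_iff {u : L2M} {φ : ℕ → ℂ → ℂ} (hφ : ∀ n, IsTest (φ n)) :
    Tendsto (fun n => eLpNorm (fun z => u z - φ n z) 2 discMeasure) atTop (𝓝 0) ↔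
      Tendsto (fun n => (hφ n).toL2) atTop (𝓝 u) := by
  rw [tendsto_iff_edist_tendsto_0]
  refine tendsto_congr fun n => ?_
  rw [edist_comm, Lp.edist_def]
  refine eLpNorm_congr_ae ?_
  filter_upwards [(hφ n).coeFn_toL2] with z hz
  simp [hz]

/-- The element of `H10` with given value and gradient. -/
noncomputable def toH10 (w : gradGraph) : H10 where
  u := valL w
  dx := dxL w
  dy := dyL w
  weak_dx := fun _ hφ => gradGraph_weak_dx w hφ
  weak_dy := fun _ hφ => gradGraph_weak_dy w hφ
  approx := by
    obtain ⟨x, hx, hlim⟩ := mem_closure_iff_seq_limit.1 w.2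
    choose φ hφ hxφ using hx
    refine ⟨φ, hφ, ?_, ?_, ?_⟩
    · rw [tendsto_eLpNorm_sub_iff hφ]
      refine ((continuous_fst.tendsto _).comp hlim).congr fun n => ?_
      simp [hxφ n]
    · rw [tendsto_eLpNorm_sub_iff fun n => (hφ n).partialX]
      refine (((continuous_fst.comp continuous_snd).tendsto _).comp hlim).congr fun n => ?_
      simp [hxφ n]
    · rw [tendsto_eLpNorm_sub_iff fun n => (hφ n).partialY]
      refine (((continuous_snd.comp continuous_snd).tendsto _).comp hlim).congr fun n => ?_
      simp [hxφ n]

theorem H10.exists_gradGraph (u : H10) :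
    ∃ w : gradGraph, valL w = u.u ∧ dxL w = u.dx ∧ dyL w = u.dy := by
  obtain ⟨φ, hφ, h1, h2, h3⟩ := u.approx
  rw [tendsto_eLpNorm_sub_iff hφ] at h1
  rw [tendsto_eLpNorm_sub_iff fun n => (hφ n).partialX] at h2
  rw [tendsto_eLpNorm_sub_iff fun n => (hφ n).partialY] at h3
  refine ⟨⟨(u.u, u.dx, u.dy), mem_closure_of_tendsto (h1.prodMk_nhds (h2.prodMk_nhds h3))
    (Eventually.of_forall fun n => ⟨φ n, hφ n, rfl⟩)⟩, rfl, rfl, rfl⟩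

/-! ### The Poincaré inequality -/

/-- The Poincaré inequality on test functions, from the Gagliardo–Nirenberg–Sobolev inequality
`‖φ‖_{L²} ≤ c ‖∇φ‖_{L¹}` in the plane. -/
theorem exists_poincare_test : ∃ c : ℝ, 0 ≤ c ∧ ∀ φ (h : IsTest φ),
    ‖h.toL2‖ ≤ c * (‖h.partialX.toL2‖ + ‖h.partialY.toL2‖) := by
  set K : ℝ≥0∞ := (eLpNormLESNormFDerivOneConst (volume : Measure ℂ) 2 : ℝ≥0∞) *
    discMeasure Set.univ ^ (1 / (1 : ℝ≥0∞).toReal - 1 / (2 : ℝ≥0∞).toReal)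
  have hK : K ≠ ⊤ := ENNReal.mul_ne_top ENNReal.coe_ne_top
    (ENNReal.rpow_ne_top_of_nonneg (by norm_num) (measure_ne_top _ _))
  refine ⟨K.toReal, ENNReal.toReal_nonneg, fun φ h => ?_⟩
  have h1 : eLpNorm φ 2 volume ≤
      eLpNormLESNormFDerivOneConst (volume : Measure ℂ) 2 * eLpNorm (fderiv ℝ φ) 1 volume := by
    refine eLpNorm_le_eLpNorm_fderiv_one volume (h.smooth.of_le (by simp)) h.compact ?_
    rw [Complex.finrank_real_complex]
    exact NNReal.HolderConjugate.two_two
  have hsupp : eLpNorm (fderiv ℝ φ) 1 volume = eLpNorm (fderiv ℝ φ) 1 discMeasure := by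
    refine (eLpNorm_restrict_eq_of_support_subset fun z hz => ?_).symm
    exact Metric.ball_subset_closedBall (h.supp (support_fderiv_subset ℝ hz))
  have hcont : Continuous (fderiv ℝ φ) := h.smooth.continuous_fderiv (by simp)
  have h2 : eLpNorm (fderiv ℝ φ) 1 discMeasure ≤ eLpNorm (fderiv ℝ φ) 2 discMeasure *
      discMeasure Set.univ ^ (1 / (1 : ℝ≥0∞).toReal - 1 / (2 : ℝ≥0∞).toReal) :=
    eLpNorm_le_eLpNorm_mul_rpow_measure_univ (by norm_num) hcont.aestronglyMeasurable
  have h3 : eLpNorm (fderiv ℝ φ) 2 discMeasure ≤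
      eLpNorm (partialX φ) 2 discMeasure + eLpNorm (partialY φ) 2 discMeasure := by
    have hX := h.partialX.continuous
    have hY := h.partialY.continuous
    refine le_trans ?_ ((eLpNorm_add_le hX.norm.aestronglyMeasurable hY.norm.aestronglyMeasurable
      one_le_two).trans (by rw [eLpNorm_norm, eLpNorm_norm]))
    refine eLpNorm_mono fun z => ?_
    rw [Pi.add_apply, Real.norm_of_nonneg (by positivity)]
    refine ContinuousLinearMap.opNorm_le_bound _ (by positivity) fun v => ?_
    have hv : fderiv ℝ φ z v = v.re • partialX φ z + v.im • partialY φ z := by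
      conv_lhs => rw [← Complex.re_add_im v]
      rw [map_add, partialX, partialY, ← map_smul, ← map_smul]
      simp
    rw [hv]
    refine (norm_add_le _ _).trans ?_
    rw [norm_smul, norm_smul, add_mul, mul_comm, mul_comm ‖v.im‖]
    exact add_le_add (mul_le_mul_of_nonneg_left (Complex.abs_re_le_norm v) (norm_nonneg _))
      (mul_le_mul_of_nonneg_left (Complex.abs_im_le_norm v) (norm_nonneg _))
  have h4 : eLpNorm φ 2 discMeasure ≤
      K * (eLpNorm (partialX φ) 2 discMeasure + eLpNorm (partialY φ) 2 discMeasure) := by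
    calc eLpNorm φ 2 discMeasure ≤ eLpNorm φ 2 volume :=
          eLpNorm_mono_measure _ Measure.restrict_le_self
      _ ≤ _ := h1
      _ = eLpNormLESNormFDerivOneConst (volume : Measure ℂ) 2 *
            eLpNorm (fderiv ℝ φ) 1 discMeasure := by rw [hsupp]
      _ ≤ eLpNormLESNormFDerivOneConst (volume : Measure ℂ) 2 *
            (eLpNorm (fderiv ℝ φ) 2 discMeasure *
            discMeasure Set.univ ^ (1 / (1 : ℝ≥0∞).toReal - 1 / (2 : ℝ≥0∞).toReal)) := by gcongr
      _ = K * eLpNorm (fderiv ℝ φ) 2 discMeasure := by ring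
      _ ≤ _ := by gcongr
  have hX := (h.partialX.memLp 2).eLpNorm_ne_top
  have hY := (h.partialY.memLp 2).eLpNorm_ne_top
  rw [IsTest.norm_toL2, IsTest.norm_toL2, IsTest.norm_toL2, ← ENNReal.toReal_add hX hY,
    ← ENNReal.toReal_mul]
  exact ENNReal.toReal_mono (ENNReal.mul_ne_top hK (ENNReal.add_ne_top.2 ⟨hX, hY⟩)) h4

theorem exists_poincare : ∃ C : ℝ, 0 < C ∧ ∀ u : H10,
    ‖u.u‖ ^ 2 ≤ C * (‖u.dx‖ ^ 2 + ‖u.dy‖ ^ 2) := by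
  obtain ⟨c, hc, h⟩ := exists_poincare_test
  refine ⟨2 * c ^ 2 + 1, by positivity, fun u => ?_⟩
  obtain ⟨w, h1, h2, h3⟩ := u.exists_gradGraph
  rw [← h1, ← h2, ← h3]
  have hw : ‖valL w‖ ≤ c * (‖dxL w‖ + ‖dyL w‖) :=
    gradGraph_induction (P := fun w => ‖valL w‖ ≤ c * (‖dxL w‖ + ‖dyL w‖))
      (isClosed_le (by fun_prop) (by fun_prop)) (fun φ hφ => h φ hφ) w
  have := pow_le_pow_left₀ (norm_nonneg _) hw 2
  nlinarith [mul_nonneg (sq_nonneg c) (sq_nonneg (‖dxL w‖ - ‖dyL w‖)),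
    sq_nonneg ‖dxL w‖, sq_nonneg ‖dyL w‖]

theorem poincareConst_nonneg : 0 ≤ poincareConst :=
  Real.sInf_nonneg fun _ h => h.1.le

/-- The infimum that defines the Poincaré constant is attained. -/
theorem poincare (u : H10) : ‖u.u‖ ^ 2 ≤ poincareConst * (‖u.dx‖ ^ 2 + ‖u.dy‖ ^ 2) := by
  set G := ‖u.dx‖ ^ 2 + ‖u.dy‖ ^ 2
  have hG : 0 ≤ G := by positivity
  obtain ⟨C, hC, hCu⟩ := exists_poincare
  rcases hG.eq_or_lt with h0 | hpos
  · have := hCu u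
    rw [← h0]; change _ ≤ C * G at this; rw [← h0] at this; simpa using this
  · rw [← div_le_iff₀ hpos]
    exact le_csInf ⟨C, hC, hCu⟩ fun b hb => (div_le_iff₀ hpos).2 (hb.2 u)

theorem norm_valL_le (w : gradGraph) : ‖valL w‖ ≤ 2 * √poincareConst * ‖dzL w‖ := by
  have h := poincare (toH10 w)
  change ‖valL w‖ ^ 2 ≤ poincareConst * (‖dxL w‖ ^ 2 + ‖dyL w‖ ^ 2) at h
  rw [← (norm_dzL_eq w).1] at h
  refine le_of_sq_le_sq ?_ (by positivity)
  rw [mul_pow, mul_pow, Real.sq_sqrt poincareConst_nonneg]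
  linarith

/-! ### Weyl's lemma for the Cauchy–Riemann operator -/


/-- Convolution of complex functions on the plane. -/
noncomputable abbrev cconv (f k : ℂ → ℂ) : ℂ → ℂ :=
  convolution f k (ContinuousLinearMap.mul ℝ ℂ) volume

/-- A rotation invariant smooth bump with support in the disc of radius `δ`. -/
noncomputable def radialBump (δ : ℝ) (z : ℂ) : ℂ :=
  ((1 - ‖z‖ ^ 2 / δ ^ 2).smoothTransition : ℝ)

theorem contDiff_radialBump (δ : ℝ) : ContDiff ℝ ∞ (radialBump δ) := by
  refine Complex.ofRealCLM.contDiff.comp (Real.smoothTransition.contDiff.comp ?_)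
  exact contDiff_const.sub ((contDiff_norm_sq ℝ).div_const _)

theorem radialBump_eq_zero {δ : ℝ} (hδ : 0 < δ) {z : ℂ} (hz : δ ≤ ‖z‖) : radialBump δ z = 0 := by
  unfold radialBump
  rw [Real.smoothTransition.zero_of_nonpos, Complex.ofReal_zero]
  rw [sub_nonpos, one_le_div (by positivity)]
  gcongr

theorem hasCompactSupport_radialBump {δ : ℝ} (hδ : 0 < δ) : HasCompactSupport (radialBump δ) :=
  HasCompactSupport.intro (isCompact_closedBall (0 : ℂ) δ) fun z hz =>
    radialBump_eq_zero hδ (by simpa using (not_le.1 (mt mem_closedBall_zero_iff.2 hz)).le)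

theorem integral_radialBump_ne_zero {δ : ℝ} (hδ : 0 < δ) : ∫ z, radialBump δ z ≠ 0 := by
  have hc : Continuous fun z : ℂ => (1 - ‖z‖ ^ 2 / δ ^ 2).smoothTransition :=
    Real.smoothTransition.continuous.comp (by fun_prop)
  have hs : HasCompactSupport fun z : ℂ => (1 - ‖z‖ ^ 2 / δ ^ 2).smoothTransition := by
    have := (hasCompactSupport_radialBump hδ).comp_left (g := Complex.re) rfl
    exact this
  unfold radialBump
  rw [integral_complex_ofReal]
  have h : 0 < ∫ z : ℂ, (1 - ‖z‖ ^ 2 / δ ^ 2).smoothTransition := by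
    refine hc.integral_pos_of_hasCompactSupport_nonneg_nonzero hs
      (fun z => Real.smoothTransition.nonneg _) (x := 0) ?_
    simp
  exact_mod_cast h.ne'

/-- The mean value property: averaging a holomorphic function against a radial bump reproduces its
value at the centre, up to the mass of the bump. -/
theorem integral_mul_radialBump {F : ℂ → ℂ} (hF : Continuous F) {δ R : ℝ} (hδ : 0 < δ)
    (hδR : δ < R) {c : ℂ} (hol : DifferentiableOn ℂ F (Metric.ball c R)) :
    ∫ w, radialBump δ w * F (c - w) = (∫ w, radialBump δ w) * F c := by
  set S := Metric.closedBall (0 : ℂ) δ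
  have hzero : ∀ g : ℂ → ℂ, ∫ w, radialBump δ w * g w = ∫ w in S, radialBump δ w * g w := by
    intro g
    refine (setIntegral_eq_integral_of_forall_compl_eq_zero fun z hz => ?_).symm
    rw [radialBump_eq_zero hδ (by simpa [S] using (not_le.1 (mt mem_closedBall_zero_iff.2 hz)).le),
      zero_mul]
  -- rotating the variable does not change the integral
  have hrot : ∀ θ : ℝ, ∫ w, radialBump δ w * F (c - w) =
      ∫ w in S, radialBump δ w * F (c - Circle.exp θ * w) := by
    intro θ
    rw [← hzero]
    have h := (rotation (Circle.exp θ)).measurePreserving.integral_comp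
      (rotation (Circle.exp θ)).toMeasurableEquiv.measurableEmbedding
      (fun w => radialBump δ w * F (c - w))
    rw [← h]
    refine integral_congr_ae (Eventually.of_forall fun w => ?_)
    simp only [radialBump, rotation_apply, norm_mul, Circle.norm_coe, one_mul]
  have hcont : Continuous (Function.uncurry fun (θ : ℝ) (w : ℂ) =>
      radialBump δ w * F (c - Circle.exp θ * w)) := by
    have := (contDiff_radialBump δ).continuous
    unfold Function.uncurry
    fun_prop
  have hint : Integrable (Function.uncurry fun (θ : ℝ) (w : ℂ) =>
      radialBump δ w * F (c - Circle.exp θ * w))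
      ((volume.restrict (Set.uIoc 0 (2 * Real.pi))).prod (volume.restrict S)) := by
    rw [Measure.prod_restrict]
    refine (hcont.continuousOn.integrableOn_compact (μ := volume.prod volume)
      ((isCompact_uIcc (a := 0) (b := 2 * Real.pi)).prod
        (isCompact_closedBall (0 : ℂ) δ))).mono_set ?_
    exact Set.prod_mono Set.uIoc_subset_uIcc subset_rfl
  have hswap := intervalIntegral_integral_swap hint
  simp only [← hrot, intervalIntegral.integral_const, sub_zero] at hswap
  have hmean : ∀ w ∈ S, ∫ θ in (0 : ℝ)..2 * Real.pi, radialBump δ w * F (c - Circle.exp θ * w) =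
      (2 * Real.pi) • (radialBump δ w * F c) := by
    intro w hw
    rw [intervalIntegral.integral_const_mul]
    have hG : DifferentiableOn ℂ (fun u => F (c - u * w)) (Metric.closedBall 0 1) := by
      intro u hu
      have hm : c - u * w ∈ Metric.ball c R := by
        rw [mem_ball_iff_norm, sub_sub_cancel_left, norm_neg, norm_mul]
        calc ‖u‖ * ‖w‖ ≤ 1 * δ := by
              gcongr
              · simpa using hu
              · simpa [S] using hw
          _ < R := by linarith
      have h1 := (hol _ hm).differentiableAt (Metric.isOpen_ball.mem_nhds hm)
      have h2 : DifferentiableAt ℂ (fun u => c - u * w) u := by fun_prop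
      exact (h1.comp u h2).differentiableWithinAt
    have hcl : DiffContOnCl ℂ (fun u => F (c - u * w)) (Metric.ball 0 |1|) := by
      rw [abs_one]
      exact (hG.mono Metric.closure_ball_subset_closedBall).diffContOnCl
    have h := hcl.circleAverage
    rw [Real.circleAverage_def, zero_mul, sub_zero] at h
    have hI : ∫ θ in (0 : ℝ)..2 * Real.pi, F (c - Circle.exp θ * w) = (2 * Real.pi) • F c := by
      rw [← h, smul_inv_smul₀ Real.two_pi_pos.ne']
      simp [circleMap]
    rw [hI, mul_smul_comm]
  rw [setIntegral_congr_fun Metric.isClosed_closedBall.measurableSet hmean, integral_smul,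
    ← hzero, integral_mul_const] at hswap
  exact smul_right_injective ℂ Real.two_pi_pos.ne' hswap

section Weyl

variable {H : ℂ → ℂ}

theorem hasFDerivAt_cconv (hH : LocallyIntegrable H volume) {k : ℂ → ℂ} (hk : ContDiff ℝ ∞ k)
    (hc : HasCompactSupport k) (z : ℂ) :
    DifferentiableAt ℝ (cconv H k) z ∧
      ∀ v, fderiv ℝ (cconv H k) z v = ∫ w, H w * fderiv ℝ k (z - w) v := by
  have hk1 : ContDiff ℝ 1 k := hk.of_le (by simp)
  have h := hc.hasFDerivAt_convolution_right (ContinuousLinearMap.mul ℝ ℂ) hH hk1 z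
  refine ⟨h.differentiableAt, fun v => ?_⟩
  rw [h.fderiv, convolution_precompR_apply _ hH (hc.fderiv ℝ) (hk1.continuous_fderiv (by simp))]
  rfl

/-- Mollifying a weak solution of `∂̄ H = 0` gives a holomorphic function, away from the
boundary. -/
theorem differentiableAt_cconv (hH : LocallyIntegrable H volume)
    (hweak : ∀ φ, IsTest φ → ∫ z, H z * (partialX φ z + Complex.I * partialY φ z) = 0)
    {k : ℂ → ℂ} (hk : ContDiff ℝ ∞ k) (hc : HasCompactSupport k) {δ : ℝ}
    (hsupp : ∀ w, δ ≤ ‖w‖ → k w = 0) {z : ℂ} (hz : ‖z‖ + δ < 1) :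
    DifferentiableAt ℂ (cconv H k) z := by
  obtain ⟨hd, hv⟩ := hasFDerivAt_cconv hH hk hc z
  refine differentiableAt_complex_iff_differentiableAt_real.2 ⟨hd, ?_⟩
  have htest : IsTest fun w => k (z - w) := by
    refine ⟨hk.comp (contDiff_const.sub contDiff_id),
      hc.comp_homeomorph (Homeomorph.subLeft z), ?_⟩
    refine (closure_minimal (t := Metric.closedBall z δ) (fun w hw => ?_)
      Metric.isClosed_closedBall).trans fun w hw => ?_
    · rw [Metric.mem_closedBall, dist_comm, dist_eq_norm]
      by_contra h
      exact hw (hsupp _ (not_le.1 h).le)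
    · rw [mem_ball_zero_iff]
      rw [Metric.mem_closedBall, dist_eq_norm] at hw
      calc ‖w‖ = ‖z + (w - z)‖ := by congr 1; ring
        _ ≤ ‖z‖ + ‖w - z‖ := norm_add_le _ _
        _ < 1 := by linarith
  have hder : ∀ w v, fderiv ℝ (fun w => k (z - w)) w v = -fderiv ℝ k (z - w) v := by
    intro w v
    have h1 : HasFDerivAt k (fderiv ℝ k (z - w)) (z - w) :=
      (hk.differentiable (by simp) _).hasFDerivAt
    have h2 : HasFDerivAt (fun w : ℂ => z - w) (-ContinuousLinearMap.id ℝ ℂ) w :=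
      (hasFDerivAt_id w).const_sub z
    have h3 : HasFDerivAt (fun w => k (z - w)) _ w := HasFDerivAt.comp w h1 h2
    rw [h3.fderiv]
    simp
  have hint : ∀ v, Integrable fun w => H w * fderiv ℝ k (z - w) v := by
    intro v
    have := (hc.fderiv_apply ℝ v).convolutionExists_right (ContinuousLinearMap.mul ℝ ℂ) hH
      (((hk.fderiv_right (m := ∞) (by norm_cast)).clm_apply contDiff_const).continuous) z
    exact this
  have h0 := hweak _ htest
  simp only [partialX, partialY, hder] at h0
  rw [hv, hv, smul_eq_mul, ← integral_const_mul, ← sub_eq_zero, ← integral_sub (hint _)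
    ((hint _).const_mul _)]
  have h1 := congrArg (Complex.I * ·) h0
  simp only [mul_zero, ← integral_const_mul] at h1
  rw [← h1]
  refine integral_congr_ae (Eventually.of_forall fun w => ?_)
  linear_combination (H w * (fderiv ℝ k (z - w)) Complex.I) * Complex.I_mul_I

theorem cconv_assoc (hH : Integrable H volume) {k l : ℂ → ℂ} (hk : Continuous k)
    (hkc : HasCompactSupport k) (hl : Continuous l) (hlc : HasCompactSupport l) :
    cconv (cconv H k) l = cconv (cconv H l) k := by
  have key : ∀ {k l : ℂ → ℂ}, Continuous k → HasCompactSupport k → Continuous l →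
      HasCompactSupport l → cconv (cconv H k) l = cconv H (cconv k l) := by
    intro k l hk hkc hl hlc
    funext z
    refine convolution_assoc _ _ _ _ (fun x y z => mul_assoc x y z) hH.aestronglyMeasurable
      hk.aestronglyMeasurable hl.aestronglyMeasurable
      (Eventually.of_forall (hkc.convolutionExists_right (ContinuousLinearMap.mul ℝ ℂ)
        hH.locallyIntegrable hk))
      (Eventually.of_forall (HasCompactSupport.convolutionExists_right
        (ContinuousLinearMap.mul ℝ ℝ) hlc.norm hk.norm.locallyIntegrable hl.norm)) ?_
    refine HasCompactSupport.convolutionExists_right (ContinuousLinearMap.mul ℝ ℝ) ?_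
      hH.norm.locallyIntegrable ?_ z
    · exact HasCompactSupport.convolution (ContinuousLinearMap.mul ℝ ℝ) hkc.norm hlc.norm
    · exact HasCompactSupport.continuous_convolution_right (ContinuousLinearMap.mul ℝ ℝ) hlc.norm
        hk.norm.locallyIntegrable hl.norm
  have hcomm : cconv k l = cconv l k := by
    funext z
    refine (convolution_eq_swap _).trans ?_
    simp only [convolution, ContinuousLinearMap.mul_apply', mul_comm]
  rw [key hk hkc hl hlc, key hl hlc hk hkc, hcomm]

/-- Weyl's lemma: a weak solution of `∂̄ H = 0` in the disc is holomorphic. With `φ_n` mollifiers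
and `ρ` a radial bump, the mean value property gives `(∫ ρ) (H * φ_n) = (H * φ_n) * ρ =
(H * ρ) * φ_n`, which tends to `H * ρ`. -/
theorem weyl (hH : Integrable H volume)
    (hweak : ∀ φ, IsTest φ → ∫ z, H z * (partialX φ z + Complex.I * partialY φ z) = 0) :
    ∃ h : ℂ → ℂ, DifferentiableOn ℂ h (Metric.ball 0 1) ∧ H =ᵐ[volume] h := by
  have hr : ∀ n : ℕ, (0 : ℝ) < 1 / (n + 1) := fun n => by positivity
  let φ : ℕ → ContDiffBump (0 : ℂ) := fun n =>
    { rIn := 1 / (n + 1) / 2, rOut := 1 / (n + 1), rIn_pos := half_pos (hr n),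
      rIn_lt_rOut := half_lt_self (hr n) }
  have hφlim : Tendsto (fun n => (φ n).rOut) atTop (𝓝 0) := tendsto_one_div_add_atTop_nhds_zero_nat
  let k : ℕ → ℂ → ℂ := fun n w => ((φ n).normed volume w : ℂ)
  have hk : ∀ n, ContDiff ℝ ∞ (k n) := fun n =>
    Complex.ofRealCLM.contDiff.comp (φ n).contDiff_normed
  have hkc : ∀ n, HasCompactSupport (k n) := fun n =>
    (φ n).hasCompactSupport_normed.comp_left (g := Complex.ofReal) Complex.ofReal_zero
  have hksupp : ∀ n w, (φ n).rOut ≤ ‖w‖ → k n w = 0 := by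
    intro n w hw
    have : w ∉ Function.support ((φ n).normed volume) := by
      rw [(φ n).support_normed_eq, mem_ball_zero_iff]
      exact not_lt.2 hw
    simp only [k, Function.notMem_support.1 this, Complex.ofReal_zero]
  have hconv : ∀ (n : ℕ) (f : ℂ → ℂ), cconv f (k n) =
      convolution ((φ n).normed volume) f (ContinuousLinearMap.lsmul ℝ ℝ) volume := by
    intro n f
    funext z
    rw [convolution_lsmul]
    refine (convolution_eq_swap _).trans ?_
    refine integral_congr_ae (Eventually.of_forall fun w => ?_)
    simp [k, mul_comm]
  have hHl := hH.locallyIntegrable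
  -- the candidate: the pointwise limit of the mollifications
  refine ⟨fun z => limUnder atTop fun n => cconv H (k n) z, ?_, ?_⟩
  · intro z hz
    rw [mem_ball_zero_iff] at hz
    obtain ⟨δ, hδ, hδz⟩ : ∃ δ : ℝ, 0 < δ ∧ ‖z‖ + δ < 1 :=
      ⟨(1 - ‖z‖) / 2, by linarith, by linarith⟩
    set ρ := radialBump δ
    have hρc := (contDiff_radialBump δ).continuous
    have hρs := hasCompactSupport_radialBump hδ
    have hcont : Continuous (cconv H ρ) := hρs.continuous_convolution_right _ hHl hρc
    have hlim : ∀ y, ‖y‖ + δ < 1 → Tendsto (fun n => cconv H (k n) y) atTop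
        (𝓝 ((∫ w, ρ w)⁻¹ * cconv H ρ y)) := by
      intro y hy
      have h1 : Tendsto (fun n => cconv (cconv H ρ) (k n) y) atTop (𝓝 (cconv H ρ y)) := by
        simp only [hconv]
        exact ContDiffBump.convolution_tendsto_right_of_continuous hφlim hcont y
      refine (h1.const_mul (∫ w, ρ w)⁻¹).congr' ?_
      have hev : ∀ᶠ n in atTop, (φ n).rOut < 1 - ‖y‖ - δ :=
        hφlim.eventually_lt_const (by linarith)
      filter_upwards [hev] with n hn
      rw [cconv_assoc hH hρc hρs (hk n).continuous (hkc n)]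
      have hF : Continuous (cconv H (k n)) :=
        (hkc n).continuous_convolution_right _ hHl (hk n).continuous
      have hm := integral_mul_radialBump hF hδ
        (R := 1 - ‖y‖ - (φ n).rOut) (by linarith) (c := y) (fun x hx => by
          rw [mem_ball_iff_norm] at hx
          refine (differentiableAt_cconv hHl hweak (hk n) (hkc n) (hksupp n)
            ?_).differentiableWithinAt
          have : ‖x‖ ≤ ‖y‖ + ‖x - y‖ := by
            calc ‖x‖ = ‖y + (x - y)‖ := by congr 1; ring
              _ ≤ _ := norm_add_le _ _
          linarith)
      have h2 : cconv (cconv H (k n)) ρ y = ∫ w, ρ w * cconv H (k n) (y - w) := by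
        refine (convolution_eq_swap _).trans ?_
        refine integral_congr_ae (Eventually.of_forall fun w => ?_)
        simp [mul_comm]
      rw [h2, hm, inv_mul_cancel_left₀ (integral_radialBump_ne_zero hδ)]
    have hopen : ∀ᶠ y in 𝓝 z, ‖y‖ + δ < 1 :=
      (continuous_norm.add continuous_const).continuousAt.eventually_lt
        continuousAt_const hδz
    have hdiff : DifferentiableAt ℂ (fun y => (∫ w, ρ w)⁻¹ * cconv H ρ y) z :=
      (differentiableAt_cconv hHl hweak (contDiff_radialBump δ) hρs
        (fun w hw => radialBump_eq_zero hδ hw) hδz).const_mul _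
    refine (hdiff.congr_of_eventuallyEq ?_).differentiableWithinAt
    filter_upwards [hopen] with y hy
    exact (hlim y hy).limUnder_eq
  · have h := ContDiffBump.ae_convolution_tendsto_right_of_locallyIntegrable (φ := φ) (K := 2)
      hφlim (Eventually.of_forall fun n => (mul_div_cancel₀ _ two_ne_zero).ge) hHl
    filter_upwards [h] with z hz
    simp only [hconv]
    exact hz.limUnder_eq.symm

end Weyl

/-- Weyl's lemma in `L²(M)`. -/
theorem isHolo_of_weak (h : L2M) (hweak : ∀ φ, IsTest φ →
    ∫ z, h z * (partialX φ z + Complex.I * partialY φ z) ∂discMeasure = 0) : IsHolo h := by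
  have hms : MeasurableSet disc := Metric.isClosed_closedBall.measurableSet
  have hint : Integrable (disc.indicator h) volume := by
    rw [integrable_indicator_iff hms]
    exact (Lp.memLp h).integrable (by norm_num)
  obtain ⟨g, hg, hae⟩ := weyl hint fun φ hφ => by
    refine Eq.trans ?_ ((integral_indicator hms).trans (hweak φ hφ))
    refine integral_congr_ae (Eventually.of_forall fun z => ?_)
    by_cases hz : z ∈ disc <;> simp [hz]
  refine ⟨g, hg, ?_⟩
  have h1 : disc.indicator h =ᵐ[discMeasure] g := ae_restrict_of_ae hae
  have h2 : disc.indicator h =ᵐ[discMeasure] h := indicator_ae_eq_restrict hms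
  exact h2.symm.trans h1

/-! ### The decompositions `L²(M) = ∂ H¹₀ ⊕ ker ∂̄` and `L²(M) = ∂̄ H¹₀ ⊕ ker ∂` -/


theorem coeFn_dzL {φ : ℂ → ℂ} (hφ : IsTest φ) : dzL hφ.toGraph =ᵐ[discMeasure]
    fun z => (1 / 2 : ℂ) * (partialX φ z - Complex.I * partialY φ z) := by
  change ((1 / 2 : ℂ) • (hφ.partialX.toL2 - Complex.I • hφ.partialY.toL2) : L2M) =ᵐ[_] _
  filter_upwards [Lp.coeFn_smul (1 / 2 : ℂ) (hφ.partialX.toL2 - Complex.I • hφ.partialY.toL2),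
    Lp.coeFn_sub hφ.partialX.toL2 (Complex.I • hφ.partialY.toL2),
    Lp.coeFn_smul Complex.I hφ.partialY.toL2, hφ.partialX.coeFn_toL2,
    hφ.partialY.coeFn_toL2] with z h1 h2 h3 h4 h5
  rw [h1, Pi.smul_apply, h2, Pi.sub_apply, h3, Pi.smul_apply, h4, h5, smul_eq_mul, smul_eq_mul]

theorem coeFn_dzbarL {φ : ℂ → ℂ} (hφ : IsTest φ) : dzbarL hφ.toGraph =ᵐ[discMeasure]
    fun z => (1 / 2 : ℂ) * (partialX φ z + Complex.I * partialY φ z) := by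
  change ((1 / 2 : ℂ) • (hφ.partialX.toL2 + Complex.I • hφ.partialY.toL2) : L2M) =ᵐ[_] _
  filter_upwards [Lp.coeFn_smul (1 / 2 : ℂ) (hφ.partialX.toL2 + Complex.I • hφ.partialY.toL2),
    Lp.coeFn_add hφ.partialX.toL2 (Complex.I • hφ.partialY.toL2),
    Lp.coeFn_smul Complex.I hφ.partialY.toL2, hφ.partialX.coeFn_toL2,
    hφ.partialY.coeFn_toL2] with z h1 h2 h3 h4 h5
  rw [h1, Pi.smul_apply, h2, Pi.add_apply, h3, Pi.smul_apply, h4, h5, smul_eq_mul, smul_eq_mul]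

theorem isHolo_of_inner_dzL {h : L2M} (hh : ∀ w, (inner ℂ (dzL w) h : ℂ) = 0) : IsHolo h := by
  refine isHolo_of_weak h fun φ hφ => ?_
  have h1 := hh hφ.star.toGraph
  rw [L2.inner_def] at h1
  have h2 : ∫ z, h z * (partialX φ z + Complex.I * partialY φ z) ∂discMeasure =
      2 * ∫ z, inner ℂ (dzL hφ.star.toGraph z) (h z) ∂discMeasure := by
    rw [← integral_const_mul]
    refine integral_congr_ae ?_
    filter_upwards [coeFn_dzL hφ.star] with z hz
    rw [hz]
    simp only [partialX, partialY, hφ.fderiv_star, RCLike.inner_apply, map_mul, map_sub,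
      Complex.conj_conj, Complex.conj_I, map_div₀, map_one, Complex.conj_ofNat]
    ring
  rw [h2, h1, mul_zero]

theorem isAntiholo_of_inner_dzbarL {h : L2M} (hh : ∀ w, (inner ℂ (dzbarL w) h : ℂ) = 0) :
    IsAntiholo h := by
  have hmem : MemLp (fun z => starRingEnd ℂ (h z)) 2 discMeasure := (Lp.memLp h).star
  obtain ⟨g, hg, hae⟩ := isHolo_of_weak (hmem.toLp _) fun φ hφ => by
    have h1 := hh hφ.toGraph
    rw [L2.inner_def] at h1
    have h2 : ∫ z, hmem.toLp _ z * (partialX φ z + Complex.I * partialY φ z) ∂discMeasure =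
        2 * starRingEnd ℂ (∫ z, inner ℂ (dzbarL hφ.toGraph z) (h z) ∂discMeasure) := by
      rw [← integral_conj, ← integral_const_mul]
      refine integral_congr_ae ?_
      filter_upwards [coeFn_dzbarL hφ, hmem.coeFn_toLp] with z hz hz'
      rw [hz, hz']
      simp only [RCLike.inner_apply, map_mul, Complex.conj_conj]
      ring
    rw [h2, h1, map_zero, mul_zero]
  refine ⟨fun z => starRingEnd ℂ (g z), by simpa only [Complex.conj_conj] using hg, ?_⟩
  filter_upwards [hae, hmem.coeFn_toLp] with z hz hz'
  rw [← hz, hz', Complex.conj_conj]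

/-- Solving `D w = b` in the least squares sense, for an operator `D` that is bounded below. -/
theorem exists_leastSquares {Γ E : Type*} [NormedAddCommGroup Γ] [NormedSpace ℂ Γ]
    [CompleteSpace Γ] [NormedAddCommGroup E] [InnerProductSpace ℂ E] [CompleteSpace E]
    (D : Γ →L[ℂ] E) {c : ℝ} (hD : ∀ w, ‖w‖ ≤ c * ‖D w‖) :
    ∃ T : E →L[ℂ] Γ, ∀ b w, (inner ℂ (D w) (b - D (T b)) : ℂ) = 0 := by
  have hanti : AntilipschitzWith c.toNNReal D := by
    refine AddMonoidHomClass.antilipschitz_of_bound D fun w => (hD w).trans ?_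
    gcongr
    exact Real.le_coe_toNNReal c
  have hcl : IsClosed (Set.range D) := hanti.isClosed_range D.uniformContinuous
  have hcl' : IsClosed (D.range : Set E) := hcl
  have : CompleteSpace D.range := hcl'.completeSpace_coe
  let e := D.equivRange hanti.injective hcl
  refine ⟨(e.symm : D.range →L[ℂ] Γ).comp (D.range).orthogonalProjectionOnto, fun b w => ?_⟩
  have h1 : D (e.symm ((D.range).orthogonalProjectionOnto b)) =
      (D.range).orthogonalProjectionOnto b := by
    have := congrArg Subtype.val (e.apply_symm_apply ((D.range).orthogonalProjectionOnto b))
    exact this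
  change inner ℂ (D w) (b - D (e.symm ((D.range).orthogonalProjectionOnto b))) = (0 : ℂ)
  rw [h1]
  exact Submodule.inner_right_of_mem_orthogonal (K := D.range) ⟨w, rfl⟩
    (Submodule.sub_starProjection_mem_orthogonal b)

theorem norm_le_norm_dzL (w : gradGraph) : ‖w‖ ≤ (2 * √poincareConst + 2) * ‖dzL w‖ := by
  have h1 := norm_valL_le w
  have h2 := (norm_dzL_eq w).1
  have h3 : ‖dxL w‖ ≤ 2 * ‖dzL w‖ :=
    le_of_sq_le_sq (by nlinarith [sq_nonneg ‖dyL w‖]) (by positivity)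
  have h4 : ‖dyL w‖ ≤ 2 * ‖dzL w‖ :=
    le_of_sq_le_sq (by nlinarith [sq_nonneg ‖dxL w‖]) (by positivity)
  have h5 : 0 ≤ √poincareConst * ‖dzL w‖ := by positivity
  have h6 := norm_nonneg (dzL w)
  change max ‖valL w‖ (max ‖dxL w‖ ‖dyL w‖) ≤ _
  refine max_le (by linarith) (max_le (by linarith) (by linarith))

theorem exists_solveDz : ∃ T : L2M →L[ℂ] gradGraph,
    ∀ b w, (inner ℂ (dzL w) (b - dzL (T b)) : ℂ) = 0 :=
  exists_leastSquares dzL norm_le_norm_dzL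

theorem exists_solveDzbar : ∃ T : L2M →L[ℂ] gradGraph,
    ∀ b w, (inner ℂ (dzbarL w) (b - dzbarL (T b)) : ℂ) = 0 :=
  exists_leastSquares dzbarL (c := 2 * √poincareConst + 2) fun w => by
    rw [(norm_dzL_eq w).2]; exact norm_le_norm_dzL w

/-- `solveDz b ∈ H¹₀(M)` is the `w` for which `∂ w` is the orthogonal projection of `b` on
`∂ H¹₀(M)`. -/
noncomputable def solveDz : L2M →L[ℂ] gradGraph := exists_solveDz.choose

/-- `solveDzbar b ∈ H¹₀(M)` is the `w` for which `∂̄ w` is the orthogonal projection of `b` on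
`∂̄ H¹₀(M)`. -/
noncomputable def solveDzbar : L2M →L[ℂ] gradGraph := exists_solveDzbar.choose

theorem inner_dzL_sub (b : L2M) (w : gradGraph) :
    (inner ℂ (dzL w) (b - dzL (solveDz b)) : ℂ) = 0 := exists_solveDz.choose_spec b w

theorem inner_dzbarL_sub (b : L2M) (w : gradGraph) :
    (inner ℂ (dzbarL w) (b - dzbarL (solveDzbar b)) : ℂ) = 0 := exists_solveDzbar.choose_spec b w

theorem isHolo_sub_solveDz (b : L2M) : IsHolo (b - dzL (solveDz b)) :=
  isHolo_of_inner_dzL (inner_dzL_sub b)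

theorem isAntiholo_sub_solveDzbar (b : L2M) : IsAntiholo (b - dzbarL (solveDzbar b)) :=
  isAntiholo_of_inner_dzbarL (inner_dzbarL_sub b)

/-! ### Angular modes -/


theorem coeFn_tensor (c : C(Ang, ℂ)) (u : L2M) :
    tensor c u =ᵐ[smMeasure] fun p => c p.2 * u p.1 := MemLp.coeFn_toLp _

theorem integral_volume_ang (g : Ang → ℂ) :
    ∫ θ, g θ = (2 * Real.pi : ℂ) * ∫ θ, g θ ∂AddCircle.haarAddCircle := by
  rw [AddCircle.volume_eq_smul_haarAddCircle, integral_smul_measure,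
    ENNReal.toReal_ofReal Real.two_pi_pos.le, Complex.real_smul]
  push_cast
  rfl

/-- Fubini's theorem for the pairing of `e^{inθ} u(x)` with `f`. -/
theorem inner_tensor_fourier (n : ℤ) (u : L2M) (f : L2SM) :
    (inner ℂ (tensor (fourier n) u) f : ℂ) =
      (2 * Real.pi : ℂ) * ∫ x, starRingEnd ℂ (u x) * moment n f x ∂discMeasure := by
  have hint := L2.integrable_inner (𝕜 := ℂ) (tensor (fourier n) u) f
  rw [L2.inner_def]
  have h1 : (fun p => (inner ℂ (tensor (fourier n) u p) (f p) : ℂ)) =ᵐ[smMeasure]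
      fun p => starRingEnd ℂ (u p.1) * (fourier (-n) p.2 • f p) := by
    filter_upwards [coeFn_tensor (fourier n) u] with p hp
    rw [hp, RCLike.inner_apply, map_mul, fourier_neg, smul_eq_mul]
    ring
  rw [integral_congr_ae h1]
  have hint' := hint.congr h1
  unfold smMeasure at hint' ⊢
  rw [integral_prod _ hint', ← integral_const_mul]
  refine integral_congr_ae (Eventually.of_forall fun x => ?_)
  simp only [moment, fourierCoeff]
  rw [integral_const_mul, integral_volume_ang]
  ring

theorem moment_tensor_fourier (n m : ℤ) (u : L2M) :
    moment n (tensor (fourier m) u) =ᵐ[discMeasure] fun x => if n = m then u x else 0 := by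
  filter_upwards [moment_congr (coeFn_tensor (fourier m) u) n] with x hx
  rw [hx]
  simp only [moment]
  have h := fourierCoeff.const_mul (fun θ : Ang => (fourier m θ : ℂ)) (u x) n
  simp only [mul_comm (u x)] at h
  rw [h, fourierCoeff_fourier, Pi.single_apply]
  split_ifs <;> simp

theorem inner_tensor_tensor (n m : ℤ) (u v : L2M) :
    (inner ℂ (tensor (fourier n) u) (tensor (fourier m) v) : ℂ) =
      if n = m then (2 * Real.pi : ℂ) * inner ℂ u v else 0 := by
  rw [inner_tensor_fourier]
  have h : ∫ x, starRingEnd ℂ (u x) * moment n (tensor (fourier m) v) x ∂discMeasure =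
      ∫ x, (if n = m then inner ℂ (u x) (v x) else 0) ∂discMeasure := by
    refine integral_congr_ae ?_
    filter_upwards [moment_tensor_fourier n m v] with x hx
    rw [hx]
    split_ifs
    · rw [RCLike.inner_apply, mul_comm]
    · rw [mul_zero]
  rw [h]
  split_ifs
  · rw [L2.inner_def]
  · simp

theorem tensor_add (c : C(Ang, ℂ)) (u v : L2M) : tensor c (u + v) = tensor c u + tensor c v := by
  refine Lp.ext ?_
  have h := (Measure.quasiMeasurePreserving_fst (μ := discMeasure) (ν := (volume : Measure Ang))).ae
    (Lp.coeFn_add u v)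
  filter_upwards [coeFn_tensor c (u + v), coeFn_tensor c u, coeFn_tensor c v,
    Lp.coeFn_add (tensor c u) (tensor c v), h] with p h1 h2 h3 h4 h5
  rw [h1, h4, Pi.add_apply, h2, h3, h5, Pi.add_apply, mul_add]

theorem tensor_smul (c : C(Ang, ℂ)) (a : ℂ) (u : L2M) : tensor c (a • u) = a • tensor c u := by
  refine Lp.ext ?_
  have h := (Measure.quasiMeasurePreserving_fst (μ := discMeasure) (ν := (volume : Measure Ang))).ae
    (Lp.coeFn_smul a u)
  filter_upwards [coeFn_tensor c (a • u), coeFn_tensor c u,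
    Lp.coeFn_smul a (tensor c u), h] with p h1 h2 h3 h4
  rw [h1, h3, Pi.smul_apply, h2, h4, Pi.smul_apply, smul_eq_mul, smul_eq_mul, mul_left_comm]

theorem norm_tensor_fourier_sq (n : ℤ) (u : L2M) :
    ‖tensor (fourier n) u‖ ^ 2 = 2 * Real.pi * ‖u‖ ^ 2 := by
  have h := inner_tensor_tensor n n u u
  rw [if_pos rfl, inner_self_eq_norm_sq_to_K, inner_self_eq_norm_sq_to_K] at h
  exact Complex.ofReal_injective (by push_cast; exact h)

/-- The embedding `u ↦ e^{inθ} u(x)` of `L²(M)` in `L²(SM)`. -/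
noncomputable def modeL (n : ℤ) : L2M →L[ℂ] L2SM :=
  LinearMap.mkContinuous ⟨⟨tensor (fourier n), tensor_add _⟩, tensor_smul _⟩ (√(2 * Real.pi))
    fun u => by
      refine le_of_sq_le_sq ?_ (by positivity)
      rw [mul_pow, Real.sq_sqrt Real.two_pi_pos.le]
      exact (norm_tensor_fourier_sq n u).le

theorem modeL_apply (n : ℤ) (u : L2M) : modeL n u = tensor (fourier n) u := rfl

theorem norm_modeL_sq (n : ℤ) (u : L2M) : ‖modeL n u‖ ^ 2 = 2 * Real.pi * ‖u‖ ^ 2 :=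
  norm_tensor_fourier_sq n u

theorem norm_modeL (n : ℤ) (u : L2M) : ‖modeL n u‖ = √(2 * Real.pi) * ‖u‖ := by
  rw [← sq_eq_sq₀ (norm_nonneg _) (by positivity), norm_modeL_sq, mul_pow,
    Real.sq_sqrt Real.two_pi_pos.le]

theorem inner_modeL_of_ne {n m : ℤ} (h : n ≠ m) (u v : L2M) :
    (inner ℂ (modeL n u) (modeL m v) : ℂ) = 0 :=
  (inner_tensor_tensor n m u v).trans (if_neg h)

/-- The angular moment `f ↦ (2π)⁻¹ ∫ f e^{-inθ} dθ` as an operator `L²(SM) → L²(M)`. -/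
noncomputable def momentL (n : ℤ) : L2SM →L[ℂ] L2M :=
  (2 * Real.pi : ℂ)⁻¹ • ContinuousLinearMap.adjoint (modeL n)

theorem two_pi_ne_zero' : (2 * Real.pi : ℂ) ≠ 0 := by
  exact_mod_cast Real.two_pi_pos.ne'

theorem inner_momentL (n : ℤ) (u : L2M) (f : L2SM) :
    (inner ℂ u (momentL n f) : ℂ) = (2 * Real.pi : ℂ)⁻¹ * inner ℂ (modeL n u) f := by
  change inner ℂ u ((2 * Real.pi : ℂ)⁻¹ • ContinuousLinearMap.adjoint (modeL n) f) = _
  rw [inner_smul_right, ContinuousLinearMap.adjoint_inner_right]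

theorem momentL_modeL (n m : ℤ) (u : L2M) :
    momentL n (modeL m u) = if n = m then u else 0 := by
  refine ext_inner_left ℂ fun v => ?_
  rw [inner_momentL, modeL_apply, modeL_apply, inner_tensor_tensor]
  split_ifs
  · rw [inv_mul_cancel_left₀ two_pi_ne_zero']
  · rw [mul_zero, inner_zero_right]

theorem momentL_ae (n : ℤ) (f : L2SM) : momentL n f =ᵐ[discMeasure] moment n f := by
  have hint : Integrable (moment n f) discMeasure := by
    have h1 : Integrable f smMeasure := (Lp.memLp f).integrable (by norm_num)
    have h2 : Integrable (fun p : ℂ × Ang => fourier (-n) p.2 • f p) smMeasure := by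
      refine h1.bdd_mul (c := 1) ((fourier (-n) : C(Ang, ℂ)).continuous.comp
        continuous_snd).aestronglyMeasurable (Eventually.of_forall fun p => ?_)
      exact (Circle.norm_coe _).le
    have h3 := h2.integral_prod_left.const_mul (2 * Real.pi : ℂ)⁻¹
    refine h3.congr (Eventually.of_forall fun x => ?_)
    simp only [moment, fourierCoeff]
    rw [integral_volume_ang, inv_mul_cancel_left₀ two_pi_ne_zero']
  refine Integrable.ae_eq_of_forall_setIntegral_eq _ _
    ((Lp.memLp _).integrable (by norm_num)) hint fun s hs hμ => ?_
  rw [← L2.inner_indicatorConstLp_one (𝕜 := ℂ) hs hμ.ne, inner_momentL, modeL_apply,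
    inner_tensor_fourier, inv_mul_cancel_left₀ two_pi_ne_zero', ← integral_indicator hs]
  refine integral_congr_ae ?_
  filter_upwards [indicatorConstLp_coeFn (p := 2) (hs := hs) (hμs := hμ.ne) (c := (1 : ℂ))]
    with x hx
  rw [hx]
  by_cases h : x ∈ s <;> simp [h]

theorem sqNormM_moment (n : ℤ) (f : L2SM) :
    sqNormM (moment n f) = ENNReal.ofReal (‖momentL n f‖ ^ 2) := by
  unfold sqNormM
  rw [← eLpNorm_congr_ae (momentL_ae n f), ENNReal.ofReal_pow (norm_nonneg _), ofReal_norm,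
    Lp.enorm_def]

/-- Completeness of the angular modes. -/
theorem eq_zero_of_momentL {f : L2SM} (hf : ∀ n, momentL n f = 0) : f = 0 := by
  have h0 : ∀ n, moment n f =ᵐ[discMeasure] 0 := fun n => by
    refine (momentL_ae n f).symm.trans ?_
    rw [hf n]
    exact Lp.coeFn_zero _ _ _
  have hmeas : StronglyMeasurable f := Lp.stronglyMeasurable f
  have hL2 : ∀ᵐ x ∂discMeasure, MemLp (fun θ => f (x, θ)) 2 (volume : Measure Ang) := by
    have h1 : Integrable (fun p => ‖f p‖ ^ 2) smMeasure :=
      (Lp.memLp f).integrable_norm_pow (by simp)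
    filter_upwards [h1.prod_right_ae] with x hx
    exact (memLp_two_iff_integrable_sq_norm
      (hmeas.comp_measurable measurable_prodMk_left).aestronglyMeasurable).2 hx
  have hfib : ∀ᵐ x ∂discMeasure, ∀ᵐ θ ∂(volume : Measure Ang), f (x, θ) = 0 := by
    filter_upwards [hL2, ae_all_iff.2 h0] with x hx h
    have hx' : MemLp (fun θ => f (x, θ)) 2 AddCircle.haarAddCircle :=
      memLp_haarAddCircle_iff.2 hx
    have hz : hx'.toLp _ = 0 := by
      refine (fourierBasis (T := 2 * Real.pi)).repr.injective ?_
      rw [map_zero]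
      ext n
      rw [fourierBasis_repr, fourierCoeff_congr_ae hx'.coeFn_toLp]
      exact h n
    have h3 : (fun θ => f (x, θ)) =ᵐ[AddCircle.haarAddCircle] 0 :=
      hx'.coeFn_toLp.symm.trans (by rw [hz]; exact Lp.coeFn_zero _ _ _)
    rw [AddCircle.volume_eq_smul_haarAddCircle]
    exact Measure.ae_smul_measure h3 _
  refine Lp.ext ?_
  have h4 : ∀ᵐ p ∂smMeasure, f p = 0 :=
    (Measure.ae_prod_iff_ae_ae (hmeas.measurable (measurableSet_singleton 0))).2 hfib
  filter_upwards [h4, Lp.coeFn_zero ℂ 2 smMeasure] with p hp h5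
  rw [hp, h5]; rfl

/-- Pythagoras' theorem for finitely many modes. -/
theorem norm_sum_modeL_sq (c₀ : L2M) (c d : ℕ → L2M) (K : ℕ) :
    ‖modeL 0 c₀ + ∑ k ∈ Finset.range K, (modeL (k + 1 : ℤ) (c k) + modeL (-(k + 1 : ℤ)) (d k))‖ ^ 2
      = 2 * Real.pi * (‖c₀‖ ^ 2 + ∑ k ∈ Finset.range K, (‖c k‖ ^ 2 + ‖d k‖ ^ 2)) := by
  induction K with
  | zero => simp [norm_modeL_sq]
  | succ K ih =>
    rw [Finset.sum_range_succ, ← add_assoc, norm_add_sq (𝕜 := ℂ), ih, norm_add_sq (𝕜 := ℂ),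
      inner_modeL_of_ne (by omega), norm_modeL_sq, norm_modeL_sq]
    have h0 : (inner ℂ (modeL 0 c₀ + ∑ k ∈ Finset.range K,
        (modeL (k + 1 : ℤ) (c k) + modeL (-(k + 1 : ℤ)) (d k)))
        (modeL (K + 1 : ℤ) (c K) + modeL (-(K + 1 : ℤ)) (d K)) : ℂ) = 0 := by
      rw [inner_add_left, sum_inner, inner_add_right, inner_modeL_of_ne (by omega),
        inner_modeL_of_ne (by omega), Finset.sum_eq_zero, add_zero, add_zero]
      intro k hk
      have hk' := Finset.mem_range.1 hk
      rw [inner_add_left, inner_add_right, inner_add_right, inner_modeL_of_ne (by omega),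
        inner_modeL_of_ne (by omega), inner_modeL_of_ne (by omega), inner_modeL_of_ne (by omega)]
      simp
    rw [h0, Finset.sum_range_succ]
    simp
    ring

/-! ### Santaló's formula in fan-beam coordinates -/


theorem norm_fourier_apply (n : ℤ) (θ : Ang) : ‖(fourier n θ : ℂ)‖ = 1 := Circle.norm_coe _

theorem fourier_one_add (θ φ : Ang) : (fourier 1 (θ + φ) : ℂ) = fourier 1 θ * fourier 1 φ := by
  simp only [fourier_one, AddCircle.toCircle_add, Circle.coe_mul]

theorem fourier_one_coe (x : ℝ) : (fourier 1 ((x : ℝ) : Ang) : ℂ) =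
    Complex.exp (x * Complex.I) := by
  rw [fourier_coe_apply]
  congr 1
  have : (Real.pi : ℂ) ≠ 0 := by exact_mod_cast Real.pi_ne_zero
  push_cast
  field_simp

theorem continuous_rayAngle : Continuous rayAngle := by
  unfold rayAngle
  exact continuous_fst.add ((AddCircle.continuous_mk' _).comp (continuous_const.add continuous_snd))

theorem continuous_rayPoint : Continuous fun p : (Ang × ℝ) × ℝ => rayPoint p.1 p.2 := by
  unfold rayPoint
  have h : Continuous (fourier 1 : C(Ang, ℂ)) := (fourier 1 : C(Ang, ℂ)).continuous
  exact (h.comp (continuous_fst.comp continuous_fst)).add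
    ((Complex.continuous_ofReal.comp continuous_snd).mul
      (h.comp (continuous_rayAngle.comp continuous_fst)))

theorem continuous_exitTime : Continuous exitTime := by
  unfold exitTime; fun_prop

/-- In the frame rotated by the angle of the ray, the ray is horizontal at height `sin α`. -/
theorem rayPoint_eq (q : Ang × ℝ) (t : ℝ) : rayPoint q t =
    fourier 1 (rayAngle q) * (((t - Real.cos q.2 : ℝ) : ℂ) + (Real.sin q.2 : ℝ) * Complex.I) := by
  have h1 : (fourier 1 (rayAngle q) : ℂ) =
      fourier 1 q.1 * Complex.exp ((Real.pi + q.2 : ℝ) * Complex.I) := by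
    rw [rayAngle, fourier_one_add, fourier_one_coe]
  have h2 : Complex.exp ((Real.pi + q.2 : ℝ) * Complex.I) =
      -(Real.cos q.2 + Real.sin q.2 * Complex.I) := by
    push_cast
    rw [add_mul, Complex.exp_add, Complex.exp_pi_mul_I, Complex.exp_mul_I]
    ring
  have h3 : (Real.cos q.2 : ℂ) ^ 2 + (Real.sin q.2 : ℂ) ^ 2 = 1 := by
    exact_mod_cast Real.cos_sq_add_sin_sq q.2
  unfold rayPoint
  rw [h1, h2]
  push_cast at h3 ⊢
  linear_combination (-(fourier 1 q.1 : ℂ)) * h3 +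
    (fourier 1 q.1 : ℂ) * (Complex.sin q.2) ^ 2 * Complex.I_sq

theorem normSq_rayPoint (q : Ang × ℝ) (t : ℝ) :
    ‖rayPoint q t‖ ^ 2 = 1 - t * (exitTime q - t) := by
  rw [rayPoint_eq, norm_mul, norm_fourier_apply, one_mul, ← Complex.normSq_eq_norm_sq,
    Complex.normSq_add_mul_I, exitTime]
  nlinarith [Real.cos_sq_add_sin_sq q.2]

theorem rayPoint_mem_disc {q : Ang × ℝ} {t : ℝ} (h0 : 0 ≤ t) (h1 : t ≤ exitTime q) :
    rayPoint q t ∈ disc := by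
  rw [disc, mem_closedBall_zero_iff, ← sq_le_one_iff₀ (norm_nonneg _), normSq_rayPoint]
  nlinarith [mul_nonneg h0 (sub_nonneg.2 h1)]

theorem mem_disc_iff {s y : ℝ} : ((s : ℂ) + y * Complex.I) ∈ disc ↔ s ^ 2 + y ^ 2 ≤ 1 := by
  rw [disc, mem_closedBall_zero_iff, ← sq_le_one_iff₀ (norm_nonneg _),
    ← Complex.normSq_eq_norm_sq, Complex.normSq_add_mul_I]

theorem ae_cos_pos : ∀ᵐ q ∂inMeasure, 0 < Real.cos q.2 := by
  have h : ∀ᵐ α ∂(volume.restrict (Set.Icc (-(Real.pi / 2)) (Real.pi / 2))),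
      0 < Real.cos α := by
    rw [← restrict_Ioo_eq_restrict_Icc]
    filter_upwards [ae_restrict_mem measurableSet_Ioo] with α hα
    exact Real.cos_pos_of_mem_Ioo hα
  exact Measure.quasiMeasurePreserving_snd.ae h

/-- The integral of `F` along the ray with fan-beam coordinates `q`. -/
noncomputable def rayLIntegral (F : ℂ × Ang → ℝ≥0∞) (q : Ang × ℝ) : ℝ≥0∞ :=
  ∫⁻ t in Set.Ioc 0 (exitTime q), F (rayPoint q t, rayAngle q)

theorem measurable_ray {F : ℂ × Ang → ℝ≥0∞} (hF : Measurable F) :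
    Measurable fun p : (Ang × ℝ) × ℝ => F (rayPoint p.1 p.2, rayAngle p.1) :=
  hF.comp (continuous_rayPoint.measurable.prodMk
    (continuous_rayAngle.measurable.comp measurable_fst))

theorem measurable_rayLIntegral {F : ℂ × Ang → ℝ≥0∞} (hF : Measurable F) :
    Measurable (rayLIntegral F) := by
  have hS : MeasurableSet {p : (Ang × ℝ) × ℝ | p.2 ∈ Set.Ioc 0 (exitTime p.1)} :=
    (measurableSet_lt measurable_const measurable_snd).inter
      (measurableSet_le measurable_snd (continuous_exitTime.measurable.comp measurable_fst))
  have h := ((measurable_ray hF).indicator hS).lintegral_prod_right' (ν := (volume : Measure ℝ))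
  convert h using 1
  funext q
  rw [rayLIntegral, ← lintegral_indicator measurableSet_Ioc]
  rfl

/-- The integral over a chord of the disc, in the frame of the ray. -/
theorem rayLIntegral_eq {F : ℂ × Ang → ℝ≥0∞} {q : Ang × ℝ} (hq : 0 ≤ Real.cos q.2) :
    rayLIntegral F q = ∫⁻ s : ℝ, disc.indicator
      (fun z => F (fourier 1 (rayAngle q) * z, rayAngle q)) (s + Real.sin q.2 * Complex.I) := by
  set G : ℂ → ℝ≥0∞ := fun z => F (fourier 1 (rayAngle q) * z, rayAngle q)
  have h1 : rayLIntegral F q = ∫⁻ t, (Set.Icc 0 (exitTime q)).indicator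
      (fun t => G (((t - Real.cos q.2 : ℝ) : ℂ) + (Real.sin q.2 : ℝ) * Complex.I)) t := by
    rw [lintegral_indicator measurableSet_Icc, rayLIntegral, ← restrict_Ioc_eq_restrict_Icc]
    simp only [rayPoint_eq, G]
  rw [h1, ← lintegral_add_right_eq_self _ (Real.cos q.2)]
  refine lintegral_congr fun s => ?_
  have hiff : s + Real.cos q.2 ∈ Set.Icc 0 (exitTime q) ↔
      ((s : ℂ) + Real.sin q.2 * Complex.I) ∈ disc := by
    rw [mem_disc_iff, exitTime, Set.mem_Icc]
    have h := Real.cos_sq_add_sin_sq q.2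
    constructor
    · rintro ⟨h2, h3⟩
      nlinarith
    · intro h2
      have := abs_le_of_sq_le_sq' (by linarith : s ^ 2 ≤ Real.cos q.2 ^ 2) hq
      constructor <;> linarith [this.1, this.2]
  by_cases h : s + Real.cos q.2 ∈ Set.Icc 0 (exitTime q)
  · rw [Set.indicator_of_mem h, Set.indicator_of_mem (hiff.1 h), add_sub_cancel_right]
  · rw [Set.indicator_of_notMem h, Set.indicator_of_notMem (mt hiff.2 h)]

/-- Integrating over the chords of the disc in a fixed direction. -/
theorem lintegral_parallel_chords {G : ℂ → ℝ≥0∞} (hG : Measurable G) :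
    ∫⁻ α in Set.Icc (-(Real.pi / 2)) (Real.pi / 2), ENNReal.ofReal (Real.cos α) *
      ∫⁻ s : ℝ, disc.indicator G (s + Real.sin α * Complex.I) = ∫⁻ z in disc, G z := by
  have hms : MeasurableSet disc := Metric.isClosed_closedBall.measurableSet
  set J : ℝ → ℝ≥0∞ := fun y => ∫⁻ s : ℝ, disc.indicator G (s + y * Complex.I)
  have himg := lintegral_image_eq_lintegral_abs_deriv_mul
    (measurableSet_Icc (a := -(Real.pi / 2)) (b := Real.pi / 2))
    (fun α _ => (Real.hasDerivAt_sin α).hasDerivWithinAt) Real.injOn_sin J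
  have h1 : ∫⁻ α in Set.Icc (-(Real.pi / 2)) (Real.pi / 2), ENNReal.ofReal (Real.cos α) *
      J (Real.sin α) = ∫⁻ y in Set.Icc (-1) 1, J y := by
    rw [← Real.bijOn_sin.image_eq, himg]
    refine setLIntegral_congr_fun measurableSet_Icc fun α hα => ?_
    simp only [abs_of_nonneg (Real.cos_nonneg_of_mem_Icc hα)]
  have h2 : ∫⁻ y in Set.Icc (-1) 1, J y = ∫⁻ y, J y := by
    rw [← lintegral_indicator measurableSet_Icc]
    refine lintegral_congr fun y => ?_
    by_cases hy : y ∈ Set.Icc (-1 : ℝ) 1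
    · rw [Set.indicator_of_mem hy]
    · rw [Set.indicator_of_notMem hy]
      refine (lintegral_eq_zero_of_ae_eq_zero (Eventually.of_forall fun s => ?_)).symm
      refine Set.indicator_of_notMem (fun h => hy ?_) _
      rw [mem_disc_iff] at h
      exact abs_le.1 (abs_le_one_iff_mul_self_le_one.2 (by nlinarith [sq_nonneg s]))
  have h3 : ∫⁻ y, J y = ∫⁻ z, disc.indicator G z := by
    rw [← Complex.volume_preserving_equiv_real_prod.symm.lintegral_comp (hG.indicator hms)]
    rw [Measure.volume_eq_prod, lintegral_prod_symm]
    · refine lintegral_congr fun y => lintegral_congr fun s => ?_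
      congr 1
      exact (Complex.mk_eq_add_mul_I s y).symm
    · exact ((hG.indicator hms).comp Complex.measurableEquivRealProd.symm.measurable).aemeasurable
  rw [h1, h2, h3, lintegral_indicator hms]

/-- **Santaló's formula**: `∫ cos α ∫_ray F dt dα dβ = ∫_{SM} F`. -/
theorem santalo {F : ℂ × Ang → ℝ≥0∞} (hF : Measurable F) :
    ∫⁻ q, ENNReal.ofReal (Real.cos q.2) * rayLIntegral F q ∂inMeasure = ∫⁻ p, F p ∂smMeasure := by
  have hms : MeasurableSet disc := Metric.isClosed_closedBall.measurableSet
  -- the chord integral as a function of the angle `θ` of the ray and of `α`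
  set K : Ang → ℝ → ℝ≥0∞ := fun θ α => ENNReal.ofReal (Real.cos α) *
    ∫⁻ s : ℝ, disc.indicator (fun z => F (fourier 1 θ * z, θ)) (s + Real.sin α * Complex.I)
  have hKm : Measurable (Function.uncurry K) := by
    have hS : MeasurableSet {p : (Ang × ℝ) × ℝ |
        ((p.2 : ℂ) + Real.sin p.1.2 * Complex.I) ∈ disc} := by
      refine hms.preimage (Continuous.measurable ?_)
      fun_prop
    have hm : Measurable fun p : (Ang × ℝ) × ℝ =>
        F (fourier 1 p.1.1 * ((p.2 : ℂ) + Real.sin p.1.2 * Complex.I), p.1.1) := by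
      refine hF.comp (Continuous.measurable ?_)
      have : Continuous (fourier 1 : C(Ang, ℂ)) := (fourier 1 : C(Ang, ℂ)).continuous
      fun_prop
    have h := (hm.indicator hS).lintegral_prod_right' (ν := (volume : Measure ℝ))
    have hc : Measurable fun p : Ang × ℝ => ENNReal.ofReal (Real.cos p.2) := by fun_prop
    exact hc.mul h
  have h1 : ∫⁻ q, ENNReal.ofReal (Real.cos q.2) * rayLIntegral F q ∂inMeasure =
      ∫⁻ q, K (rayAngle q) q.2 ∂inMeasure := by
    refine lintegral_congr_ae ?_
    filter_upwards [ae_cos_pos] with q hq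
    rw [rayLIntegral_eq hq.le]
  have hKm' : Measurable fun q : Ang × ℝ => K (rayAngle q) q.2 :=
    hKm.comp (continuous_rayAngle.measurable.prodMk measurable_snd)
  rw [h1, inMeasure, lintegral_prod_symm _ hKm'.aemeasurable]
  have h2 : ∀ α : ℝ, ∫⁻ β : Ang, K (rayAngle (β, α)) α = ∫⁻ θ : Ang, K θ α := fun α =>
    lintegral_add_right_eq_self (fun θ : Ang => K θ α) ((Real.pi + α : ℝ) : Ang)
  simp only [h2]
  rw [lintegral_lintegral_swap (f := fun (α : ℝ) θ => K θ α)
    (hKm.comp measurable_swap).aemeasurable, smMeasure, lintegral_prod_symm _ hF.aemeasurable]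
  refine lintegral_congr fun θ => ?_
  have hFθ : Measurable fun z : ℂ => F (z, θ) := hF.comp measurable_prodMk_right
  have hG : Measurable fun z : ℂ => F (fourier 1 θ * z, θ) :=
    hFθ.comp (measurable_const_mul _)
  rw [lintegral_parallel_chords hG, discMeasure, ← lintegral_indicator hms,
    ← lintegral_indicator hms]
  have hrot := (rotation (AddCircle.toCircle θ)).measurePreserving.lintegral_comp
    (hFθ.indicator hms)
  rw [← hrot]
  refine lintegral_congr fun z => ?_
  have hiff : rotation (AddCircle.toCircle θ) z ∈ disc ↔ z ∈ disc := by
    simp only [disc, mem_closedBall_zero_iff, LinearIsometryEquiv.norm_map]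
  by_cases hz : z ∈ disc
  · rw [Set.indicator_of_mem hz, Set.indicator_of_mem (hiff.2 hz), rotation_apply, fourier_one]
  · rw [Set.indicator_of_notMem hz, Set.indicator_of_notMem (mt hiff.1 hz)]

/-! ### The kernel of the attenuated X-ray transform -/


theorem measurable_cos_mul_rayLIntegral {F : ℂ × Ang → ℝ≥0∞} (hF : Measurable F) :
    Measurable fun q : Ang × ℝ => ENNReal.ofReal (Real.cos q.2) * rayLIntegral F q :=
  (ENNReal.measurable_ofReal.comp (Real.measurable_cos.comp measurable_snd)).mul
    (measurable_rayLIntegral hF)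

theorem ae_ray_of_ae {P : ℂ × Ang → Prop} (hP : ∀ᵐ p ∂smMeasure, P p) :
    ∀ᵐ q ∂inMeasure, ∀ᵐ t ∂(volume.restrict (Set.Ioc 0 (exitTime q))),
      P (rayPoint q t, rayAngle q) := by
  obtain ⟨N, hPN, hNm, hN0⟩ := exists_measurable_superset_of_null (ae_iff.1 hP)
  have hF : Measurable (N.indicator (fun _ => (1 : ℝ≥0∞))) := measurable_const.indicator hNm
  have h0 := santalo hF
  rw [lintegral_indicator_const hNm, hN0, mul_zero, lintegral_eq_zero_iff
    (measurable_cos_mul_rayLIntegral hF)] at h0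
  filter_upwards [h0, ae_cos_pos] with q hq hcos
  have h1 : rayLIntegral (N.indicator fun _ => 1) q = 0 := by
    rcases mul_eq_zero.1 hq with h | h
    · exact absurd h (by simpa using hcos)
    · exact h
  have hm : Measurable fun t => N.indicator (fun _ => (1 : ℝ≥0∞)) (rayPoint q t, rayAngle q) :=
    (measurable_ray hF).comp measurable_prodMk_left
  rw [rayLIntegral, lintegral_eq_zero_iff hm] at h1
  filter_upwards [h1] with t ht
  by_contra hcon
  have : (rayPoint q t, rayAngle q) ∈ N := hPN hcon
  simp [this] at ht

theorem ae_rayLIntegral_lt_top {F : ℂ × Ang → ℝ≥0∞} (hF : Measurable F)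
    (hfin : ∫⁻ p, F p ∂smMeasure ≠ ⊤) : ∀ᵐ q ∂inMeasure, rayLIntegral F q < ⊤ := by
  rw [← santalo hF] at hfin
  filter_upwards [ae_lt_top (measurable_cos_mul_rayLIntegral hF) hfin, ae_cos_pos] with q hq hcos
  by_contra hcon
  rw [not_lt, top_le_iff] at hcon
  rw [hcon, ENNReal.mul_top (by simpa using hcos)] at hq
  exact lt_irrefl _ hq

section Continuous

variable {a : ℂ → ℂ} {A : ℝ}

/-- The attenuation factor `exp ∫₀ᵗ a(γ(s)) ds`. -/
noncomputable def attenuation (a : ℂ → ℂ) (q : Ang × ℝ) (t : ℝ) : ℂ :=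
  Complex.exp (∫ s in (0 : ℝ)..t, a (rayPoint q s))

theorem continuous_ray_comp (ha : Continuous a) (q : Ang × ℝ) :
    Continuous fun s => a (rayPoint q s) :=
  ha.comp (continuous_rayPoint.comp (continuous_const.prodMk continuous_id))

theorem hasDerivAt_attenuation (ha : Continuous a) (q : Ang × ℝ) (t : ℝ) :
    HasDerivAt (attenuation a q) (attenuation a q t * a (rayPoint q t)) t :=
  ((continuous_ray_comp ha q).integral_hasStrictDerivAt 0 t).hasDerivAt.cexp

theorem continuous_attenuation (ha : Continuous a) (q : Ang × ℝ) :
    Continuous (attenuation a q) :=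
  continuous_iff_continuousAt.2 fun t => (hasDerivAt_attenuation ha q t).continuousAt

theorem norm_attenuation_le (hA : ∀ z, ‖a z‖ ≤ A) {q : Ang × ℝ} {t : ℝ} (h0 : 0 ≤ t)
    (h1 : t ≤ exitTime q) : ‖attenuation a q t‖ ≤ Real.exp (2 * A) := by
  have hA0 : 0 ≤ A := (norm_nonneg _).trans (hA 0)
  rw [attenuation, Complex.norm_exp]
  refine Real.exp_le_exp.2 ((Complex.re_le_norm _).trans ?_)
  refine (intervalIntegral.norm_integral_le_of_norm_le_const fun s _ => hA _).trans ?_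
  rw [sub_zero, abs_of_nonneg h0, mul_comm]
  gcongr
  refine h1.trans ?_
  have := Real.cos_le_one q.2
  rw [exitTime]; linarith

theorem exitTime_nonneg {q : Ang × ℝ} (hq : 0 < Real.cos q.2) : 0 ≤ exitTime q := by
  rw [exitTime]; positivity

theorem rayIntegrand_eq (a : ℂ → ℂ) (f : ℂ × Ang → ℂ) (q : Ang × ℝ) (t : ℝ) :
    rayIntegrand a f q t = f (rayPoint q t, rayAngle q) * attenuation a q t := rfl

theorem measurable_enorm_coe (f : L2SM) : Measurable fun p => ‖f p‖ₑ :=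
  (Lp.stronglyMeasurable f).measurable.enorm

theorem lintegral_enorm_le (f : L2SM) :
    ∫⁻ p, ‖f p‖ₑ ∂smMeasure ≤ ‖f‖ₑ * smMeasure Set.univ ^ (1 / 2 : ℝ) := by
  have h := eLpNorm_le_eLpNorm_mul_rpow_measure_univ (μ := smMeasure) (p := 1) (q := 2)
    one_le_two (Lp.aestronglyMeasurable f)
  rw [eLpNorm_one_eq_lintegral_enorm] at h
  rw [Lp.enorm_def]
  convert h using 3
  norm_num

theorem lintegral_enorm_ne_top (f : L2SM) : ∫⁻ p, ‖f p‖ₑ ∂smMeasure ≠ ⊤ :=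
  ((lintegral_enorm_le f).trans_lt (ENNReal.mul_lt_top enorm_lt_top
    (ENNReal.rpow_lt_top_of_nonneg (by norm_num) (measure_ne_top _ _)))).ne

/-- The integrals that define the attenuated X-ray transform converge absolutely. -/
theorem ae_intervalIntegrable (ha : Continuous a) (f : L2SM) :
    ∀ᵐ q ∂inMeasure, IntervalIntegrable (rayIntegrand a f q) volume 0 (exitTime q) := by
  filter_upwards [ae_rayLIntegral_lt_top (measurable_enorm_coe f) (lintegral_enorm_ne_top f),
    ae_cos_pos] with q hq hcos
  have h1 : IntervalIntegrable (fun t => f (rayPoint q t, rayAngle q)) volume 0 (exitTime q) := by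
    rw [intervalIntegrable_iff_integrableOn_Ioc_of_le (exitTime_nonneg hcos)]
    refine ⟨?_, hq⟩
    exact ((Lp.stronglyMeasurable f).comp_measurable (((continuous_rayPoint.comp
      (continuous_const.prodMk continuous_id)).measurable).prodMk
        measurable_const)).aestronglyMeasurable
  exact h1.mul_continuousOn (continuous_attenuation ha q).continuousOn

theorem xray_congr {f g : ℂ × Ang → ℂ} (h : f =ᵐ[smMeasure] g) :
    ∀ᵐ q ∂inMeasure, xray a f q = xray a g q := by
  filter_upwards [ae_ray_of_ae h, ae_cos_pos] with q hq hcos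
  refine intervalIntegral.integral_congr_ae ?_
  rw [Set.uIoc_of_le (exitTime_nonneg hcos), ← ae_restrict_iff' measurableSet_Ioc]
  filter_upwards [hq] with t ht
  simp only [rayIntegrand, ht]

theorem xray_add (ha : Continuous a) (f g : L2SM) :
    ∀ᵐ q ∂inMeasure, xray a (f + g : L2SM) q = xray a f q + xray a g q := by
  filter_upwards [xray_congr (a := a) (Lp.coeFn_add f g), ae_intervalIntegrable ha f,
    ae_intervalIntegrable ha g] with q h1 h2 h3
  rw [h1, xray, xray, xray, ← intervalIntegral.integral_add h2 h3]
  simp only [rayIntegrand, Pi.add_apply, add_mul]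

theorem xray_smul (c : ℂ) (f : L2SM) :
    ∀ᵐ q ∂inMeasure, xray a (c • f : L2SM) q = c * xray a f q := by
  filter_upwards [xray_congr (a := a) (Lp.coeFn_smul c f)] with q h1
  rw [h1, xray, xray, ← intervalIntegral.integral_const_mul]
  simp only [rayIntegrand, Pi.smul_apply, smul_eq_mul, mul_assoc]

theorem enorm_xray_le (hA : ∀ z, ‖a z‖ ≤ A) (f : L2SM) {q : Ang × ℝ} (hcos : 0 < Real.cos q.2) :
    ‖xray a f q‖ₑ ≤ ENNReal.ofReal (Real.exp (2 * A)) * rayLIntegral (fun p => ‖f p‖ₑ) q := by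
  rw [xray, intervalIntegral.integral_of_le (exitTime_nonneg hcos)]
  refine (enorm_integral_le_lintegral_enorm _).trans ?_
  rw [rayLIntegral, ← lintegral_const_mul' _ _ ENNReal.ofReal_ne_top]
  refine setLIntegral_mono' measurableSet_Ioc fun t ht => ?_
  rw [rayIntegrand_eq, enorm_mul, mul_comm]
  gcongr
  rw [← ofReal_norm]
  exact ENNReal.ofReal_le_ofReal (norm_attenuation_le hA ht.1.le ht.2)

/-- The kernel of the attenuated X-ray transform on `L²(SM)`. -/
noncomputable def xrayKernel (ha : Continuous a) : Submodule ℂ L2SM where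
  carrier := {f | ∀ᵐ q ∂inMeasure, xray a f q = 0}
  zero_mem' := by
    filter_upwards [xray_smul (a := a) 0 0] with q hq
    rwa [zero_smul, zero_mul] at hq
  add_mem' := fun {f g} hf hg => by
    filter_upwards [hf, hg, xray_add ha f g] with q h1 h2 h3
    rw [h3, h1, h2, add_zero]
  smul_mem' := fun c f hf => by
    filter_upwards [hf, xray_smul c f] with q h1 h2
    rw [h2, h1, mul_zero]

/-- By Santaló's formula the transform is continuous from `L²(SM)` to `L¹(cos α dβ dα)`, so its
kernel is closed. -/
theorem isClosed_xrayKernel (ha : Continuous a) (hA : ∀ z, ‖a z‖ ≤ A) :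
    IsClosed (xrayKernel ha : Set L2SM) := by
  refine isClosed_of_closure_subset fun f hf => ?_
  obtain ⟨g, hg, hlim⟩ := mem_closure_iff_seq_limit.1 hf
  change ∀ᵐ q ∂inMeasure, xray a f q = 0
  have hm : ∀ n, Measurable fun q : Ang × ℝ => ENNReal.ofReal (Real.cos q.2) *
      rayLIntegral (fun p => ‖(f - g n : L2SM) p‖ₑ) q := fun n =>
    measurable_cos_mul_rayLIntegral (measurable_enorm_coe _)
  have hle : ∀ n, ∫⁻ q, ENNReal.ofReal (Real.cos q.2) *
      rayLIntegral (fun p => ‖(f - g n : L2SM) p‖ₑ) q ∂inMeasure ≤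
      ‖f - g n‖ₑ * smMeasure Set.univ ^ (1 / 2 : ℝ) := fun n => by
    rw [santalo (measurable_enorm_coe _)]
    exact lintegral_enorm_le _
  have hto : Tendsto (fun n => ‖f - g n‖ₑ * smMeasure Set.univ ^ (1 / 2 : ℝ)) atTop (𝓝 0) := by
    have h1 : Tendsto (fun n => ‖f - g n‖ₑ) atTop (𝓝 0) := by
      have h2 := (tendsto_const_nhds (x := f)).sub hlim
      rw [sub_self] at h2
      simpa using h2.enorm
    have h3 := ENNReal.Tendsto.mul_const (b := smMeasure Set.univ ^ (1 / 2 : ℝ)) h1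
      (Or.inr (ENNReal.rpow_ne_top_of_nonneg (by norm_num) (measure_ne_top _ _)))
    rwa [zero_mul] at h3
  have hzero : ∫⁻ q, ⨅ n, ENNReal.ofReal (Real.cos q.2) *
      rayLIntegral (fun p => ‖(f - g n : L2SM) p‖ₑ) q ∂inMeasure = 0 := by
    refine le_antisymm (ge_of_tendsto' hto fun n => ?_) (zero_le)
    exact (lintegral_mono fun q => iInf_le _ n).trans (hle n)
  rw [lintegral_eq_zero_iff (Measurable.iInf hm)] at hzero
  have hker : ∀ᵐ q ∂inMeasure, ∀ n, xray a f q = xray a (f - g n : L2SM) q := by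
    rw [ae_all_iff]
    intro n
    filter_upwards [hg n, xray_add ha (f - g n) (g n)] with q h1 h2
    rw [sub_add_cancel, h1, add_zero] at h2
    exact h2
  filter_upwards [hzero, hker, ae_cos_pos] with q h1 h2 hcos
  rw [← enorm_eq_zero, ← nonpos_iff_eq_zero]
  have hE : ENNReal.ofReal (Real.cos q.2) * ‖xray a f q‖ₑ ≤
      ENNReal.ofReal (Real.exp (2 * A)) * ⨅ n, ENNReal.ofReal (Real.cos q.2) *
      rayLIntegral (fun p => ‖(f - g n : L2SM) p‖ₑ) q := by
    rw [ENNReal.mul_iInf_of_ne (by simpa using Real.exp_pos _) ENNReal.ofReal_ne_top]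
    refine le_iInf fun n => ?_
    rw [mul_left_comm]
    gcongr
    rw [h2 n]
    exact enorm_xray_le hA _ hcos
  rw [h1, Pi.zero_apply, mul_zero, nonpos_iff_eq_zero, mul_eq_zero] at hE
  rcases hE with h | h
  · exact absurd h (by simpa using hcos)
  · exact h.le

/-! ### The transport operator -/

theorem memLp_mul (ha : Continuous a) (hA : ∀ z, ‖a z‖ ≤ A) (u : L2M) :
    MemLp (fun z => a z * u z) 2 discMeasure :=
  (Lp.memLp u).of_le_mul (c := A) (ha.aestronglyMeasurable.mul (Lp.aestronglyMeasurable u))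
    (Eventually.of_forall fun z => by
      rw [norm_mul]; exact mul_le_mul_of_nonneg_right (hA z) (norm_nonneg _))

/-- Multiplication by `a` on `L²(M)`. -/
noncomputable def mulL (ha : Continuous a) (hA : ∀ z, ‖a z‖ ≤ A) : L2M →L[ℂ] L2M :=
  LinearMap.mkContinuous
    { toFun := fun u => (memLp_mul ha hA u).toLp _
      map_add' := fun u v => by
        refine Lp.ext ?_
        filter_upwards [(memLp_mul ha hA (u + v)).coeFn_toLp, (memLp_mul ha hA u).coeFn_toLp,
          (memLp_mul ha hA v).coeFn_toLp, Lp.coeFn_add u v,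
          Lp.coeFn_add ((memLp_mul ha hA u).toLp _) ((memLp_mul ha hA v).toLp _)]
          with z h1 h2 h3 h4 h5
        rw [h1, h5, Pi.add_apply, h2, h3, h4, Pi.add_apply, mul_add]
      map_smul' := fun c u => by
        refine Lp.ext ?_
        filter_upwards [(memLp_mul ha hA (c • u)).coeFn_toLp, (memLp_mul ha hA u).coeFn_toLp,
          Lp.coeFn_smul c u, Lp.coeFn_smul c ((memLp_mul ha hA u).toLp _)] with z h1 h2 h3 h4
        rw [h1, RingHom.id_apply, h4, Pi.smul_apply, h2, h3, Pi.smul_apply, smul_eq_mul,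
          smul_eq_mul, mul_left_comm] } A
    fun u => by
      refine Lp.norm_le_mul_norm_of_ae_le_mul ?_
      filter_upwards [(memLp_mul ha hA u).coeFn_toLp] with z hz
      change ‖(memLp_mul ha hA u).toLp _ z‖ ≤ _
      rw [hz, norm_mul]
      exact mul_le_mul_of_nonneg_right (hA z) (norm_nonneg _)

theorem norm_mulL_le (ha : Continuous a) (hA : ∀ z, ‖a z‖ ≤ A) (u : L2M) :
    ‖mulL ha hA u‖ ≤ A * ‖u‖ :=
  (mulL ha hA).le_of_opNorm_le
    (LinearMap.mkContinuous_norm_le _ ((norm_nonneg _).trans (hA 0)) _) u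

theorem coeFn_mulL (ha : Continuous a) (hA : ∀ z, ‖a z‖ ≤ A) (u : L2M) :
    mulL ha hA u =ᵐ[discMeasure] fun z => a z * u z := (memLp_mul ha hA u).coeFn_toLp

/-- `w ↦ (X + a)(e^{imθ} w)` on `H¹₀(M)`, where `X = e^{iθ} ∂ + e^{-iθ} ∂̄` is the geodesic vector
field. -/
noncomputable def transport (ha : Continuous a) (hA : ∀ z, ‖a z‖ ≤ A) (m : ℤ) :
    gradGraph →L[ℂ] L2SM :=
  (modeL (m + 1)).comp dzL + (modeL (m - 1)).comp dzbarL +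
    (modeL m).comp ((mulL ha hA).comp valL)

theorem transport_apply (ha : Continuous a) (hA : ∀ z, ‖a z‖ ≤ A) (m : ℤ) (w : gradGraph) :
    transport ha hA m w = modeL (m + 1) (dzL w) + modeL (m - 1) (dzbarL w) +
      modeL m (mulL ha hA (valL w)) := rfl

theorem fderiv_eq_partial {φ : ℂ → ℂ} (z v : ℂ) :
    fderiv ℝ φ z v = v.re * AttenuatedXray.partialX φ z +
      v.im * AttenuatedXray.partialY φ z := by
  conv_lhs => rw [← Complex.re_add_im v]
  have h1 : ((v.re : ℂ)) = v.re • (1 : ℂ) := by simp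
  have h2 : ((v.im : ℂ)) * Complex.I = v.im • Complex.I := by simp
  rw [map_add, h1, h2, map_smul, map_smul]
  simp [AttenuatedXray.partialX, AttenuatedXray.partialY]

theorem coeFn_transport (ha : Continuous a) (hA : ∀ z, ‖a z‖ ≤ A) (m : ℤ) {φ : ℂ → ℂ}
    (hφ : IsTest φ) : transport ha hA m hφ.toGraph =ᵐ[smMeasure] fun p =>
      fourier m p.2 * (fderiv ℝ φ p.1 (fourier 1 p.2) + a p.1 * φ p.1) := by
  have hq : ∀ {P : ℂ → Prop}, (∀ᵐ z ∂discMeasure, P z) → ∀ᵐ p ∂smMeasure, P p.1 := fun h =>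
    (Measure.quasiMeasurePreserving_fst (μ := discMeasure) (ν := (volume : Measure Ang))).ae h
  rw [transport_apply, modeL_apply, modeL_apply, modeL_apply]
  filter_upwards [Lp.coeFn_add (tensor (fourier (m + 1)) (dzL hφ.toGraph) +
      tensor (fourier (m - 1)) (dzbarL hφ.toGraph))
      (tensor (fourier m) (mulL ha hA (valL hφ.toGraph))),
    Lp.coeFn_add (tensor (fourier (m + 1)) (dzL hφ.toGraph))
      (tensor (fourier (m - 1)) (dzbarL hφ.toGraph)),
    coeFn_tensor (fourier (m + 1)) (dzL hφ.toGraph),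
    coeFn_tensor (fourier (m - 1)) (dzbarL hφ.toGraph),
    coeFn_tensor (fourier m) (mulL ha hA (valL hφ.toGraph)),
    hq (coeFn_dzL hφ), hq (coeFn_dzbarL hφ), hq (coeFn_mulL ha hA (valL hφ.toGraph)),
    hq hφ.coeFn_toL2] with p h1 h2 h3 h4 h5 h6 h7 h8 h9
  rw [h1, Pi.add_apply, h2, Pi.add_apply, h3, h4, h5, h6, h7, h8]
  change _ + fourier m p.2 * (a p.1 * hφ.toL2 p.1) = _
  rw [h9, fderiv_eq_partial p.1 (fourier 1 p.2), sub_eq_add_neg m 1, fourier_add, fourier_add,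
    fourier_neg]
  have hre := Complex.re_eq_add_conj (fourier 1 p.2 : ℂ)
  have him := Complex.im_eq_sub_conj (fourier 1 p.2 : ℂ)
  rw [hre, him]
  field_simp
  linear_combination (-(fourier 1 p.2 : ℂ) * partialY φ p.1 +
    starRingEnd ℂ (fourier 1 p.2) * partialY φ p.1) * Complex.I_sq

/-- The fundamental theorem of calculus along a ray: the transform of `(X + a)(e^{imθ} φ)` vanishes
for a test function `φ`. -/
theorem xray_transport_test (ha : Continuous a) (m : ℤ) {φ : ℂ → ℂ} (hφ : IsTest φ)
    (q : Ang × ℝ) :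
    xray a (fun p => fourier m p.2 * (fderiv ℝ φ p.1 (fourier 1 p.2) + a p.1 * φ p.1)) q = 0 := by
  set g : ℝ → ℂ := fun t => fourier m (rayAngle q) * (φ (rayPoint q t) * attenuation a q t)
  have hray : ∀ t, HasDerivAt (rayPoint q) (fourier 1 (rayAngle q)) t := by
    intro t
    have h := ((Complex.ofRealCLM.hasDerivAt (x := t)).mul_const
      (fourier 1 (rayAngle q) : ℂ)).const_add (fourier 1 q.1 : ℂ)
    exact h.congr_deriv (by simp)
  have hderiv : ∀ t, HasDerivAt g (rayIntegrand a
      (fun p => fourier m p.2 * (fderiv ℝ φ p.1 (fourier 1 p.2) + a p.1 * φ p.1)) q t) t := by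
    intro t
    have h1 : HasDerivAt (fun t => φ (rayPoint q t))
        (fderiv ℝ φ (rayPoint q t) (fourier 1 (rayAngle q))) t :=
      (hφ.differentiable _).hasFDerivAt.comp_hasDerivAt t (hray t)
    refine ((h1.mul (hasDerivAt_attenuation ha q t)).const_mul _).congr_deriv ?_
    rw [rayIntegrand_eq]
    ring
  have hcont : Continuous (rayIntegrand a
      (fun p => fourier m p.2 * (fderiv ℝ φ p.1 (fourier 1 p.2) + a p.1 * φ p.1)) q) := by
    have hr : Continuous (rayPoint q) :=
      continuous_rayPoint.comp (continuous_const.prodMk continuous_id)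
    have h2 := (hφ.fderiv_apply (fourier 1 (rayAngle q))).continuous.comp hr
    have h3 := hφ.continuous.comp hr
    change Continuous fun t => fourier m (rayAngle q) *
      (fderiv ℝ φ (rayPoint q t) (fourier 1 (rayAngle q)) + a (rayPoint q t) * φ (rayPoint q t)) *
      attenuation a q t
    exact (continuous_const.mul (h2.add ((ha.comp hr).mul h3))).mul (continuous_attenuation ha q)
  have hbd : ∀ t, t * (exitTime q - t) = 0 → g t = 0 := by
    intro t ht
    have : φ (rayPoint q t) = 0 := by
      refine hφ.eq_zero fun h => ?_
      rw [mem_ball_zero_iff, ← sq_lt_one_iff₀ (norm_nonneg _), normSq_rayPoint, ht] at h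
      linarith
    simp only [g, this, zero_mul, mul_zero]
  rw [xray, intervalIntegral.integral_eq_sub_of_hasDerivAt (fun t _ => hderiv t)
    (hcont.intervalIntegrable _ _), hbd _ (by ring), hbd _ (by ring), sub_zero]

theorem transport_mem_xrayKernel (ha : Continuous a) (hA : ∀ z, ‖a z‖ ≤ A) (m : ℤ)
    (w : gradGraph) : transport ha hA m w ∈ xrayKernel ha := by
  refine gradGraph_induction (P := fun w => transport ha hA m w ∈ xrayKernel ha)
    ((isClosed_xrayKernel ha hA).preimage (transport ha hA m).continuous) (fun φ hφ => ?_) w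
  change ∀ᵐ q ∂inMeasure, xray a _ q = 0
  filter_upwards [xray_congr (a := a) (coeFn_transport ha hA m hφ)] with q h1
  rw [h1]
  exact xray_transport_test ha m hφ q

end Continuous

/-! ### Extension of the attenuation to the plane -/

/-- The extension of `a` from the disc that is constant on the rays outside the disc. -/
noncomputable def extendDisc (a : ℂ → ℂ) (z : ℂ) : ℂ := a (z / (max 1 ‖z‖ : ℝ))

theorem div_max_mem_disc (z : ℂ) : z / (max 1 ‖z‖ : ℝ) ∈ disc := by
  have h : 0 < max 1 ‖z‖ := lt_max_of_lt_left one_pos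
  rw [disc, mem_closedBall_zero_iff, norm_div, Complex.norm_real, Real.norm_of_nonneg h.le,
    div_le_one h]
  exact le_max_right _ _

theorem continuous_extendDisc {a : ℂ → ℂ} (ha : ContinuousOn a disc) :
    Continuous (extendDisc a) := by
  refine ha.comp_continuous (continuous_id.div (Complex.continuous_ofReal.comp
    (continuous_const.max continuous_norm)) fun z => ?_) div_max_mem_disc
  exact Complex.ofReal_ne_zero.2 (lt_max_of_lt_left one_pos).ne'

theorem extendDisc_eq (a : ℂ → ℂ) {z : ℂ} (hz : z ∈ disc) : extendDisc a z = a z := by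
  rw [disc, mem_closedBall_zero_iff] at hz
  rw [extendDisc, max_eq_left hz, Complex.ofReal_one, div_one]

theorem norm_extendDisc_le {a : ℂ → ℂ} (ha : ContinuousOn a disc) (z : ℂ) :
    ‖extendDisc a z‖ ≤ supNorm a := by
  have hb : BddAbove (Set.range fun z : disc => ‖a z‖) := by
    have h := (isCompact_closedBall (0 : ℂ) 1).bddAbove_image ha.norm
    rwa [Set.image_eq_range] at h
  exact le_ciSup hb ⟨_, div_max_mem_disc z⟩

theorem rayIntegrand_extendDisc (a : ℂ → ℂ) (f : ℂ × Ang → ℂ) {q : Ang × ℝ} {t : ℝ}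
    (h0 : 0 ≤ t) (h1 : t ≤ exitTime q) :
    rayIntegrand (extendDisc a) f q t = rayIntegrand a f q t := by
  unfold rayIntegrand
  congr 2
  refine intervalIntegral.integral_congr fun s hs => ?_
  rw [Set.uIcc_of_le h0] at hs
  exact extendDisc_eq a (rayPoint_mem_disc hs.1 (hs.2.trans h1))

theorem intervalIntegrable_extendDisc_iff (a : ℂ → ℂ) (f : ℂ × Ang → ℂ) {q : Ang × ℝ}
    (hcos : 0 < Real.cos q.2) :
    IntervalIntegrable (rayIntegrand (extendDisc a) f q) volume 0 (exitTime q) ↔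
      IntervalIntegrable (rayIntegrand a f q) volume 0 (exitTime q) := by
  refine intervalIntegrable_congr fun t ht => ?_
  rw [Set.uIoc_of_le (exitTime_nonneg hcos)] at ht
  exact rayIntegrand_extendDisc a f ht.1.le ht.2

theorem xray_extendDisc (a : ℂ → ℂ) (f : ℂ × Ang → ℂ) {q : Ang × ℝ} (hcos : 0 < Real.cos q.2) :
    xray (extendDisc a) f q = xray a f q := by
  refine intervalIntegral.integral_congr fun t ht => ?_
  rw [Set.uIcc_of_le (exitTime_nonneg hcos)] at ht
  exact rayIntegrand_extendDisc a f ht.1 ht.2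

/-! ### Pushing the modes down -/


/-- `S` solves `P w = b` in the least squares sense on `H¹₀(M)`, where `P` and `Q` are the two
Wirtinger derivatives, in either order. -/
structure IsWirtingerSolver (S : L2M →L[ℂ] gradGraph) (P Q : gradGraph →L[ℂ] L2M) : Prop where
  norm_eq : ∀ w, ‖Q w‖ = ‖P w‖
  norm_val_le : ∀ w, ‖valL w‖ ≤ 2 * √poincareConst * ‖P w‖
  inner_eq : ∀ b w, (inner ℂ (P w) (b - P (S b)) : ℂ) = 0

theorem isWirtingerSolver_solveDz : IsWirtingerSolver solveDz dzL dzbarL :=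
  ⟨fun w => (norm_dzL_eq w).2, norm_valL_le, inner_dzL_sub⟩

theorem isWirtingerSolver_solveDzbar : IsWirtingerSolver solveDzbar dzbarL dzL :=
  ⟨fun w => (norm_dzL_eq w).2.symm, fun w => by rw [(norm_dzL_eq w).2]; exact norm_valL_le w,
    inner_dzbarL_sub⟩

theorem summable_of_weighted_le {C T : ℝ} (hC : 4 ≤ C) {x : ℕ → ℝ} (hx : ∀ k, 0 ≤ x k)
    (h : ∀ k, C ^ k * x k ^ 2 ≤ T) : Summable x := by
  have hT : 0 ≤ T := le_trans (by positivity) (h 0)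
  refine Summable.of_nonneg_of_le hx (fun k => ?_)
    ((summable_geometric_of_lt_one (r := (1 / 2 : ℝ)) (by norm_num) (by norm_num)).mul_left √T)
  have h4 : (4 : ℝ) ^ k * x k ^ 2 ≤ T :=
    (mul_le_mul_of_nonneg_right (pow_le_pow_left₀ (by norm_num) hC k) (sq_nonneg _)).trans (h k)
  have h2 : 2 ^ k * x k ≤ √T := by
    refine Real.le_sqrt_of_sq_le ?_
    rw [mul_pow, ← pow_mul, mul_comm k 2, pow_mul]
    norm_num
    exact h4
  rw [one_div, inv_pow, ← div_eq_mul_inv, le_div_iff₀ (by positivity), mul_comm]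
  exact h2

theorem summable_of_summable_weighted {C : ℝ} (hC : 4 ≤ C) {x : ℕ → ℝ} (hx : ∀ k, 0 ≤ x k)
    (h : Summable fun k => C ^ k * x k ^ 2) : Summable x :=
  summable_of_weighted_le hC hx fun k => h.le_tsum k fun j _ => by positivity

section

variable {a : ℂ → ℂ} {A : ℝ}

/-- The contribution `a w` of the mode `b` to the next lower mode, where `w` solves `P w = b`. -/
noncomputable def lowerOne (ha : Continuous a) (hA : ∀ z, ‖a z‖ ≤ A) (S : L2M →L[ℂ] gradGraph) :
    L2M →L[ℂ] L2M := (mulL ha hA).comp (valL.comp S)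

variable (ha : Continuous a) (hA : ∀ z, ‖a z‖ ≤ A) {S : L2M →L[ℂ] gradGraph}
  {P Q : gradGraph →L[ℂ] L2M}

namespace IsWirtingerSolver

theorem norm_sq_split (h : IsWirtingerSolver S P Q) (b : L2M) :
    ‖b‖ ^ 2 = ‖P (S b)‖ ^ 2 + ‖b - P (S b)‖ ^ 2 := by
  have := norm_add_sq (𝕜 := ℂ) (P (S b)) (b - P (S b))
  rw [h.inner_eq, add_sub_cancel] at this
  simpa using this

theorem norm_apply_le (h : IsWirtingerSolver S P Q) (b : L2M) : ‖P (S b)‖ ≤ ‖b‖ :=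
  le_of_sq_le_sq (by rw [h.norm_sq_split b]; linarith [sq_nonneg ‖b - P (S b)‖]) (norm_nonneg _)

theorem norm_mulL_valL_le (h : IsWirtingerSolver S P Q) (w : gradGraph) :
    ‖mulL ha hA (valL w)‖ ≤ 2 * A * √poincareConst * ‖P w‖ := by
  have hA0 : 0 ≤ A := (norm_nonneg _).trans (hA 0)
  calc ‖mulL ha hA (valL w)‖ ≤ A * ‖valL w‖ := norm_mulL_le ha hA _
    _ ≤ A * (2 * √poincareConst * ‖P w‖) := by gcongr; exact h.norm_val_le w
    _ = _ := by ring

theorem norm_lowerOne_le (h : IsWirtingerSolver S P Q) (b : L2M) :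
    ‖lowerOne ha hA S b‖ ≤ 2 * A * √poincareConst * ‖b‖ := by
  have hA0 : 0 ≤ A := (norm_nonneg _).trans (hA 0)
  refine (h.norm_mulL_valL_le ha hA (S b)).trans ?_
  gcongr
  exact h.norm_apply_le b

/-- The sequence `b_k = f_k - a w_k - Q w_{k+1}`, where `w_{k-1} = S b_k`. -/
noncomputable abbrev modes (_ : IsWirtingerSolver S P Q) (f : ℕ → L2M) : ℕ → L2M :=
  recSol (lowerOne ha hA S) (Q.comp S) f

variable {C : ℝ} {f : ℕ → L2M}

theorem summable_modes (h : IsWirtingerSolver S P Q)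
    (hC : C = 4 + 2 * (2 * A * √poincareConst) ^ 2)
    (hf : Summable fun k => C ^ k * ‖f k‖ ^ 2) (k : ℕ) :
    Summable fun j => recCoeff (lowerOne ha hA S) (Q.comp S) j (f (k + j)) := by
  have hA0 : 0 ≤ A := (norm_nonneg _).trans (hA 0)
  have hCpos : 0 < C := by rw [hC]; positivity
  have hs0 : 0 ≤ 2 * A * √poincareConst := by positivity
  have hB : ∀ x, ‖(Q.comp S) x‖ ≤ ‖x‖ := fun x =>
    (h.norm_eq (S x)).le.trans (h.norm_apply_le x)
  refine summable_recCoeff (A := lowerOne ha hA S) (B := Q.comp S)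
    (s := 2 * A * √poincareConst) (C := C) (f := f) (k := k)
    (M := √(∑' k, C ^ k * ‖f k‖ ^ 2)) (h.norm_lowerOne_le ha hA) hB hs0 hC fun j => ?_
  refine Real.le_sqrt_of_sq_le ?_
  rw [mul_pow, ← pow_mul, mul_comm (k + j) 2, pow_mul, Real.sq_sqrt hCpos.le]
  exact hf.le_tsum (k + j) fun i _ => by positivity

theorem modes_eq (h : IsWirtingerSolver S P Q)
    (hC : C = 4 + 2 * (2 * A * √poincareConst) ^ 2)
    (hf : Summable fun k => C ^ k * ‖f k‖ ^ 2) (k : ℕ) :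
    h.modes ha hA f k = f k - mulL ha hA (valL (S (h.modes ha hA f (k + 1)))) -
      Q (S (h.modes ha hA f (k + 2))) :=
  recSol_eq (h.summable_modes ha hA hC hf) k

theorem tendsto_modes (h : IsWirtingerSolver S P Q)
    (hC : C = 4 + 2 * (2 * A * √poincareConst) ^ 2)
    (hf : Summable fun k => C ^ k * ‖f k‖ ^ 2) :
    Tendsto (fun k => C ^ k * ‖h.modes ha hA f k‖ ^ 2) atTop (𝓝 0) := by
  have hA0 : 0 ≤ A := (norm_nonneg _).trans (hA 0)
  have hs0 : 0 ≤ 2 * A * √poincareConst := by positivity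
  have hB : ∀ x, ‖(Q.comp S) x‖ ≤ ‖x‖ := fun x =>
    (h.norm_eq (S x)).le.trans (h.norm_apply_le x)
  exact tendsto_weighted_recSol (A := lowerOne ha hA S) (B := Q.comp S)
    (h.norm_lowerOne_le ha hA) hB hs0 hC hf

theorem summable_norm_modes (h : IsWirtingerSolver S P Q)
    (hC : C = 4 + 2 * (2 * A * √poincareConst) ^ 2)
    (hf : Summable fun k => C ^ k * ‖f k‖ ^ 2) : Summable fun k => ‖h.modes ha hA f k‖ := by
  obtain ⟨T, hT⟩ := (h.tendsto_modes ha hA hC hf).bddAbove_range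
  exact summable_of_weighted_le (by rw [hC]; linarith [sq_nonneg (2 * A * √poincareConst)])
    (fun k => norm_nonneg _) fun k => hT ⟨k, rfl⟩

theorem energy_modes (h : IsWirtingerSolver S P Q)
    (hC : C = 4 + 2 * (2 * A * √poincareConst) ^ 2)
    (hf : Summable fun k => C ^ k * ‖f k‖ ^ 2) :
    Summable (fun k => ‖h.modes ha hA f (k + 1) - P (S (h.modes ha hA f (k + 1)))‖ ^ 2) ∧
    C * ‖P (S (h.modes ha hA f 1))‖ ^ 2 + 8 * ‖P (S (h.modes ha hA f 2))‖ ^ 2 +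
      ∑' k, ‖h.modes ha hA f (k + 1) - P (S (h.modes ha hA f (k + 1)))‖ ^ 2 ≤
      4 * ∑' k, C ^ (k + 1) * ‖f (k + 1)‖ ^ 2 := by
  refine energy_recursion hC (Bn := fun k => ‖h.modes ha hA f k‖) (F := fun k => ‖f k‖)
    (D := fun k => ‖P (S (h.modes ha hA f k))‖)
    (H := fun k => ‖h.modes ha hA f k - P (S (h.modes ha hA f k))‖) (fun k => norm_nonneg _)
    (fun k => h.norm_sq_split _) (fun k => ?_) (h.tendsto_modes ha hA hC hf) hf
  have h1 := h.modes_eq ha hA hC hf k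
  refine (congrArg norm h1).le.trans ((norm_sub_le _ _).trans (add_le_add ((norm_sub_le _ _).trans
    (add_le_add le_rfl (h.norm_mulL_valL_le ha hA _))) (h.norm_eq _).le))

end IsWirtingerSolver

end

/-! ### Fourier series in the angle and the operator `X_⊥` -/

/-- The sum of a pointwise summable sequence of linear maps. -/
noncomputable def tsumLinearMap {V W : Type*} [AddCommGroup V] [Module ℂ V] [NormedAddCommGroup W]
    [NormedSpace ℂ W] (φ : ℕ → V →ₗ[ℂ] W) (h : ∀ v, Summable fun k => φ k v) : V →ₗ[ℂ] W where
  toFun v := ∑' k, φ k v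
  map_add' u v := by simp only [map_add]; exact (h u).tsum_add (h v)
  map_smul' c v := by simp only [map_smul, RingHom.id_apply]; exact (h v).tsum_const_smul c

/-- The norm of `L^{2,κ}(SM)` by real series, with their convergence. -/
theorem wNormSq_eq {κ : ℝ} (hκ : 0 ≤ κ) {f : L2SM} (hf : wNormSq κ f < ⊤) :
    (Summable fun k : ℕ => κ ^ k * ‖momentL (k : ℤ) f‖ ^ 2) ∧
    (Summable fun k : ℕ => κ ^ k * ‖momentL (-(k : ℤ)) f‖ ^ 2) ∧
    wNormSq κ f = ENNReal.ofReal (2 * Real.pi * (‖momentL 0 f‖ ^ 2 +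
      (∑' k : ℕ, κ ^ (k + 1) * ‖momentL (k + 1 : ℤ) f‖ ^ 2 +
        ∑' k : ℕ, κ ^ (k + 1) * ‖momentL (-(k + 1 : ℤ)) f‖ ^ 2))) := by
  have hterm : ∀ k : ℕ, ENNReal.ofReal κ ^ (k + 1) *
      (sqNormM (moment (k + 1 : ℤ) f) + sqNormM (moment (-(k + 1 : ℤ)) f)) =
      ENNReal.ofReal (κ ^ (k + 1) * ‖momentL (k + 1 : ℤ) f‖ ^ 2 +
        κ ^ (k + 1) * ‖momentL (-(k + 1 : ℤ)) f‖ ^ 2) := by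
    intro k
    rw [sqNormM_moment, sqNormM_moment, ← ENNReal.ofReal_add (by positivity) (by positivity),
      ← ENNReal.ofReal_pow hκ, ← ENNReal.ofReal_mul (by positivity), mul_add]
  have hne : ∑' k : ℕ, ENNReal.ofReal (κ ^ (k + 1) * ‖momentL (k + 1 : ℤ) f‖ ^ 2 +
        κ ^ (k + 1) * ‖momentL (-(k + 1 : ℤ)) f‖ ^ 2) ≠ ⊤ := by
    intro htop
    unfold wNormSq at hf
    simp only [hterm] at hf
    rw [htop, add_top, ENNReal.mul_top (by simpa using Real.pi_pos)] at hf
    exact lt_irrefl _ hf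
  have hs : Summable fun k : ℕ => κ ^ (k + 1) * ‖momentL (k + 1 : ℤ) f‖ ^ 2 +
        κ ^ (k + 1) * ‖momentL (-(k + 1 : ℤ)) f‖ ^ 2 := by
    have := ENNReal.summable_toReal hne
    refine this.congr fun k => ?_
    rw [ENNReal.toReal_ofReal (by positivity)]
  have hsp : Summable fun k : ℕ => κ ^ (k + 1) * ‖momentL (k + 1 : ℤ) f‖ ^ 2 :=
    hs.of_nonneg_of_le (fun k => by positivity) fun k => le_add_of_nonneg_right (by positivity)
  have hsn : Summable fun k : ℕ => κ ^ (k + 1) * ‖momentL (-(k + 1 : ℤ)) f‖ ^ 2 :=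
    hs.of_nonneg_of_le (fun k => by positivity) fun k => le_add_of_nonneg_left (by positivity)
  refine ⟨(summable_nat_add_iff 1).1 (by simpa using hsp),
    (summable_nat_add_iff 1).1 (by simpa using hsn), ?_⟩
  unfold wNormSq
  simp only [hterm]
  rw [sqNormM_moment, ← ENNReal.ofReal_tsum_of_nonneg (fun k => by positivity) hs,
    ← ENNReal.ofReal_add (by positivity) (tsum_nonneg fun k => by positivity),
    ← ENNReal.ofReal_mul (by positivity), hsp.tsum_add hsn]

/-- The Fourier series in the angle of a function with summable moments. -/
theorem hasSum_modeL {f : L2SM} (hp : Summable fun k : ℕ => ‖momentL (k : ℤ) f‖)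
    (hn : Summable fun k : ℕ => ‖momentL (-(k : ℤ)) f‖) :
    HasSum (fun k : ℕ => modeL (k + 1 : ℤ) (momentL (k + 1 : ℤ) f) +
      modeL (-(k + 1 : ℤ)) (momentL (-(k + 1 : ℤ)) f)) (f - modeL 0 (momentL 0 f)) := by
  have hs : Summable fun k : ℕ => modeL (k + 1 : ℤ) (momentL (k + 1 : ℤ) f) +
      modeL (-(k + 1 : ℤ)) (momentL (-(k + 1 : ℤ)) f) := by
    refine Summable.add ?_ ?_
    · refine Summable.of_norm ?_
      simp only [norm_modeL]
      exact (((summable_nat_add_iff 1).2 hp).congr fun k => by push_cast; rfl).mul_left _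
    · refine Summable.of_norm ?_
      simp only [norm_modeL]
      exact (((summable_nat_add_iff 1).2 hn).congr fun k => by push_cast; rfl).mul_left _
  convert hs.hasSum using 1
  rw [← sub_eq_zero]
  refine eq_zero_of_momentL fun n => ?_
  have h1 := (hs.hasSum.map (momentL n) (momentL n).continuous).tsum_eq
  rw [map_sub, map_sub, ← h1, momentL_modeL]
  simp only [Function.comp_def, map_add, momentL_modeL]
  obtain ⟨k, rfl | rfl⟩ := n.eq_nat_or_neg
  · rcases k with _ | k
    · have : ∀ k : ℕ, (0 : ℤ) ≠ k + 1 ∧ (0 : ℤ) ≠ -(k + 1) := fun k => by omega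
      simp only [Nat.cast_zero, (this _).1, (this _).2, if_false, if_true, add_zero,
        tsum_zero, sub_self]
    · rw [tsum_eq_single k]
      · have : ((k + 1 : ℕ) : ℤ) ≠ -(k + 1) ∧ ((k + 1 : ℕ) : ℤ) ≠ 0 := by omega
        simp only [this.1, this.2, if_false]
        simp
      · intro j hj
        have : ((k + 1 : ℕ) : ℤ) ≠ -(j + 1) ∧ ((k + 1 : ℕ) : ℤ) ≠ j + 1 := by omega
        simp only [this.1, this.2, if_false, add_zero]
  · rcases k with _ | k
    · have : ∀ k : ℕ, (0 : ℤ) ≠ k + 1 ∧ (0 : ℤ) ≠ -(k + 1) := fun k => by omega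
      simp only [Nat.cast_zero, neg_zero, (this _).1, (this _).2, if_false, if_true, add_zero,
        tsum_zero, sub_self]
    · rw [tsum_eq_single k]
      · have : (-(k + 1 : ℕ) : ℤ) ≠ (k + 1) ∧ (-(k + 1 : ℕ) : ℤ) ≠ 0 := by omega
        simp only [this.1, this.2, if_false]
        simp
      · intro j hj
        have : (-(k + 1 : ℕ) : ℤ) ≠ -(j + 1) ∧ (-(k + 1 : ℕ) : ℤ) ≠ j + 1 := by omega
        simp only [this.1, this.2, if_false, add_zero]

/-- The operator `X_⊥ w = -i e^{iθ} ∂ w + i e^{-iθ} ∂̄ w` on `H¹₀(M)`. -/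
noncomputable def XperpL : gradGraph →L[ℂ] L2SM :=
  (modeL 1).comp ((-Complex.I) • dzL) + (modeL (-1)).comp (Complex.I • dzbarL)

theorem XperpL_apply (w : gradGraph) :
    XperpL w = modeL 1 (-Complex.I • dzL w) + modeL (-1) (Complex.I • dzbarL w) := rfl

theorem Xperp_toH10 (w : gradGraph) : Xperp (toH10 w) = XperpL w := by
  have hdz : dzL w = (1 / 2 : ℂ) • (dxL w - Complex.I • dyL w) := rfl
  have hdzb : dzbarL w = (1 / 2 : ℂ) • (dxL w + Complex.I • dyL w) := rfl
  have hsin : tensor sinA (dxL w) =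
      (-Complex.I / 2) • (modeL 1 (dxL w) - modeL (-1) (dxL w)) := by
    refine Lp.ext ?_
    rw [modeL_apply, modeL_apply]
    filter_upwards [coeFn_tensor sinA (dxL w), coeFn_tensor (fourier 1) (dxL w),
      coeFn_tensor (fourier (-1)) (dxL w),
      Lp.coeFn_smul (-Complex.I / 2) (tensor (fourier 1) (dxL w) - tensor (fourier (-1)) (dxL w)),
      Lp.coeFn_sub (tensor (fourier 1) (dxL w)) (tensor (fourier (-1)) (dxL w))]
      with p h1 h2 h3 h4 h5
    rw [h1, h4, Pi.smul_apply, h5, Pi.sub_apply, h2, h3, fourier_neg, smul_eq_mul]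
    change ((fourier 1 p.2 : ℂ).im : ℂ) * _ = _
    rw [Complex.im_eq_sub_conj]
    field_simp
    linear_combination (dxL w p.1 * ((fourier 1 p.2 : ℂ) - starRingEnd ℂ (fourier 1 p.2))) *
      Complex.I_sq
  have hcos : tensor cosA (dyL w) = (1 / 2 : ℂ) • (modeL 1 (dyL w) + modeL (-1) (dyL w)) := by
    refine Lp.ext ?_
    rw [modeL_apply, modeL_apply]
    filter_upwards [coeFn_tensor cosA (dyL w), coeFn_tensor (fourier 1) (dyL w),
      coeFn_tensor (fourier (-1)) (dyL w),
      Lp.coeFn_smul (1 / 2 : ℂ) (tensor (fourier 1) (dyL w) + tensor (fourier (-1)) (dyL w)),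
      Lp.coeFn_add (tensor (fourier 1) (dyL w)) (tensor (fourier (-1)) (dyL w))]
      with p h1 h2 h3 h4 h5
    rw [h1, h4, Pi.smul_apply, h5, Pi.add_apply, h2, h3, fourier_neg, smul_eq_mul]
    change ((fourier 1 p.2 : ℂ).re : ℂ) * _ = _
    rw [Complex.re_eq_add_conj]
    ring
  have hI : Complex.I * Complex.I = -1 := Complex.I_mul_I
  change tensor sinA (dxL w) - tensor cosA (dyL w) = _
  rw [XperpL_apply, hsin, hcos, hdz, hdzb]
  simp only [map_smul, map_sub, map_add, smul_sub, smul_add, smul_smul]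
  have e1 : -Complex.I * (1 / 2 * Complex.I) = 1 / 2 := by linear_combination (-1 / 2) * hI
  have e2 : Complex.I * (1 / 2 * Complex.I) = -1 / 2 := by linear_combination (1 / 2) * hI
  rw [e1, e2]
  module

/-! ### The telescoping identity and the norm of `g` -/


section

variable {a : ℂ → ℂ} {A : ℝ}

/-- The modes of degree `±1` contain `e^{iθ} ∂w + e^{-iθ} ∂̄w'`, for the first gauge functions `w`
and `w'`. This sum is `X v + X_⊥ g_s`, where `X = e^{iθ} ∂ + e^{-iθ} ∂̄`, and `gaugeEven w w'` is `v`. -/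
noncomputable def gaugeEven (w w' : gradGraph) : gradGraph := (1 / 2 : ℂ) • (w + w')

/-- The potential `g_s` in `e^{iθ} ∂w + e^{-iθ} ∂̄w' = X v + X_⊥ g_s`. -/
noncomputable def gaugeOdd (w w' : gradGraph) : gradGraph := (Complex.I / 2) • (w - w')

theorem XperpL_gaugeOdd (w w' : gradGraph) :
    XperpL (gaugeOdd w w') = (1 / 2 : ℂ) • modeL 1 (dzL w - dzL w') -
      (1 / 2 : ℂ) • modeL (-1) (dzbarL w - dzbarL w') := by
  have e1 : -Complex.I * (Complex.I / 2) = 1 / 2 := by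
    linear_combination (-1 / 2) * Complex.I_sq
  have e2 : Complex.I * (Complex.I / 2) = -(1 / 2) := by
    linear_combination (1 / 2) * Complex.I_sq
  have h1 := (modeL 1).map_smul (-Complex.I * (Complex.I / 2)) (dzL (w - w'))
  have h2 := (modeL (-1)).map_smul (Complex.I * (Complex.I / 2)) (dzbarL (w - w'))
  rw [XperpL_apply, gaugeOdd, dzL.map_smul, dzbarL.map_smul, smul_smul, smul_smul, h1, h2, e1, e2,
    map_sub dzL, map_sub dzbarL, neg_smul]
  exact (sub_eq_add_neg _ _).symm

/-- The telescoping identity: subtracting `(X + a)` of the gauge functions from the modes of `f`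
leaves the modes of `g`, up to the four terms at the top. -/
theorem telescope (ha : Continuous a) (hA : ∀ z, ‖a z‖ ≤ A) (f₀ : L2M) {fP fN hP hN : ℕ → L2M}
    {wP wN : ℕ → gradGraph}
    (eP : ∀ k, fP k = hP k + dzL (wP k) + mulL ha hA (valL (wP (k + 1))) + dzbarL (wP (k + 2)))
    (eN : ∀ k, fN k = hN k + dzbarL (wN k) + mulL ha hA (valL (wN (k + 1))) + dzL (wN (k + 2)))
    (K : ℕ) :
    (modeL 0 f₀ + ∑ k ∈ Finset.range K, (modeL (k + 1 : ℤ) (fP k) + modeL (-(k + 1 : ℤ)) (fN k))) -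
      (modeL 0 (f₀ - dzbarL (wP 1) - dzL (wN 1) -
          mulL ha hA (valL (gaugeEven (wP 0) (wN 0)))) + XperpL (gaugeOdd (wP 0) (wN 0)) +
        ∑ k ∈ Finset.range K, (modeL (k + 1 : ℤ) (hP k) + modeL (-(k + 1 : ℤ)) (hN k))) =
    transport ha hA 0 (gaugeEven (wP 0) (wN 0)) +
      ∑ k ∈ Finset.range K, (transport ha hA (k + 1 : ℤ) (wP (k + 1)) +
        transport ha hA (-(k + 1 : ℤ)) (wN (k + 1))) -
      (modeL (K + 1 : ℤ) (dzL (wP K)) - modeL (K : ℤ) (dzbarL (wP (K + 1))) +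
        (modeL (-(K + 1 : ℤ)) (dzbarL (wN K)) - modeL (-(K : ℤ)) (dzL (wN (K + 1))))) := by
  induction K with
  | zero =>
    rw [XperpL_gaugeOdd]
    simp only [Finset.range_zero, Finset.sum_empty, transport_apply, gaugeEven,
      Nat.cast_zero, zero_add, neg_zero, zero_sub, add_zero, map_sub, map_add, map_smul]
    module
  | succ K ih =>
    rw [Finset.sum_range_succ, Finset.sum_range_succ, Finset.sum_range_succ]
    have i1 : (K + 1 - 1 : ℤ) = K := by ring
    have i2 : (-(K + 1) + 1 : ℤ) = -K := by ring
    have i3 : (-(K + 1) - 1 : ℤ) = -(K + 1 + 1) := by ring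
    push_cast
    rw [eP K, eN K, transport_apply ha hA (K + 1 : ℤ) (wP (K + 1)),
      transport_apply ha hA (-(K + 1) : ℤ) (wN (K + 1)), i1, i2, i3]
    rw [sub_eq_iff_eq_add] at ih
    rw [← add_assoc, ih]
    simp only [map_add]
    abel

theorem parallelogram_gauge (D : gradGraph →L[ℂ] L2M) (w w' : gradGraph) :
    2 * (‖D (gaugeEven w w')‖ ^ 2 + ‖D (gaugeOdd w w')‖ ^ 2) = ‖D w‖ ^ 2 + ‖D w'‖ ^ 2 := by
  have h := parallelogram_law_with_norm ℂ (D w) (D w')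
  rw [gaugeEven, gaugeOdd, map_smul, map_smul, norm_smul, norm_smul, map_add, map_sub, mul_pow,
    mul_pow]
  norm_num
  linarith

/-- The size of the part of `g` of degree zero and of `X_⊥ g_s`. -/
theorem norm_low_le (ha : Continuous a) (hA : ∀ z, ‖a z‖ ≤ A) (f₀ : L2M)
    (w₀ w₁ w₀' w₁' : gradGraph) {C : ℝ} (hC : C = 4 + 2 * (2 * A * √poincareConst) ^ 2) :
    ‖f₀ - dzbarL w₁ - dzL w₁' - mulL ha hA (valL (gaugeEven w₀ w₀'))‖ ^ 2 +
      2 * ‖dzL (gaugeOdd w₀ w₀')‖ ^ 2 ≤ 4 * ‖f₀‖ ^ 2 +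
      (C * ‖dzL w₀‖ ^ 2 + 8 * ‖dzL w₁‖ ^ 2) + (C * ‖dzbarL w₀'‖ ^ 2 + 8 * ‖dzbarL w₁'‖ ^ 2) := by
  set s := 2 * A * √poincareConst
  have h1 := isWirtingerSolver_solveDz.norm_mulL_valL_le ha hA (gaugeEven w₀ w₀')
  have h2 := parallelogram_gauge dzL w₀ w₀'
  rw [(norm_dzL_eq w₀').2, (norm_dzL_eq w₁').2]
  have h3 : ‖f₀ - dzbarL w₁ - dzL w₁' - mulL ha hA (valL (gaugeEven w₀ w₀'))‖ ≤
      ‖f₀‖ + ‖dzL w₁‖ + ‖dzL w₁'‖ + s * ‖dzL (gaugeEven w₀ w₀')‖ := by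
    refine (norm_sub_le _ _).trans (add_le_add ((norm_sub_le _ _).trans (add_le_add
      ((norm_sub_le _ _).trans (add_le_add le_rfl (norm_dzL_eq w₁).2.le)) le_rfl)) h1)
  have h4 := pow_le_pow_left₀ (norm_nonneg _) h3 2
  set F := ‖f₀‖
  set x := ‖dzL w₁‖
  set y := ‖dzL w₁'‖
  set v := ‖dzL (gaugeEven w₀ w₀')‖
  set p := ‖dzL (gaugeOdd w₀ w₀')‖
  have h5 : (F + x + y + s * v) ^ 2 ≤ 4 * F ^ 2 + 8 * x ^ 2 + 8 * y ^ 2 + 2 * (s * v) ^ 2 := by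
    nlinarith [sq_nonneg (F - (x + y)), sq_nonneg (x - y), sq_nonneg (s * v - F - (x + y))]
  have h6 : 0 ≤ s ^ 2 * p ^ 2 := by positivity
  have h7 : 0 ≤ v ^ 2 := by positivity
  have h8 : s ^ 2 * (2 * (v ^ 2 + p ^ 2)) = s ^ 2 * (‖dzL w₀‖ ^ 2 + ‖dzL w₀'‖ ^ 2) := by rw [h2]
  have h9 : 0 ≤ s ^ 2 * (‖dzL w₀‖ ^ 2 + ‖dzL w₀'‖ ^ 2) := by positivity
  rw [hC]
  nlinarith [sq_nonneg ‖dzL w₀‖, sq_nonneg ‖dzL w₀'‖]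

/-- The norm of a partial sum of `g`: since `h_{±1}` is orthogonal to the derivatives of `g_s`, the
modes of degree `±1` split by Pythagoras' theorem. -/
theorem norm_partial_sq (g₀ : L2M) (w : gradGraph) {hP hN : ℕ → L2M}
    (oP : (inner ℂ (dzL w) (hP 0) : ℂ) = 0) (oN : (inner ℂ (dzbarL w) (hN 0) : ℂ) = 0) (K : ℕ) :
    ‖modeL 0 g₀ + XperpL w + ∑ k ∈ Finset.range (K + 1),
      (modeL (k + 1 : ℤ) (hP k) + modeL (-(k + 1 : ℤ)) (hN k))‖ ^ 2 =
    2 * Real.pi * (‖g₀‖ ^ 2 + 2 * ‖dzL w‖ ^ 2 +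
      ∑ k ∈ Finset.range (K + 1), (‖hP k‖ ^ 2 + ‖hN k‖ ^ 2)) := by
  let c : ℕ → L2M := fun k => Nat.casesOn k (hP 0 + -Complex.I • dzL w) fun k => hP (k + 1)
  let d : ℕ → L2M := fun k => Nat.casesOn k (hN 0 + Complex.I • dzbarL w) fun k => hN (k + 1)
  have h := norm_sum_modeL_sq g₀ c d (K + 1)
  rw [Finset.sum_range_succ', Finset.sum_range_succ'] at h
  rw [Finset.sum_range_succ', Finset.sum_range_succ']
  have h1 : ‖c 0‖ ^ 2 = ‖hP 0‖ ^ 2 + ‖dzL w‖ ^ 2 := by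
    change ‖hP 0 + -Complex.I • dzL w‖ ^ 2 = _
    have o : (inner ℂ (hP 0) (dzL w) : ℂ) = 0 := inner_eq_zero_symm.1 oP
    rw [norm_add_sq (𝕜 := ℂ), inner_smul_right, o, norm_smul]
    simp
  have h2 : ‖d 0‖ ^ 2 = ‖hN 0‖ ^ 2 + ‖dzL w‖ ^ 2 := by
    change ‖hN 0 + Complex.I • dzbarL w‖ ^ 2 = _
    have o : (inner ℂ (hN 0) (dzbarL w) : ℂ) = 0 := inner_eq_zero_symm.1 oN
    rw [norm_add_sq (𝕜 := ℂ), inner_smul_right, o, norm_smul, (norm_dzL_eq w).2]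
    simp
  rw [h1, h2] at h
  have c0 : c 0 = hP 0 + -Complex.I • dzL w := rfl
  have d0 : d 0 = hN 0 + Complex.I • dzbarL w := rfl
  have c1 : ∀ k, c (k + 1) = hP (k + 1) := fun _ => rfl
  have d1 : ∀ k, d (k + 1) = hN (k + 1) := fun _ => rfl
  simp only [c0, d0, c1, d1, map_add, Nat.cast_zero, zero_add] at h
  calc _ = _ := by
        congr 2
        simp only [XperpL_apply, Nat.cast_zero, zero_add]
        abel
    _ = _ := h
    _ = _ := by ring

end

/-- The modes of the solution of the recursion depend linearly on the data. -/
theorem IsWirtingerSolver.exists_linear_modes {a : ℂ → ℂ} {A : ℝ} (ha : Continuous a)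
    (hA : ∀ z, ‖a z‖ ≤ A) {S : L2M →L[ℂ] gradGraph} {P Q : gradGraph →L[ℂ] L2M}
    (h : IsWirtingerSolver S P Q) {C : ℝ} (hC : C = 4 + 2 * (2 * A * √poincareConst) ^ 2)
    {V : Type*} [AddCommGroup V] [Module ℂ V] (F : ℕ → V →ₗ[ℂ] L2M)
    (hF : ∀ v, Summable fun k => C ^ k * ‖F k v‖ ^ 2) :
    ∃ b : ℕ → V →ₗ[ℂ] L2M, ∀ v k, b k v = h.modes ha hA (fun k => F k v) k :=
  ⟨fun k => tsumLinearMap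
    (fun j => (recCoeff (lowerOne ha hA S) (Q.comp S) j).toLinearMap ∘ₗ F (k + j))
    fun v => h.summable_modes ha hA hC (hF v) k, fun _ _ => rfl⟩

/-! ### The gauge representative -/


section

variable {a : ℂ → ℂ} {A : ℝ}

/-- In the limit the top terms of the telescoping identity disappear, so that `f - g` is a limit of
functions `(X + a) w` and has vanishing transform. -/
theorem sub_mem_xrayKernel (ha : Continuous a) (hA : ∀ z, ‖a z‖ ≤ A) {f : L2SM}
    {hP hN : ℕ → L2M} {wP wN : ℕ → gradGraph}
    (eP : ∀ k : ℕ, momentL (k + 1 : ℤ) f =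
      hP k + dzL (wP k) + mulL ha hA (valL (wP (k + 1))) + dzbarL (wP (k + 2)))
    (eN : ∀ k : ℕ, momentL (-(k + 1 : ℤ)) f =
      hN k + dzbarL (wN k) + mulL ha hA (valL (wN (k + 1))) + dzL (wN (k + 2)))
    (hp : Summable fun k : ℕ => ‖momentL (k : ℤ) f‖)
    (hn : Summable fun k : ℕ => ‖momentL (-(k : ℤ)) f‖)
    (tP : Tendsto (fun k => ‖dzL (wP k)‖) atTop (𝓝 0))
    (tN : Tendsto (fun k => ‖dzL (wN k)‖) atTop (𝓝 0))
    (hs : Summable fun k : ℕ => modeL (k + 1 : ℤ) (hP k) + modeL (-(k + 1 : ℤ)) (hN k)) :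
    f - (modeL 0 (momentL 0 f - dzbarL (wP 1) - dzL (wN 1) -
      mulL ha hA (valL (gaugeEven (wP 0) (wN 0)))) + XperpL (gaugeOdd (wP 0) (wN 0)) +
        ∑' k : ℕ, (modeL (k + 1 : ℤ) (hP k) + modeL (-(k + 1 : ℤ)) (hN k))) ∈ xrayKernel ha := by
  have hm : ∀ (n : ℕ → ℤ) {D : gradGraph →L[ℂ] L2M} {w : ℕ → gradGraph},
      (∀ w, ‖D w‖ = ‖dzL w‖) → Tendsto (fun k => ‖dzL (w k)‖) atTop (𝓝 0) →
      Tendsto (fun k => modeL (n k) (D (w k))) atTop (𝓝 0) := by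
    intro n D w hD hw
    rw [tendsto_zero_iff_norm_tendsto_zero]
    simp only [norm_modeL, hD]
    simpa using hw.const_mul √(2 * Real.pi)
  have hE := ((hm (fun k => k + 1) (fun _ => rfl) tP).sub
    (hm (fun k => k) (fun w => (norm_dzL_eq w).2) ((tendsto_add_atTop_iff_nat 1).2 tP))).add
    ((hm (fun k => -(k + 1)) (fun w => (norm_dzL_eq w).2) tN).sub
    (hm (fun k => -k) (fun _ => rfl) ((tendsto_add_atTop_iff_nat 1).2 tN)))
  have hF := (hasSum_modeL hp hn).tendsto_sum_nat.const_add (modeL 0 (momentL 0 f))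
  have hG := hs.hasSum.tendsto_sum_nat.const_add (modeL 0 (momentL 0 f - dzbarL (wP 1) -
    dzL (wN 1) - mulL ha hA (valL (gaugeEven (wP 0) (wN 0)))) + XperpL (gaugeOdd (wP 0) (wN 0)))
  have hlim := (hF.sub hG).add hE
  rw [add_sub_cancel, sub_zero, add_zero, add_zero] at hlim
  refine (isClosed_xrayKernel ha hA).mem_of_tendsto hlim (Eventually.of_forall fun K => ?_)
  rw [telescope ha hA (momentL 0 f) eP eN K, sub_add_cancel]
  exact Submodule.add_mem _ (transport_mem_xrayKernel ha hA _ _) (Submodule.sum_mem _ fun k _ =>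
    Submodule.add_mem _ (transport_mem_xrayKernel ha hA _ _) (transport_mem_xrayKernel ha hA _ _))

/-- Functions with `f - g` in the kernel of the transform for the continuous extension of `a` have
the same transform for `a`. -/
theorem ae_xray_eq_of_sub_mem (ha : ContinuousOn a disc) {f g : L2SM}
    (h : f - g ∈ xrayKernel (continuous_extendDisc ha)) :
    ∀ᵐ q ∂inMeasure, IntervalIntegrable (rayIntegrand a f q) volume 0 (exitTime q) ∧
      IntervalIntegrable (rayIntegrand a g q) volume 0 (exitTime q) ∧
      xray a g q = xray a f q := by
  have he := continuous_extendDisc ha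
  have h0 : ∀ᵐ q ∂inMeasure, xray (extendDisc a) (f - g : L2SM) q = 0 := h
  filter_upwards [ae_cos_pos, ae_intervalIntegrable he f, ae_intervalIntegrable he g, h0,
    xray_add he (f - g) g] with q hc hf hg hq hadd
  refine ⟨(intervalIntegrable_extendDisc_iff a f hc).1 hf,
    (intervalIntegrable_extendDisc_iff a g hc).1 hg, ?_⟩
  rw [sub_add_cancel, hq, zero_add] at hadd
  rw [← xray_extendDisc a f hc, ← xray_extendDisc a g hc, hadd]

end

/-- The norm of `g`, the limit of `norm_partial_sq`. -/
theorem norm_sq_eq (g₀ : L2M) (w : gradGraph) {hP hN : ℕ → L2M}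
    (oP : (inner ℂ (dzL w) (hP 0) : ℂ) = 0) (oN : (inner ℂ (dzbarL w) (hN 0) : ℂ) = 0)
    (sP : Summable fun k => ‖hP k‖ ^ 2) (sN : Summable fun k => ‖hN k‖ ^ 2)
    (hs : Summable fun k : ℕ => modeL (k + 1 : ℤ) (hP k) + modeL (-(k + 1 : ℤ)) (hN k)) :
    ‖modeL 0 g₀ + XperpL w +
      ∑' k : ℕ, (modeL (k + 1 : ℤ) (hP k) + modeL (-(k + 1 : ℤ)) (hN k))‖ ^ 2 =
    2 * Real.pi * (‖g₀‖ ^ 2 + 2 * ‖dzL w‖ ^ 2 + (∑' k, ‖hP k‖ ^ 2 + ∑' k, ‖hN k‖ ^ 2)) := by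
  have h1 := ((hs.hasSum.tendsto_sum_nat.const_add (modeL 0 g₀ + XperpL w)).norm.pow 2).comp
    (tendsto_add_atTop_nat 1)
  have h2 := (((sP.hasSum.add sN.hasSum).tendsto_sum_nat.const_add
    (‖g₀‖ ^ 2 + 2 * ‖dzL w‖ ^ 2)).const_mul (2 * Real.pi)).comp (tendsto_add_atTop_nat 1)
  exact tendsto_nhds_unique h1 (h2.congr fun K => (norm_partial_sq g₀ w oP oN K).symm)

theorem tensor_one (u : L2M) : tensor 1 u = modeL 0 u := by
  have h : (1 : C(Ang, ℂ)) = fourier 0 := by ext; exact fourier_zero.symm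
  rw [modeL_apply, h]

/-- The constant of the theorem is the weight `4 + 2 s²` of the recursion, where `s = 2 a_∞ √C_P`
bounds `‖a w‖ / ‖∂w‖` on `H¹₀(M)`. -/
theorem stabConst_eq (a : ℂ → ℂ) :
    stabConst a = 4 + 2 * (2 * supNorm a * √poincareConst) ^ 2 := by
  rw [stabConst, mul_pow, Real.sq_sqrt poincareConst_nonneg]
  ring

end AttenuatedXray

open AttenuatedXray in
theorem theorem2p2 (a : ℂ → ℂ) (ha : ContinuousOn a AttenuatedXray.disc) :
    ∃ G : AttenuatedXray.L2w (AttenuatedXray.stabConst a) →ₗ[ℂ] AttenuatedXray.L2SM,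
      ∀ f : AttenuatedXray.L2w (AttenuatedXray.stabConst a),
        (∀ᵐ q ∂AttenuatedXray.inMeasure,
          IntervalIntegrable (AttenuatedXray.rayIntegrand a (f : AttenuatedXray.L2SM) q)
            volume 0 (AttenuatedXray.exitTime q) ∧
          IntervalIntegrable (AttenuatedXray.rayIntegrand a (G f) q)
            volume 0 (AttenuatedXray.exitTime q) ∧
          AttenuatedXray.xray a (G f) q = AttenuatedXray.xray a (f : AttenuatedXray.L2SM) q) ∧
        (∃ (g₀ : AttenuatedXray.L2M) (gs : AttenuatedXray.H10)
            (g : ℕ → AttenuatedXray.L2SM) (S : AttenuatedXray.L2SM),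
          (∀ k : ℕ, g k ∈ AttenuatedXray.Hsol (k + 1)) ∧ HasSum g S ∧
          G f = AttenuatedXray.tensor 1 g₀ + AttenuatedXray.Xperp gs + S) ∧
        ‖G f‖ₑ ^ 2 ≤ 4 * AttenuatedXray.wNormSq (AttenuatedXray.stabConst a)
          (f : AttenuatedXray.L2SM) := by
  have he := continuous_extendDisc ha
  have hA := norm_extendDisc_le ha
  have hC := stabConst_eq a
  have hC4 : 4 ≤ stabConst a := by
    rw [hC]; linarith [sq_nonneg (2 * supNorm a * √poincareConst)]
  have hC0 : 0 ≤ stabConst a := by linarith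
  have hw : ∀ f : L2w (stabConst a), _ := fun f => wNormSq_eq hC0 (f := (f : L2SM)) f.2
  let hzP := isWirtingerSolver_solveDz
  let hzN := isWirtingerSolver_solveDzbar
  let FP : ℕ → L2w (stabConst a) →ₗ[ℂ] L2M := fun k =>
    (momentL (k : ℤ)).toLinearMap ∘ₗ (L2w (stabConst a)).subtype
  let FN : ℕ → L2w (stabConst a) →ₗ[ℂ] L2M := fun k =>
    (momentL (-(k : ℤ))).toLinearMap ∘ₗ (L2w (stabConst a)).subtype
  obtain ⟨bP, hbP⟩ := hzP.exists_linear_modes he hA hC FP fun f => (hw f).1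
  obtain ⟨bN, hbN⟩ := hzN.exists_linear_modes he hA hC FN fun f => (hw f).2.1
  -- the gauge functions, and what remains of the modes `b_{k+1}` without their derivatives
  let wP : ℕ → L2w (stabConst a) →ₗ[ℂ] gradGraph := fun k => solveDz.toLinearMap ∘ₗ bP (k + 1)
  let wN : ℕ → L2w (stabConst a) →ₗ[ℂ] gradGraph := fun k => solveDzbar.toLinearMap ∘ₗ bN (k + 1)
  let hP : ℕ → L2w (stabConst a) →ₗ[ℂ] L2M := fun k => bP (k + 1) - dzL.toLinearMap ∘ₗ wP k
  let hN : ℕ → L2w (stabConst a) →ₗ[ℂ] L2M := fun k => bN (k + 1) - dzbarL.toLinearMap ∘ₗ wN k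
  have sbP : ∀ f, Summable fun k => ‖bP k f‖ := fun f => by
    simp only [hbP]
    exact hzP.summable_norm_modes he hA hC (hw f).1
  have sbN : ∀ f, Summable fun k => ‖bN k f‖ := fun f => by
    simp only [hbN]
    exact hzN.summable_norm_modes he hA hC (hw f).2.1
  have nP : ∀ k f, ‖hP k f‖ ≤ ‖bP (k + 1) f‖ := fun k f =>
    le_of_sq_le_sq (by
      rw [hzP.norm_sq_split (bP (k + 1) f)]; exact le_add_of_nonneg_left (sq_nonneg _))
      (norm_nonneg _)
  have nN : ∀ k f, ‖hN k f‖ ≤ ‖bN (k + 1) f‖ := fun k f =>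
    le_of_sq_le_sq (by
      rw [hzN.norm_sq_split (bN (k + 1) f)]; exact le_add_of_nonneg_left (sq_nonneg _))
      (norm_nonneg _)
  let g : ℕ → L2w (stabConst a) →ₗ[ℂ] L2SM := fun k =>
    (modeL (k + 1 : ℤ)).toLinearMap ∘ₗ hP k + (modeL (-(k + 1 : ℤ))).toLinearMap ∘ₗ hN k
  have hg : ∀ f, Summable fun k => g k f := by
    intro f
    refine Summable.add (Summable.of_norm ?_) (Summable.of_norm ?_)
    · refine ((((summable_nat_add_iff 1).2 (sbP f)).mul_left √(2 * Real.pi))).of_nonneg_of_le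
        (fun k => norm_nonneg _) fun k => ?_
      exact (norm_modeL _ _).le.trans (mul_le_mul_of_nonneg_left (nP k f) (Real.sqrt_nonneg _))
    · refine ((((summable_nat_add_iff 1).2 (sbN f)).mul_left √(2 * Real.pi))).of_nonneg_of_le
        (fun k => norm_nonneg _) fun k => ?_
      exact (norm_modeL _ _).le.trans (mul_le_mul_of_nonneg_left (nN k f) (Real.sqrt_nonneg _))
  -- `FP 0 f` is the moment `f_0`; the other terms come from the modes of degree `±2` and `±1`
  let g₀ : L2w (stabConst a) →ₗ[ℂ] L2M := FP 0 - dzbarL.toLinearMap ∘ₗ wP 1 -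
    dzL.toLinearMap ∘ₗ wN 1 -
    ((mulL he hA).comp valL).toLinearMap ∘ₗ ((1 / 2 : ℂ) • (wP 0 + wN 0))
  let gs : L2w (stabConst a) →ₗ[ℂ] gradGraph := (Complex.I / 2) • (wP 0 - wN 0)
  refine ⟨(modeL 0).toLinearMap ∘ₗ g₀ + XperpL.toLinearMap ∘ₗ gs + tsumLinearMap g hg,
    fun f => ⟨ae_xray_eq_of_sub_mem ha ?_, ⟨g₀ f, toH10 (gs f), fun k => g k f, ∑' k, g k f, ?_,
      (hg f).hasSum, ?_⟩, ?_⟩⟩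
  · refine sub_mem_xrayKernel (f := (f : L2SM)) (hP := fun k => hP k f) (hN := fun k => hN k f)
      (wP := fun k => wP k f) (wN := fun k => wN k f) he hA ?_ ?_ ?_ ?_ ?_ ?_ (hg f)
    · intro k
      have h := hzP.modes_eq he hA hC (hw f).1 (k + 1)
      have h' : bP (k + 1) f = momentL (k + 1 : ℤ) (f : L2SM) -
          mulL he hA (valL (wP (k + 1) f)) - dzbarL (wP (k + 2) f) := by
        simp only [wP, LinearMap.comp_apply, hbP]
        exact_mod_cast h
      change _ = bP (k + 1) f - dzL (wP k f) + dzL (wP k f) + _ + _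
      rw [h']
      abel
    · intro k
      have h := hzN.modes_eq he hA hC (hw f).2.1 (k + 1)
      have h' : bN (k + 1) f = momentL (-(k + 1 : ℤ)) (f : L2SM) -
          mulL he hA (valL (wN (k + 1) f)) - dzL (wN (k + 2) f) := by
        simp only [wN, LinearMap.comp_apply, hbN]
        exact_mod_cast h
      change _ = bN (k + 1) f - dzbarL (wN k f) + dzbarL (wN k f) + _ + _
      rw [h']
      abel
    · exact summable_of_summable_weighted hC4 (fun k => norm_nonneg _) (hw f).1
    · exact summable_of_summable_weighted hC4 (fun k => norm_nonneg _) (hw f).2.1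
    · exact squeeze_zero (fun k => norm_nonneg _) (fun k => hzP.norm_apply_le _)
        ((summable_nat_add_iff 1).2 (sbP f)).tendsto_atTop_zero
    · refine squeeze_zero (fun k => norm_nonneg _)
        (fun k => (norm_dzL_eq _).2.symm.le.trans (hzN.norm_apply_le _))
        ((summable_nat_add_iff 1).2 (sbN f)).tendsto_atTop_zero
  · intro k
    refine ⟨hP k f, hN k f, isHolo_sub_solveDz _, isAntiholo_sub_solveDzbar _, ?_⟩
    rw [← modeL_apply, ← modeL_apply, Nat.cast_succ]
    rfl
  · rw [tensor_one, Xperp_toH10]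
    rfl
  · obtain ⟨sP, hEP⟩ := hzP.energy_modes he hA hC (hw f).1
    obtain ⟨sN, hEN⟩ := hzN.energy_modes he hA hC (hw f).2.1
    have sP' : Summable fun k => ‖hP k f‖ ^ 2 := by
      simp only [hP, wP, LinearMap.sub_apply, LinearMap.comp_apply, hbP]
      exact sP
    have sN' : Summable fun k => ‖hN k f‖ ^ 2 := by
      simp only [hN, wN, LinearMap.sub_apply, LinearMap.comp_apply, hbN]
      exact sN
    have eP : stabConst a * ‖dzL (wP 0 f)‖ ^ 2 + 8 * ‖dzL (wP 1 f)‖ ^ 2 + ∑' k, ‖hP k f‖ ^ 2 ≤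
        4 * ∑' k : ℕ, stabConst a ^ (k + 1) * ‖momentL (k + 1 : ℤ) (f : L2SM)‖ ^ 2 := by
      simp only [hP, wP, LinearMap.sub_apply, LinearMap.comp_apply, hbP]
      exact_mod_cast hEP
    have eN : stabConst a * ‖dzbarL (wN 0 f)‖ ^ 2 + 8 * ‖dzbarL (wN 1 f)‖ ^ 2 +
        ∑' k, ‖hN k f‖ ^ 2 ≤
        4 * ∑' k : ℕ, stabConst a ^ (k + 1) * ‖momentL (-(k + 1 : ℤ)) (f : L2SM)‖ ^ 2 := by
      simp only [hN, wN, LinearMap.sub_apply, LinearMap.comp_apply, hbN]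
      exact_mod_cast hEN
    have hlow := norm_low_le he hA (momentL 0 (f : L2SM)) (wP 0 f) (wP 1 f) (wN 0 f) (wN 1 f) hC
    have hn := norm_sq_eq (g₀ f) (gs f) (hP := fun k => hP k f) (hN := fun k => hN k f)
      (inner_dzL_sub _ _) (inner_dzbarL_sub _ _) sP' sN' (hg f)
    have hreal : ‖(modeL 0).toLinearMap (g₀ f) + XperpL (gs f) + ∑' k, g k f‖ ^ 2 ≤
        4 * (2 * Real.pi * (‖momentL 0 (f : L2SM)‖ ^ 2 +
        (∑' k : ℕ, stabConst a ^ (k + 1) * ‖momentL (k + 1 : ℤ) (f : L2SM)‖ ^ 2 +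
          ∑' k : ℕ, stabConst a ^ (k + 1) * ‖momentL (-(k + 1 : ℤ)) (f : L2SM)‖ ^ 2))) := by
      refine hn.le.trans ?_
      rw [mul_left_comm]
      refine mul_le_mul_of_nonneg_left ?_ Real.two_pi_pos.le
      change ‖g₀ f‖ ^ 2 + 2 * ‖dzL (gs f)‖ ^ 2 ≤ _ at hlow
      linarith
    rw [(hw f).2.2, ← ofReal_norm, ← ENNReal.ofReal_pow (norm_nonneg _)]
    refine (ENNReal.ofReal_le_ofReal hreal).trans ?_
    rw [ENNReal.ofReal_mul (by norm_num)]
    norm_num
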